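/- Let $p,q\ge 0$ be integers, not both $0$, let $\omega=e^{\pi i/3}$ and $z=p+q\omega$. The icosahedral fullerene with Coxeter parameters $(p,q)$ is obtained by replacing each of the twenty triangles (cells) of the icosahedron, consistently with orientation, by the equilateral triangle with corners $0,z,\omega z$ in the plane. Its faces are the points of the triangular lattice $\mathbb Z+\mathbb Z\omega$ in the cells, identified along the edges of the icosahedron, and two faces are adjacent if their lattice points are at distance $1$ after developing one cell, or two cells with a common edge, in the plane; the twelve corners of the cells are the pentagons and all other faces are hexagons. A lattice segment is a sequence of distinct faces, each adjacent to the next, that enters and leaves each hexagon between its two ends through opposite sides, all faces strictly between its two ends being hexagons. A system of cuts consists of one lattice segment (possibly a single face) starting at each non-hexagonal face, such that two different cuts have no face in common except possibly their common last face. An orbital coloring is a proper coloring of the faces with four colors for which there are a system of cuts and a partition of the faces into orbits such that: (1) orbits run along weaving lines, that is, along the lines parallel to one axis in the lattice unfolded along the cuts: for every hexagon $v$ that lies on no cut, the orbit of $v$ contains the two neighbours of $v$ across some pair of opposite sides of $v$; and for every face $v$ of a cut other than its last face, with next face $y$ on the cut, the orbit of $v$ contains the common neighbours of $v$ and $y$,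 so that it crosses the cut at $v$; (2) the faces of each orbit induce, in the adjacency graph of the faces, a path or a cycle of even length; (3) to each orbit a set of two colors is assigned which contains the colors of all its faces, and whenever two different orbits contain adjacent faces, the two color sets are complementary. Theorem. For all integers $p,q\ge0$, not both $0$, the icosahedral fullerene with Coxeter parameters $(p,q)$ has an orbital coloring of its faces. -/

import Mathlib

/-! ### The icosahedron and the icosahedral fullerenes

A fullerene is represented by its faces and the relation "share an edge" between them, i.e. by
the dual triangulation. The faces of the hexagonal lattice in the plane are the points of the
triangular lattice `ℤ + ℤω`, `ω = exp (π i / 3)`, where `x = (m, n)` stands for `m + n ω`; two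
faces share an edge when their lattice points are at distance `1`. -/

/-- The twelve vertices of the icosahedron: two poles and two rings of five vertices. -/
inductive IcoVertex : Type
  | north : IcoVertex
  | south : IcoVertex
  | upper : ZMod 5 → IcoVertex
  | lower : ZMod 5 → IcoVertex

/-- `IsCell a b c`: the vertices `a, b, c` span one of the twenty triangles of the icosahedron,
and are listed counterclockwise as seen from outside. -/
inductive IsCell : IcoVertex → IcoVertex → IcoVertex → Prop
  | top (i : ZMod 5) : IsCell .north (.upper i) (.upper (i + 1))
  | down (i : ZMod 5) : IsCell (.upper i) (.lower i) (.upper (i + 1))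
  | up (i : ZMod 5) : IsCell (.upper (i + 1)) (.lower i) (.lower (i + 1))
  | bottom (i : ZMod 5) : IsCell .south (.lower (i + 1)) (.lower i)
  | rotate {a b c : IcoVertex} : IsCell a b c → IsCell b c a

/-- The squared length `m² + m n + n²` of the lattice vector `m + n ω`. -/
def latNorm (x : ℤ × ℤ) : ℤ := x.1 ^ 2 + x.1 * x.2 + x.2 ^ 2

/-- Each cell is developed in the plane as the equilateral triangle with corners `0`, `z`, `ω z`,
where `z = p + q ω`: the Coxeter coordinates of an edge of the cell are `(p, q)`.
`weightA`, `weightB`, `weightC` are the barycentric coordinates of the lattice point `x` with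
respect to `0`, `z`, `ω z`, multiplied by the common denominator `p² + p q + q²`. -/
def weightB (p q : ℕ) (x : ℤ × ℤ) : ℤ := x.1 * (p + q) + x.2 * q

/-- See `weightB`. -/
def weightC (p q : ℕ) (x : ℤ × ℤ) : ℤ := x.2 * p - x.1 * q

/-- See `weightB`. -/
def weightA (p q : ℕ) (x : ℤ × ℤ) : ℤ :=
  latNorm ((p : ℤ), (q : ℤ)) - weightB p q x - weightC p q x

/-- The lattice point `x` lies in the closed triangle with corners `0`, `z`, `ω z`. -/
def InCell (p q : ℕ) (x : ℤ × ℤ) : Prop :=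
  0 ≤ weightA p q x ∧ 0 ≤ weightB p q x ∧ 0 ≤ weightC p q x

open Classical in
/-- The point of the surface of the icosahedron which has position `x` in the cell `a b c`, developed
with `a`, `b`, `c` at `0`, `z`, `ω z`. Points of the surface are given by their (scaled)
barycentric coordinates with respect to the vertices of the icosahedron, so that positions in two
cells give the same point exactly when they are glued along a common edge or at a common vertex. -/
noncomputable def cellPoint (p q : ℕ) (a b c : IcoVertex) (x : ℤ × ℤ) : IcoVertex → ℤ :=
  fun v => if v = a then weightA p q x else if v = b then weightB p q x
    else if v = c then weightC p q x else 0

/-- The faces of the icosahedral fullerene with parameters `(p, q)`: the lattice points of its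
twenty cells. -/
def FullereneFace (p q : ℕ) : Type :=
  {f : IcoVertex → ℤ // ∃ a b c x, IsCell a b c ∧ InCell p q x ∧ f = cellPoint p q a b c x}

/-- Two faces of the icosahedral fullerene share an edge when they are at distance `1` in one cell,
or in two cells `a b c` and `b a d` developed side by side along their common edge `a b`.
(The position `y` in the plane, with `a`, `b` at `0`, `z`, is the position `z - y` in the
cell `b a d` developed with `b`, `a` at `0`, `z`.) -/
def fullereneFaceGraph (p q : ℕ) : SimpleGraph (FullereneFace p q) :=
  SimpleGraph.fromRel fun f g => ∃ a b c x y,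
    IsCell a b c ∧ InCell p q x ∧ f.1 = cellPoint p q a b c x ∧ latNorm (y - x) = 1 ∧
      ((InCell p q y ∧ g.1 = cellPoint p q a b c y) ∨
        ∃ d, IsCell b a d ∧ InCell p q (((p : ℤ), (q : ℤ)) - y) ∧
          g.1 = cellPoint p q b a d (((p : ℤ), (q : ℤ)) - y))

/-! ### Orbital colorings

In this part `G` is the graph whose vertices are the faces of a polyhedral graph with three edges
at each vertex, two of them adjacent when they share an edge. -/

/-- A face with six neighbours. -/
def IsHexagon {V : Type*} (G : SimpleGraph V) (v : V) : Prop :=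
  (G.neighborSet v).ncard = 6

/-- `v` is a hexagon and `u`, `w` are its neighbours across two opposite sides: in the cycle of
the six neighbours of `v`, the faces `u` and `w` are neither equal, nor adjacent, nor at
distance two. So `u, v, w` are three consecutive faces on a lattice line. -/
def IsStraight {V : Type*} (G : SimpleGraph V) (u v w : V) : Prop :=
  IsHexagon G v ∧ G.Adj v u ∧ G.Adj v w ∧ u ≠ w ∧ ¬ G.Adj u w ∧
    ∀ x, G.Adj v x → ¬ (G.Adj x u ∧ G.Adj x w)

/-- A segment of a lattice line: successive faces are adjacent, the line goes straight through
every face between its two ends, and it does not meet itself. -/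
def IsLatticeSegment {V : Type*} (G : SimpleGraph V) (l : List V) : Prop :=
  l.Nodup ∧ l.IsChain G.Adj ∧ ∀ u v w, [u, v, w] <:+: l → IsStraight G u v w

/-- A system of cuts along which the lattice is unfolded: from every non-hexagonal face `a` one
cut `cut a` starts, which is a segment of a lattice line (possibly only the face `a` itself).
Different cuts are disjoint, except that they may converge in a common last face.
(The value of `cut` at a hexagon is irrelevant.) -/
def IsCutSystem {V : Type*} (G : SimpleGraph V) (cut : V → List V) : Prop :=
  (∀ a, ¬ IsHexagon G a → (cut a).head? = some a ∧ IsLatticeSegment G (cut a)) ∧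
  ∀ a b, ¬ IsHexagon G a → ¬ IsHexagon G b → a ≠ b → ∀ x, x ∈ cut a → x ∈ cut b →
    (cut a).getLast? = some x ∧ (cut b).getLast? = some x

/-- The sets of faces in `orbits` run along the weaving lines (the lines parallel to one axis in
the lattice unfolded along the cuts): in a hexagon off the cuts, the orbit continues straight in
both directions; in a face `v` of a cut, with next face `y`, the orbit crosses the cut, passing
from a common neighbour of `v` and `y` on one side to the common neighbour of `v` and `y` on the
other side (where the unfolded lattice has a gap of `60°` along the cut, so that this is the same
line of the unfolding on both sides of the gap). -/
def FollowWeavingLines {V : Type*} (G : SimpleGraph V) (cut : V → List V)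
    (orbits : Set (Set V)) : Prop :=
  (∀ O ∈ orbits, ∀ v ∈ O, IsHexagon G v → (∀ a, ¬ IsHexagon G a → v ∉ cut a) →
    ∃ u ∈ O, ∃ w ∈ O, IsStraight G u v w) ∧
  ∀ O ∈ orbits, ∀ v ∈ O, ∀ a y, ¬ IsHexagon G a → [v, y] <:+: cut a →
    ∀ x, G.Adj x v → G.Adj x y → x ∈ O

/-- The set of faces `O` forms a path or an even cycle. -/
def IsPathOrEvenCycle {V : Type*} (G : SimpleGraph V) (O : Set V) : Prop :=
  (∃ n, 1 ≤ n ∧ Nonempty (G.induce O ≃g SimpleGraph.pathGraph n)) ∨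
    ∃ m, 2 ≤ m ∧ Nonempty (G.induce O ≃g SimpleGraph.cycleGraph (2 * m))

/-- A proper coloring `c` of the faces with four colors is an orbital coloring if the faces are
partitioned into orbits along weaving lines, each orbit is a path or an even cycle, each
orbit is colored with two colors, and neighbouring orbits are colored with the other two. -/
def IsOrbitalColoring {V : Type*} (G : SimpleGraph V) (c : G.Coloring (Fin 4)) : Prop :=
  ∃ (cut : V → List V) (orbits : Set (Set V)) (colors : Set V → Finset (Fin 4)),
    IsCutSystem G cut ∧
    Setoid.IsPartition orbits ∧
    FollowWeavingLines G cut orbits ∧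
    (∀ O ∈ orbits, IsPathOrEvenCycle G O) ∧
    (∀ O ∈ orbits, (colors O).card = 2 ∧ ∀ v ∈ O, c v ∈ colors O) ∧
    ∀ O ∈ orbits, ∀ O' ∈ orbits, O ≠ O' → (∃ u ∈ O, ∃ v ∈ O', G.Adj u v) →
      colors O' = (colors O)ᶜ

/-! ### Combinatorics of the icosahedron -/

/-! Group the twelve pentagons into four triples, each consisting of the corners `a, b, c` of one
cell. A triple carries curvature π, so outside four small regions the surface is a pillowcase: the
plane modulo translations and point reflections. These motions keep every direction of lines up to
sign, so the rows, the lines on which `x.1` is constant, descend to the surface and only have to be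
followed through the four regions.

In detail, let e run through the index lattice ℤ + ℤω and draw it in the plane of faces as z e. The
point e is a centre if it lies in an ideal of index seven, the kernel of ω ↦ 5 in ℤ/7 (5² - 5 + 1 =
21). The other points are labelled by vertices, depending only on e modulo twice the ideal and up to
sign: 24 classes, 12 labels. Triangles without a centre as corner show sixteen cells. The open
hexagons around the centres show none; each stands, modulo its point reflection, for one of the four
missing cells (a, b, c). A cap consists of this cell and of the outer cell (c, b, t) beyond `b c`.
Cuts from a, b, c, of lengths p + q, p, q, meet at position (0, p + q) of the cap and divide it into
three parts. `develop` leaves part 2 in place, turns part 0 by -60° about c, and turns part 1 by 60°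
about b followed by the point reflection in the centre. Then parts 0 and 1 fit the sides `c a` and
`a b` of the hexagon, and each cut opens to a gap of 60° whose two sides are matched along rows, up
to the point reflection. By `Lift.unique`, two positions of a face differ by such gaps and by the
symmetries of the labels.

Two quantities that survive these ambiguities finish the proof. The first is the parity of the row,
which becomes the function `eps` on faces (`Lift.rowParity_eq`). Adjacent faces with equal `eps` are
neighbours on a weaving line; they form `rowGraph`, whose components are the orbits. Each face has
at most two neighbours there (`row_degree`), so an orbit is a path or a cycle.

The second is the length along a row modulo two, the `potential`. It grows by one at each step,
except that in a gap row of odd width one designated step counts twice. Hence it agrees on both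
sides of a gap (`Lift.rowEquiv`), while a step between faces still counts one
(`HalfStep.stepWeight_eq_zero`). A symmetry which preserves a row preserves the potential on it
(`IsSymmetry.potential_eq_self`), because the translations are twice vectors under which the
corrections are already periodic. So closed walks in `rowGraph` are even (`rowGraph_even`), and
`path_or_even_cycle` applies. The value of `eps` chooses one of two complementary pairs of colors,
and a two-coloring of `rowGraph` chooses within the pair; different adjacent orbits have different
`eps`. -/

namespace IcoVertex

/-- A numbering of the vertices. -/
def code : IcoVertex → ℕ
  | north => 0
  | south => 1
  | upper i => 2 + i.val
  | lower i => 7 + i.val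

theorem code_injective : Function.Injective code := by
  intro a b h
  rcases a with _ | _ | i | i <;> rcases b with _ | _ | j | j <;> simp only [code] at h
  all_goals first
    | rfl
    | omega
    | (congr 1; apply ZMod.val_injective; omega)
    | (have := ZMod.val_lt i; omega)
    | (have := ZMod.val_lt j; omega)

/-- Facts about the icosahedron and its labels are finite checks by `decide`; comparing codes keeps
the equality test computable. -/
instance : DecidableEq IcoVertex := fun _ _ => decidable_of_iff _ code_injective.eq_iff

instance : Fintype IcoVertex where
  elems := {north, south} ∪ (Finset.univ : Finset (ZMod 5)).image upper ∪
    (Finset.univ : Finset (ZMod 5)).image lower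
  complete := by rintro (_ | _ | i | i) <;> simp

end IcoVertex

open IcoVertex in
/-- The third vertex of the cell on the left of the directed edge from `a` to `b`. -/
def apex : IcoVertex → IcoVertex → Option IcoVertex
  | north, upper i => some (upper (i + 1))
  | north, _ => none
  | south, lower i => some (lower (i - 1))
  | south, _ => none
  | upper i, north => some (upper (i - 1))
  | upper i, upper j =>
    if j = i + 1 then some north else if i = j + 1 then some (lower j) else none
  | upper i, lower j =>
    if i = j then some (upper (i + 1)) else if i = j + 1 then some (lower i) else none
  | upper _, south => none
  | lower i, south => some (lower (i + 1))
  | lower i, lower j =>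
    if j = i + 1 then some (upper j) else if i = j + 1 then some south else none
  | lower i, upper j =>
    if j = i + 1 then some (upper i) else if i = j then some (lower (i - 1)) else none
  | lower _, north => none

theorem apex_rotate : ∀ a b : IcoVertex, ∀ c ∈ apex a b, apex b c = some a := by decide

/-- An inductive predicate closed under rotation cannot be evaluated, so cells are tabulated by
their directed edges. This makes `IsCell` decidable and shows that two vertices determine the third.
-/
theorem isCell_iff_apex {a b c : IcoVertex} : IsCell a b c ↔ apex a b = some c := by
  constructor
  · intro h
    induction h with
    | top i => rfl
    | down i => simp [apex]
    | up i => simp [apex, show (1 : ZMod 5) ≠ 0 by decide]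
    | bottom i => simp [apex]
    | rotate _ ih => exact apex_rotate _ _ _ ih
  · intro h
    rcases a with _ | _ | i | i <;> rcases b with _ | _ | j | j <;>
      simp only [apex, Option.some.injEq, reduceCtorEq] at h
    · exact h ▸ IsCell.top j
    · have := IsCell.bottom (j - 1)
      rw [sub_add_cancel] at this
      exact h ▸ this
    · have := (IsCell.top (i - 1)).rotate.rotate
      rw [sub_add_cancel] at this
      exact h ▸ this
    · split_ifs at h with h1 h2
      · obtain rfl := Option.some.inj h
        exact h1 ▸ (IsCell.top i).rotate
      · obtain rfl := Option.some.inj h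
        exact h2 ▸ (IsCell.down j).rotate.rotate
    · split_ifs at h with h1 h2
      · obtain rfl := Option.some.inj h
        exact h1 ▸ IsCell.down i
      · obtain rfl := Option.some.inj h
        exact h2 ▸ IsCell.up j
    · exact h ▸ (IsCell.bottom i).rotate.rotate
    · split_ifs at h with h1 h2
      · obtain rfl := Option.some.inj h
        exact h1 ▸ (IsCell.down i).rotate
      · obtain rfl := Option.some.inj h
        subst h2
        have h3 := (IsCell.up (i - 1)).rotate.rotate
        rw [sub_add_cancel] at h3
        exact h3
    · split_ifs at h with h1 h2
      · obtain rfl := Option.some.inj h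
        exact h1 ▸ (IsCell.up i).rotate
      · obtain rfl := Option.some.inj h
        exact h2 ▸ (IsCell.bottom j).rotate

instance (a b c : IcoVertex) : Decidable (IsCell a b c) := decidable_of_iff _ isCell_iff_apex.symm

/-! ### Labels of the index lattice -/

/-- Multiplication of `m + n ω` and `i + j ω`. -/
def emul (x y : ℤ × ℤ) : ℤ × ℤ := (x.1 * y.1 - x.2 * y.2, x.1 * y.2 + x.2 * y.1 + x.2 * y.2)

/-- The unit vectors of the triangular lattice. -/
def units : List (ℤ × ℤ) := [(1, 0), (0, 1), (-1, 1), (-1, 0), (0, -1), (1, -1)]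

/-- Multiplication by `ω`. -/
def rot (x : ℤ × ℤ) : ℤ × ℤ := (-x.2, x.1 + x.2)

/-- Residue classes of `ℤ + ℤω` modulo twice the ideal of index seven. -/
abbrev Cls : Type := ZMod 7 × ZMod 2 × ZMod 2

/-- The residue class of a lattice point. -/
def cls (e : ℤ × ℤ) : Cls := ((e.1 + 5 * e.2 : ℤ), (e.1 : ℤ), (e.2 : ℤ))

open IcoVertex in
/-- The vertex of the icosahedron at a point of the index lattice with given class. -/
def label (c : Cls) : IcoVertex :=
  let r1 : Fin 2 → Fin 2 → IcoVertex := ![![lower 1, south], ![north, upper 4]]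
  let r2 : Fin 2 → Fin 2 → IcoVertex := ![![upper 3, upper 0], ![lower 0, lower 2]]
  let r3 : Fin 2 → Fin 2 → IcoVertex := ![![lower 4, upper 2], ![lower 3, upper 1]]
  -- Rows k and 7 - k agree, which makes the labels invariant under negation. Row 0 belongs to the
  -- centres, which have no label; its value is a default.
  let rows : Fin 7 → Fin 2 → Fin 2 → IcoVertex := ![r1, r1, r2, r3, r3, r2, r1]
  rows c.1 c.2.1 c.2.2

theorem cls_add (x y : ℤ × ℤ) : cls (x + y) = cls x + cls y := by
  simp only [cls, Prod.fst_add, Prod.snd_add, Prod.mk_add_mk]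
  push_cast
  refine Prod.ext ?_ rfl
  simp only
  ring

theorem cls_neg (x : ℤ × ℤ) : cls (-x) = -cls x := by
  have h := cls_add x (-x)
  rw [add_neg_cancel] at h
  have h0 : cls 0 = 0 := by simp [cls]
  rw [h0] at h
  exact (neg_eq_of_add_eq_zero_right h.symm).symm

/-- This makes the point reflections in all centres symmetries of the labels: centres have classes
of order at most two. -/
theorem label_neg : ∀ c : Cls, label (-c) = label c := by decide +kernel

/-- The 24 classes off the ideal form twelve pairs ±c, one for each vertex. Hence a label determines
an index point up to translation and point reflection. -/
theorem label_eq_label : ∀ c c' : Cls, c.1 ≠ 0 → c'.1 ≠ 0 → label c = label c' →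
    c' = c ∨ c' = -c := by decide +kernel

/-- A triangle of the index lattice without point of the index seven ideal shows a cell. -/
theorem isCell_label : ∀ c : Cls, ∀ u ∈ units, c.1 ≠ 0 → (c + cls u).1 ≠ 0 →
    (c + cls (rot u)).1 ≠ 0 →
    IsCell (label c) (label (c + cls u)) (label (c + cls (rot u))) := by decide +kernel

/-! ### Cells and the faces around a cell -/

/-- The cell `a b c` and its three neighbours across `a b`, `b c` and `c a`. -/
structure CellStar (a b c d₁ d₂ d₃ : IcoVertex) : Prop where
  cell : IsCell a b c
  cell₁ : IsCell b a d₁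
  cell₂ : IsCell c b d₂
  cell₃ : IsCell a c d₃

theorem IsCell.unique {a b c d : IcoVertex} (h : IsCell a b c) (h' : IsCell a b d) : c = d := by
  rw [isCell_iff_apex] at h h'
  exact Option.some.inj (h.symm.trans h')

theorem IsCell.exists_opposite : ∀ {a b c : IcoVertex}, IsCell a b c → ∃ d, IsCell b a d := by
  have h : ∀ a b : IcoVertex, (apex a b).isSome → (apex b a).isSome := by decide +kernel
  intro a b c hc
  rw [isCell_iff_apex] at hc
  obtain ⟨d, hd⟩ := Option.isSome_iff_exists.1 (h a b (by rw [hc]; rfl))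
  exact ⟨d, isCell_iff_apex.2 hd⟩

theorem IsCell.exists_star {a b c : IcoVertex} (h : IsCell a b c) :
    ∃ d₁ d₂ d₃, CellStar a b c d₁ d₂ d₃ := by
  obtain ⟨d₁, h₁⟩ := h.exists_opposite
  obtain ⟨d₂, h₂⟩ := h.rotate.exists_opposite
  obtain ⟨d₃, h₃⟩ := h.rotate.rotate.exists_opposite
  exact ⟨d₁, d₂, d₃, h, h₁, h₂, h₃⟩

theorem CellStar.rotate {a b c d₁ d₂ d₃ : IcoVertex} (h : CellStar a b c d₁ d₂ d₃) :
    CellStar b c a d₂ d₃ d₁ := ⟨h.cell.rotate, h.cell₂, h.cell₃, h.cell₁⟩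

/-- The third vertex of the cell on the left of a directed edge. -/
def apexD (a b : IcoVertex) : IcoVertex := (apex a b).getD a

theorem IsCell.apexD_eq {a b c : IcoVertex} (h : IsCell a b c) : apexD a b = c := by
  rw [isCell_iff_apex] at h
  simp [apexD, h]

/-- The charts around two neighbouring cells involve these eight vertices; their distinctness allows
positions in both charts to be compared coordinate by coordinate. -/
theorem CellStar.nodup_opposite {a b c d₁ d₂ d₃ e₁ e₂ : IcoVertex} (h : CellStar a b c d₁ d₂ d₃)
    (h' : CellStar b a d₁ c e₁ e₂) : [a, b, c, d₁, d₂, d₃, e₁, e₂].Nodup := by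
  have key : ∀ a b : IcoVertex, (apex a b).isSome →
      [a, b, apexD a b, apexD b a, apexD (apexD a b) b, apexD a (apexD a b),
        apexD (apexD b a) a, apexD b (apexD b a)].Nodup := by decide +kernel
  have := key a b (by rw [isCell_iff_apex.1 h.cell]; rfl)
  rwa [h.cell.apexD_eq, h.cell₁.apexD_eq, h.cell₂.apexD_eq, h.cell₃.apexD_eq,
    h'.cell₂.apexD_eq, h'.cell₃.apexD_eq] at this

theorem CellStar.opposite {a b c d₁ d₂ d₃ : IcoVertex} (h : CellStar a b c d₁ d₂ d₃) :
    ∃ e₁ e₂, CellStar b a d₁ c e₁ e₂ := by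
  obtain ⟨e₁, he₁⟩ := h.cell₁.rotate.exists_opposite
  obtain ⟨e₂, he₂⟩ := h.cell₁.rotate.rotate.exists_opposite
  exact ⟨e₁, e₂, h.cell₁, h.cell, he₁, he₂⟩

theorem CellStar.nodup {a b c d₁ d₂ d₃ : IcoVertex} (h : CellStar a b c d₁ d₂ d₃) :
    [a, b, c, d₁, d₂, d₃].Nodup := by
  obtain ⟨e₁, e₂, h'⟩ := h.opposite
  exact (h.nodup_opposite h').sublist (List.sublist_append_left [a, b, c, d₁, d₂, d₃] [e₁, e₂])

theorem IsCell.ne {a b c : IcoVertex} (h : IsCell a b c) : a ≠ b ∧ b ≠ c ∧ a ≠ c := by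
  obtain ⟨d₁, d₂, d₃, hs⟩ := h.exists_star
  have := hs.nodup
  simp only [List.nodup_cons, List.mem_cons, not_or] at this
  tauto

/-- The rotation of a cell which takes its coordinates with first corner `a` to those with first
corner `b`. -/
def cellRot (p q : ℕ) (y : ℤ × ℤ) : ℤ × ℤ := (y.2 - q, p + q - y.1 - y.2)

theorem weightA_cellRot (p q : ℕ) (y : ℤ × ℤ) : weightA p q (cellRot p q y) = weightB p q y := by
  simp only [weightA, weightB, weightC, latNorm, cellRot]; ring

theorem weightB_cellRot (p q : ℕ) (y : ℤ × ℤ) : weightB p q (cellRot p q y) = weightC p q y := by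
  simp only [weightB, weightC, cellRot]; ring

theorem weightC_cellRot (p q : ℕ) (y : ℤ × ℤ) : weightC p q (cellRot p q y) = weightA p q y := by
  simp only [weightA, weightB, weightC, latNorm, cellRot]; ring

theorem cellRot_cellRot_cellRot (p q : ℕ) (y : ℤ × ℤ) :
    cellRot p q (cellRot p q (cellRot p q y)) = y := by
  simp only [cellRot]; ext <;> simp <;> ring

theorem inCell_cellRot {p q : ℕ} {y : ℤ × ℤ} : InCell p q (cellRot p q y) ↔ InCell p q y := by
  simp only [InCell, weightA_cellRot, weightB_cellRot, weightC_cellRot]; tauto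

/-- The position in the neighbouring cell across the edge from the first to the second corner. -/
def cellFlip (p q : ℕ) (y : ℤ × ℤ) : ℤ × ℤ := ((p : ℤ), (q : ℤ)) - y

theorem weightA_cellFlip (p q : ℕ) (y : ℤ × ℤ) :
    weightA p q (cellFlip p q y) = weightB p q y + weightC p q y := by
  simp only [weightA, weightB, weightC, latNorm, cellFlip, Prod.fst_sub, Prod.snd_sub]; ring

theorem weightB_cellFlip (p q : ℕ) (y : ℤ × ℤ) :
    weightB p q (cellFlip p q y) = weightA p q y + weightC p q y := by
  simp only [weightA, weightB, weightC, latNorm, cellFlip, Prod.fst_sub, Prod.snd_sub]; ring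

theorem weightC_cellFlip (p q : ℕ) (y : ℤ × ℤ) :
    weightC p q (cellFlip p q y) = -weightC p q y := by
  simp only [weightC, cellFlip, Prod.fst_sub, Prod.snd_sub]; ring

theorem cellFlip_cellFlip (p q : ℕ) (y : ℤ × ℤ) : cellFlip p q (cellFlip p q y) = y := by
  simp [cellFlip]

theorem weight_sum (p q : ℕ) (y : ℤ × ℤ) :
    weightA p q y + weightB p q y + weightC p q y = latNorm ((p : ℤ), (q : ℤ)) := by
  simp only [weightA]; ring

theorem latNorm_pos {p : ℕ} (q : ℕ) (hp : 0 < p) : 0 < latNorm ((p : ℤ), (q : ℤ)) := by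
  have : (0 : ℤ) < p := by exact_mod_cast hp
  simp only [latNorm]; positivity

theorem eq_of_weight_eq {p q : ℕ} (hp : 0 < p) {x y : ℤ × ℤ} (hB : weightB p q x = weightB p q y)
    (hC : weightC p q x = weightC p q y) : x = y := by
  have hN := latNorm_pos q hp
  simp only [weightB, weightC, latNorm] at hB hC hN
  ext
  · apply mul_left_cancel₀ hN.ne'
    linear_combination (p : ℤ) * hB - q * hC
  · apply mul_left_cancel₀ hN.ne'
    linear_combination (q : ℤ) * hB + (p + q) * hC

/-! ### Barycentric charts of a cell and its three neighbours -/

section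
variable {p q : ℕ} {a b c d₁ d₂ d₃ : IcoVertex}

theorem cellPoint_cellRot (h : IsCell a b c) (y : ℤ × ℤ) :
    cellPoint p q b c a (cellRot p q y) = cellPoint p q a b c y := by
  obtain ⟨h1, h2, h3⟩ := h.ne
  funext v
  simp only [cellPoint, weightA_cellRot, weightB_cellRot, weightC_cellRot]
  by_cases hva : v = a
  · subst hva; simp [h1, h3]
  · by_cases hvb : v = b
    · subst hvb; simp [hva]
    · simp [hva, hvb]

theorem cellPoint_eq_add (h : IsCell a b c) (y : ℤ × ℤ) (v : IcoVertex) :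
    cellPoint p q a b c y v = (if v = a then weightA p q y else 0) +
      (if v = b then weightB p q y else 0) + (if v = c then weightC p q y else 0) := by
  obtain ⟨h1, h2, h3⟩ := h.ne
  simp only [cellPoint]
  by_cases hva : v = a
  · subst hva; simp [h1, h3]
  · by_cases hvb : v = b
    · subst hvb; simp [hva, h2]
    · simp [hva, hvb]

variable (p q a b c d₁ d₂ d₃) in
/-- The development of the cell `a b c` and its three neighbours in the plane. -/
def chart (y : ℤ × ℤ) (v : IcoVertex) : ℤ :=
  -- Beyond the edge `a b`, where `weightC` is negative, its absolute value becomes the coordinate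
  -- at `d₁` and is taken off those at `a` and `b`. The other edges are treated alike; this is the
  -- true development as long as only one edge is crossed.
  if v = a then max (weightA p q y) 0 - max (-weightB p q y) 0 - max (-weightC p q y) 0
  else if v = b then max (weightB p q y) 0 - max (-weightC p q y) 0 - max (-weightA p q y) 0
  else if v = c then max (weightC p q y) 0 - max (-weightA p q y) 0 - max (-weightB p q y) 0
  else if v = d₁ then max (-weightC p q y) 0
  else if v = d₂ then max (-weightA p q y) 0
  else if v = d₃ then max (-weightB p q y) 0 else 0

theorem chart_cellRot (h : CellStar a b c d₁ d₂ d₃) (y : ℤ × ℤ) :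
    chart p q b c a d₂ d₃ d₁ (cellRot p q y) = chart p q a b c d₁ d₂ d₃ y := by
  have hn := h.nodup
  simp only [List.nodup_cons, List.mem_cons, not_or, List.not_mem_nil] at hn
  funext v
  simp only [chart, weightA_cellRot, weightB_cellRot, weightC_cellRot]
  split_ifs <;> simp_all

theorem chart_of_inCell {y : ℤ × ℤ} (hy : InCell p q y) :
    chart p q a b c d₁ d₂ d₃ y = cellPoint p q a b c y := by
  obtain ⟨hA, hB, hC⟩ := hy
  funext v
  simp only [chart, cellPoint]
  rw [max_eq_left hA, max_eq_left hB, max_eq_left hC, max_eq_right (neg_nonpos.2 hA),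
    max_eq_right (neg_nonpos.2 hB), max_eq_right (neg_nonpos.2 hC)]
  split_ifs <;> simp

/-- The four inequalities describe the rhombus formed by the two cells, where both charts show the
same points. -/
theorem chart_cellFlip (h : CellStar a b c d₁ d₂ d₃) {e₁ e₂ : IcoVertex}
    (h' : CellStar b a d₁ c e₁ e₂) {y : ℤ × ℤ} (hA : 0 ≤ weightA p q y) (hB : 0 ≤ weightB p q y)
    (hAC : 0 ≤ weightA p q y + weightC p q y) (hBC : 0 ≤ weightB p q y + weightC p q y) :
    chart p q b a d₁ c e₁ e₂ (cellFlip p q y) = chart p q a b c d₁ d₂ d₃ y := by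
  have hn := h.nodup_opposite h'
  simp only [List.nodup_cons, List.mem_cons, not_or, List.not_mem_nil] at hn
  funext v
  simp only [chart, weightA_cellFlip, weightB_cellFlip, weightC_cellFlip, neg_neg]
  rw [max_eq_left hAC, max_eq_left hBC, max_eq_left hA, max_eq_left hB,
    max_eq_right (neg_nonpos.2 hAC), max_eq_right (neg_nonpos.2 hBC),
    max_eq_right (neg_nonpos.2 hA), max_eq_right (neg_nonpos.2 hB)]
  have hmax : max (-weightC p q y) 0 = max (weightC p q y) 0 - weightC p q y := by
    rcases le_total 0 (weightC p q y) with h0 | h0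
    · rw [max_eq_right (neg_nonpos.2 h0), max_eq_left h0]; ring
    · rw [max_eq_left (neg_nonneg.2 h0), max_eq_right h0]; ring
  rw [hmax]
  split_ifs <;> first | omega | simp_all

/-- The coordinates at the outer vertices are the negative parts of the weights. With them the
positive parts can be recovered, even at positions where the chart is no development. -/
theorem chart_injective (hp : 0 < p) (h : CellStar a b c d₁ d₂ d₃) :
    Function.Injective (chart p q a b c d₁ d₂ d₃) := by
  have hn := h.nodup
  simp only [List.nodup_cons, List.mem_cons, not_or, List.not_mem_nil] at hn
  intro x y hxy
  have ea := congrFun hxy a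
  have eb := congrFun hxy b
  have ec := congrFun hxy c
  have e1 := congrFun hxy d₁
  have e2 := congrFun hxy d₂
  have e3 := congrFun hxy d₃
  have hs := weight_sum p q x
  have hs' := weight_sum p q y
  obtain ⟨⟨hab, hac, ha1, ha2, ha3, -⟩, ⟨hbc, hb1, hb2, hb3, -⟩, ⟨hc1, hc2, hc3, -⟩,
    ⟨h12, h13, -⟩, ⟨h23, -⟩, -⟩ := hn
  simp only [chart, if_true, if_neg (Ne.symm hab), if_neg (Ne.symm hac), if_neg (Ne.symm ha1),
    if_neg (Ne.symm ha2), if_neg (Ne.symm ha3), if_neg (Ne.symm hbc), if_neg (Ne.symm hb1),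
    if_neg (Ne.symm hb2), if_neg (Ne.symm hb3), if_neg (Ne.symm hc1), if_neg (Ne.symm hc2),
    if_neg (Ne.symm hc3), if_neg (Ne.symm h12), if_neg (Ne.symm h13), if_neg (Ne.symm h23)]
    at ea eb ec e1 e2 e3
  apply eq_of_weight_eq (q := q) hp <;> omega

/-- Positions in two charts around neighbouring cells which show the same point are the same. -/
theorem eq_of_chart_eq_chart_cellFlip (hp : 0 < p) (h : CellStar a b c d₁ d₂ d₃)
    {e₁ e₂ : IcoVertex} (h' : CellStar b a d₁ c e₁ e₂) {x y : ℤ × ℤ}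
    (hxy : chart p q a b c d₁ d₂ d₃ x = chart p q b a d₁ c e₁ e₂ (cellFlip p q y)) : x = y := by
  have hn := h.nodup_opposite h'
  simp only [List.nodup_cons, List.mem_cons, not_or, List.not_mem_nil] at hn
  have ea := congrFun hxy a
  have eb := congrFun hxy b
  have ec := congrFun hxy c
  have e1 := congrFun hxy d₁
  have e2 := congrFun hxy d₂
  have e3 := congrFun hxy d₃
  have e4 := congrFun hxy e₁
  have e5 := congrFun hxy e₂
  obtain ⟨⟨hab, hac, ha1, ha2, ha3, ha4, ha5, -⟩, ⟨hbc, hb1, hb2, hb3, hb4, hb5, -⟩,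
    ⟨hc1, hc2, hc3, hc4, hc5, -⟩, ⟨h12, h13, h14, h15, -⟩, ⟨h23, h24, h25, -⟩, ⟨h34, h35, -⟩,
    ⟨h45, -⟩, -⟩ := hn
  simp only [chart, if_true, if_neg (Ne.symm hab), if_neg (Ne.symm hac), if_neg (Ne.symm ha1),
    if_neg (Ne.symm ha2), if_neg (Ne.symm ha3), if_neg (Ne.symm hbc), if_neg (Ne.symm hb1),
    if_neg (Ne.symm hb2), if_neg (Ne.symm hb3), if_neg (Ne.symm hc1), if_neg (Ne.symm hc2),
    if_neg (Ne.symm hc3), if_neg (Ne.symm h12), if_neg (Ne.symm h13), if_neg (Ne.symm h23),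
    if_neg (Ne.symm ha4), if_neg (Ne.symm ha5), if_neg (Ne.symm hb4), if_neg (Ne.symm hb5),
    if_neg (Ne.symm hc4), if_neg (Ne.symm hc5), if_neg (Ne.symm h14), if_neg (Ne.symm h15),
    if_neg (Ne.symm h24), if_neg (Ne.symm h25), if_neg (Ne.symm h34), if_neg (Ne.symm h35),
    if_neg (Ne.symm h45), if_neg hab, if_neg hc1, if_neg h24, if_neg h25, if_neg h34, if_neg h35,
    weightA_cellFlip, weightB_cellFlip, weightC_cellFlip, neg_neg] at ea eb ec e1 e2 e3 e4 e5
  apply eq_of_weight_eq (q := q) hp <;> omega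

end

/-! ### The neighbours of a face -/

theorem mem_units_iff {d : ℤ × ℤ} : d ∈ units ↔ latNorm d = 1 := by
  obtain ⟨m, n⟩ := d
  constructor
  · intro h
    simp only [units, List.mem_cons, Prod.mk.injEq, List.not_mem_nil, or_false] at h
    rcases h with ⟨rfl, rfl⟩ | ⟨rfl, rfl⟩ | ⟨rfl, rfl⟩ | ⟨rfl, rfl⟩ | ⟨rfl, rfl⟩ | ⟨rfl, rfl⟩ <;>
      simp [latNorm]
  · intro h
    simp only [latNorm] at h
    have h1 : m ≤ 1 := by nlinarith [sq_nonneg (m + 2 * n)]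
    have h2 : -1 ≤ m := by nlinarith [sq_nonneg (m + 2 * n)]
    have h3 : n ≤ 1 := by nlinarith [sq_nonneg (2 * m + n)]
    have h4 : -1 ≤ n := by nlinarith [sq_nonneg (2 * m + n)]
    interval_cases m <;> interval_cases n <;> simp_all [units]

theorem neg_mem_units {d : ℤ × ℤ} (h : d ∈ units) : -d ∈ units := by
  rw [mem_units_iff] at h ⊢
  simpa [latNorm] using h

theorem sub_mem_units_comm {x y : ℤ × ℤ} : x - y ∈ units ↔ y - x ∈ units := by
  constructor <;> intro h <;> simpa using neg_mem_units h

theorem cellRot_sub_mem_units {p q : ℕ} {x y : ℤ × ℤ} :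
    cellRot p q y - cellRot p q x ∈ units ↔ y - x ∈ units := by
  simp only [mem_units_iff, latNorm, cellRot, Prod.fst_sub, Prod.snd_sub]
  ring_nf

theorem cellFlip_sub_mem_units {p q : ℕ} {x y : ℤ × ℤ} :
    cellFlip p q y - cellFlip p q x ∈ units ↔ y - x ∈ units := by
  simp only [mem_units_iff, latNorm, cellFlip, Prod.fst_sub, Prod.snd_sub]
  ring_nf

/-- A step to a neighbouring lattice point changes the weights by at most `p + q`. -/
theorem weight_step {p q : ℕ} {x y : ℤ × ℤ} (h : y - x ∈ units) :
    |weightA p q y - weightA p q x| ≤ p + q ∧ |weightB p q y - weightB p q x| ≤ p + q ∧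
      |weightC p q y - weightC p q x| ≤ p + q := by
  obtain ⟨m, n⟩ := x
  obtain ⟨m', n'⟩ := y
  simp only [units, List.mem_cons, Prod.mk_sub_mk, Prod.mk.injEq, List.not_mem_nil,
    or_false] at h
  simp only [weightA, weightB, weightC, latNorm, abs_le]
  have hp : (0 : ℤ) ≤ p := by positivity
  have hq : (0 : ℤ) ≤ q := by positivity
  rcases h with ⟨h1, h2⟩ | ⟨h1, h2⟩ | ⟨h1, h2⟩ | ⟨h1, h2⟩ | ⟨h1, h2⟩ | ⟨h1, h2⟩ <;>
    rw [sub_eq_iff_eq_add] at h1 h2 <;> subst h1 h2 <;>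
    refine ⟨⟨?_, ?_⟩, ⟨?_, ?_⟩, ⟨?_, ?_⟩⟩ <;> ring_nf <;> omega

theorem sector_nonneg {p q : ℕ} (hp : 0 < p) {x : ℤ × ℤ} (hB : 0 ≤ weightB p q x)
    (hC : 0 ≤ weightC p q x) : 0 ≤ x.2 ∧ 0 ≤ x.1 + x.2 := by
  have hN := latNorm_pos q hp
  have hp : (0 : ℤ) < p := by exact_mod_cast hp
  have hq : (0 : ℤ) ≤ q := by positivity
  have e1 : latNorm ((p : ℤ), (q : ℤ)) * x.2 = weightB p q x * q + weightC p q x * (p + q) := by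
    simp only [weightB, weightC, latNorm]; ring
  have e2 : latNorm ((p : ℤ), (q : ℤ)) * (x.1 + x.2) =
      weightB p q x * (p + q) + weightC p q x * p := by
    simp only [weightB, weightC, latNorm]; ring
  constructor
  · by_contra! h
    have : latNorm ((p : ℤ), (q : ℤ)) * x.2 < 0 := mul_neg_of_pos_of_neg hN h
    rw [e1] at this
    have : 0 ≤ weightB p q x * q + weightC p q x * (p + q) := by positivity
    omega
  · by_contra! h
    have : latNorm ((p : ℤ), (q : ℤ)) * (x.1 + x.2) < 0 := mul_neg_of_pos_of_neg hN h
    rw [e2] at this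
    have : 0 ≤ weightB p q x * (p + q) + weightC p q x * p := by positivity
    omega

/-- A lattice point of a cell other than a corner is far from the opposite edge's parallel through
that corner. -/
theorem weightA_gap {p q : ℕ} (hp : 0 < p) {x : ℤ × ℤ} (hB : 0 ≤ weightB p q x)
    (hC : 0 ≤ weightC p q x) (hA : weightA p q x ≠ latNorm ((p : ℤ), (q : ℤ))) :
    weightA p q x ≤ latNorm ((p : ℤ), (q : ℤ)) - (p + q) := by
  obtain ⟨h1, h2⟩ := sector_nonneg hp hB hC
  have hp : (0 : ℤ) < p := by exact_mod_cast hp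
  have hq : (0 : ℤ) ≤ q := by positivity
  obtain ⟨m, n⟩ := x
  simp only [weightA, weightB, weightC] at *
  have key : m * (p + q) + n * q + (n * p - m * q) = (m + n) * p + n * q := by ring
  have hne : (m + n) * p + n * q ≠ 0 := by
    intro h; apply hA; linarith
  suffices (p : ℤ) + q ≤ (m + n) * p + n * q by linarith
  rcases h1.eq_or_lt with h | h
  · have hn : n = 0 := h.symm
    subst hn
    simp only [add_zero, zero_mul, zero_sub, ne_eq] at *
    have hm : 0 < m := lt_of_le_of_ne h2 (by rintro rfl; simp at hne)
    have : (q : ℤ) = 0 := by nlinarith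
    rw [this]; nlinarith
  · have hmn : 0 < m + n := by
      rcases h2.eq_or_lt with h0 | h0
      · exfalso
        have hm : m = -n := by linarith
        subst hm
        nlinarith
      · exact h0
    nlinarith

section
variable {p q : ℕ} {a b c d₁ d₂ d₃ : IcoVertex}

theorem weightB_gap (hp : 0 < p) {x : ℤ × ℤ} (hx : InCell p q x)
    (hB : weightB p q x ≠ latNorm ((p : ℤ), (q : ℤ))) :
    weightB p q x ≤ latNorm ((p : ℤ), (q : ℤ)) - (p + q) := by
  rw [← weightA_cellRot] at hB ⊢
  exact weightA_gap hp (by rw [weightB_cellRot]; exact hx.2.2)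
    (by rw [weightC_cellRot]; exact hx.1) hB

theorem weightC_gap (hp : 0 < p) {x : ℤ × ℤ} (hx : InCell p q x)
    (hC : weightC p q x ≠ latNorm ((p : ℤ), (q : ℤ))) :
    weightC p q x ≤ latNorm ((p : ℤ), (q : ℤ)) - (p + q) := by
  rw [← weightB_cellRot] at hC ⊢
  exact weightB_gap hp (inCell_cellRot.2 hx) hC

/-- The face at a given position of a cell. -/
noncomputable def cellFace (h : IsCell a b c) {y : ℤ × ℤ} (hy : InCell p q y) : FullereneFace p q :=
  ⟨cellPoint p q a b c y, a, b, c, y, h, hy, rfl⟩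

/-- A face which is not a corner of a cell. -/
def NonCorner (f : FullereneFace p q) : Prop := ∀ v, f.1 v ≠ latNorm ((p : ℤ), (q : ℤ))

theorem cellPoint_first (_ : IsCell a b c) (y : ℤ × ℤ) :
    cellPoint p q a b c y a = weightA p q y := by simp [cellPoint]

theorem cellPoint_second (h : IsCell a b c) (y : ℤ × ℤ) :
    cellPoint p q a b c y b = weightB p q y := by simp [cellPoint, h.ne.1.symm]

theorem cellPoint_third (h : IsCell a b c) (y : ℤ × ℤ) :
    cellPoint p q a b c y c = weightC p q y := by
  simp [cellPoint, h.ne.2.1.symm, h.ne.2.2.symm]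

theorem cellPoint_of_ne {v : IcoVertex} (ha : v ≠ a) (hb : v ≠ b) (hc : v ≠ c) (y : ℤ × ℤ) :
    cellPoint p q a b c y v = 0 := by simp [cellPoint, ha, hb, hc]

/-- A unit step changes a weight by at most p + q (`weight_step`). So this bound keeps all
neighbours of a face that is no corner inside the cell and its three neighbours. -/
theorem NonCorner.weight_le {f : FullereneFace p q} (hp : 0 < p) (hf : NonCorner f)
    (hc : IsCell a b c) {x : ℤ × ℤ} (hx : InCell p q x) (hfx : f.1 = cellPoint p q a b c x) :
    weightA p q x ≤ latNorm ((p : ℤ), (q : ℤ)) - (p + q) ∧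
    weightB p q x ≤ latNorm ((p : ℤ), (q : ℤ)) - (p + q) ∧
    weightC p q x ≤ latNorm ((p : ℤ), (q : ℤ)) - (p + q) := by
  refine ⟨weightA_gap hp hx.2.1 hx.2.2 ?_, weightB_gap hp hx ?_, weightC_gap hp hx ?_⟩
  · rw [← cellPoint_first hc, ← hfx]; exact hf a
  · rw [← cellPoint_second hc, ← hfx]; exact hf b
  · rw [← cellPoint_third hc, ← hfx]; exact hf c

theorem eq_of_cellPoint_eq (hp : 0 < p) (hc : IsCell a b c) {x y : ℤ × ℤ}
    (h : cellPoint p q a b c x = cellPoint p q a b c y) : x = y := by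
  apply eq_of_weight_eq (q := q) hp
  · rw [← cellPoint_second hc, h, cellPoint_second hc]
  · rw [← cellPoint_third hc, h, cellPoint_third hc]

theorem inCell_cellFlip {y : ℤ × ℤ} (hC : weightC p q y ≤ 0)
    (hA : weightA p q y ≤ latNorm ((p : ℤ), (q : ℤ)))
    (hB : weightB p q y ≤ latNorm ((p : ℤ), (q : ℤ))) : InCell p q (cellFlip p q y) := by
  have := weight_sum p q y
  refine ⟨?_, ?_, ?_⟩
  · rw [weightA_cellFlip]; omega
  · rw [weightB_cellFlip]; omega
  · rw [weightC_cellFlip]; omega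

theorem chart_of_inCell_cellFlip (h : CellStar a b c d₁ d₂ d₃) {y : ℤ × ℤ}
    (hy : InCell p q (cellFlip p q y)) :
    chart p q a b c d₁ d₂ d₃ y = cellPoint p q b a d₁ (cellFlip p q y) := by
  obtain ⟨e₁, e₂, h'⟩ := h.opposite
  rw [← chart_of_inCell (d₁ := c) (d₂ := e₁) (d₃ := e₂) hy]
  obtain ⟨h1, h2, h3⟩ := hy
  rw [weightA_cellFlip] at h1
  rw [weightB_cellFlip] at h2
  rw [weightC_cellFlip] at h3
  exact (chart_cellFlip h h' (by omega) (by omega) h2 h1).symm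

/-- Adjacent faces lie next to each other in the chart around some cell. -/
theorem exists_chart_of_adj {f g : FullereneFace p q} (h : (fullereneFaceGraph p q).Adj f g) :
    ∃ a b c d₁ d₂ d₃ x y, CellStar a b c d₁ d₂ d₃ ∧ InCell p q x ∧
      f.1 = cellPoint p q a b c x ∧ y - x ∈ units ∧ g.1 = chart p q a b c d₁ d₂ d₃ y := by
  rw [fullereneFaceGraph, SimpleGraph.fromRel_adj] at h
  obtain ⟨-, ⟨a, b, c, x, y, hc, hx, hf, hd, hg⟩ | ⟨a, b, c, x, y, hc, hx, hf, hd, hg⟩⟩ := h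
  · obtain ⟨d₁, d₂, d₃, hs⟩ := hc.exists_star
    refine ⟨a, b, c, d₁, d₂, d₃, x, y, hs, hx, hf, mem_units_iff.2 hd, ?_⟩
    rcases hg with ⟨hy, hg⟩ | ⟨d, hcd, hy, hg⟩
    · rw [chart_of_inCell hy, hg]
    · obtain rfl := hcd.unique hs.cell₁
      exact (chart_of_inCell_cellFlip hs hy).symm ▸ hg
  · rcases hg with ⟨hy, hg⟩ | ⟨d, hcd, hy, hg⟩
    · obtain ⟨d₁, d₂, d₃, hs⟩ := hc.exists_star
      refine ⟨a, b, c, d₁, d₂, d₃, y, x, hs, hy, hg,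
        sub_mem_units_comm.1 (mem_units_iff.2 hd), ?_⟩
      rw [chart_of_inCell hx, hf]
    · obtain ⟨d₁, d₂, d₃, hs⟩ := hcd.exists_star
      obtain rfl := hs.cell₁.unique hc
      refine ⟨b, a, d, d₁, d₂, d₃, cellFlip p q y, cellFlip p q x, hs, hy, hg,
        cellFlip_sub_mem_units.2 (sub_mem_units_comm.1 (mem_units_iff.2 hd)), ?_⟩
      rw [chart_of_inCell_cellFlip hs (by rwa [cellFlip_cellFlip]), cellFlip_cellFlip, hf]

/-- Positions of a face, which is no corner and not on the edge from `c` to `a`, in the chart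
around `a b c` and in a chart around a cell with first corner `a`. -/
theorem exists_chart_aux (hp : 0 < p) (h : CellStar a b c d₁ d₂ d₃) {x : ℤ × ℤ}
    (hx : InCell p q x) (hA : 0 < weightA p q x) (hB : 0 < weightB p q x)
    {f : FullereneFace p q} (hf : NonCorner f) (hfx : f.1 = cellPoint p q a b c x)
    {b' c' d₁' d₂' d₃' : IcoVertex} (h' : CellStar a b' c' d₁' d₂' d₃') {x' y' : ℤ × ℤ}
    (hx' : InCell p q x') (hfx' : f.1 = cellPoint p q a b' c' x') (hy' : y' - x' ∈ units) :
    ∃ y, y - x ∈ units ∧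
      chart p q a b' c' d₁' d₂' d₃' y' = chart p q a b c d₁ d₂ d₃ y := by
  have hab := h.cell.ne.1
  have hfb : f.1 b = weightB p q x := by rw [hfx, cellPoint_second h.cell]
  -- The face has positive coordinates at `a` and `b`, so every cell containing it has the edge `a
  -- b`: it is the given cell or the one across that edge.
  by_cases hb : b = b'
  · subst hb
    obtain rfl := h.cell.unique h'.cell
    obtain rfl := h.cell₁.unique h'.cell₁
    obtain rfl := h.cell₂.unique h'.cell₂
    obtain rfl := h.cell₃.unique h'.cell₃
    obtain rfl := eq_of_cellPoint_eq hp h.cell (hfx.symm.trans hfx')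
    exact ⟨y', hy', rfl⟩
  · by_cases hc : b = c'
    · subst hc
      have h'' := h'.rotate.rotate
      obtain rfl := h''.cell.unique h.cell₁
      obtain rfl := h''.cell₁.unique h.cell
      have hn := h.nodup
      simp only [List.nodup_cons, List.mem_cons, not_or, List.not_mem_nil] at hn
      have hC : weightC p q x = 0 := by
        rw [← cellPoint_third h.cell, ← hfx, hfx', cellPoint_of_ne] <;> tauto
      have hs := weight_sum p q x
      have hw := hf.weight_le hp h.cell hx hfx
      have hx2 : InCell p q (cellFlip p q x) := inCell_cellFlip hC.le (by omega) (by omega)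
      have e1 : cellRot p q (cellRot p q x') = cellFlip p q x := by
        apply eq_of_cellPoint_eq hp h''.cell
        rw [cellPoint_cellRot h'.rotate.cell, cellPoint_cellRot h'.cell, ← hfx', hfx,
          ← chart_of_inCell_cellFlip h hx2, chart_of_inCell hx]
      refine ⟨cellFlip p q (cellRot p q (cellRot p q y')), ?_, ?_⟩
      · rw [← cellFlip_sub_mem_units (p := p) (q := q), cellFlip_cellFlip, ← e1,
          cellRot_sub_mem_units, cellRot_sub_mem_units]
        exact hy'
      · set y'' := cellRot p q (cellRot p q y') with hy''
        have hu : cellFlip p q y'' - x ∈ units := by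
          rw [← cellFlip_sub_mem_units (p := p) (q := q), cellFlip_cellFlip, ← e1, hy'',
            cellRot_sub_mem_units, cellRot_sub_mem_units]
          exact hy'
        obtain ⟨w1, w2, w3⟩ := weight_step (p := p) (q := q) hu
        rw [abs_le] at w1 w2 w3
        have hs' := weight_sum p q (cellFlip p q y'')
        have := chart_cellFlip (p := p) (q := q) h h'' (y := cellFlip p q y'') (by omega) (by omega) (by omega)
          (by omega)
        rw [← this, cellFlip_cellFlip, hy'', chart_cellRot h'.rotate, chart_cellRot h']
    · exfalso
      have : f.1 b = 0 := by rw [hfx', cellPoint_of_ne hab.symm hb hc]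
      omega

/-- The neighbours of a face which is no corner are the faces around it in a chart. -/
theorem NonCorner.exists_unit_of_adj (hp : 0 < p) {f g : FullereneFace p q} (hf : NonCorner f)
    (h : CellStar a b c d₁ d₂ d₃) {x : ℤ × ℤ} (hx : InCell p q x)
    (hfx : f.1 = cellPoint p q a b c x) (hfg : (fullereneFaceGraph p q).Adj f g) :
    ∃ y, y - x ∈ units ∧ g.1 = chart p q a b c d₁ d₂ d₃ y := by
  have key : ∀ {a b c d₁ d₂ d₃ : IcoVertex} (_ : CellStar a b c d₁ d₂ d₃) {x : ℤ × ℤ}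
      (_ : InCell p q x) (_ : f.1 = cellPoint p q a b c x) (_ : 0 < weightA p q x)
      (_ : 0 < weightB p q x), ∃ y, y - x ∈ units ∧ g.1 = chart p q a b c d₁ d₂ d₃ y := by
    intro a b c d₁ d₂ d₃ h x hx hfx hA hB
    obtain ⟨a', b', c', d₁', d₂', d₃', x', y', h', hx', hfx', hd, hg⟩ := exists_chart_of_adj hfg
    have hfa : f.1 a = weightA p q x := by rw [hfx, cellPoint_first h.cell]
    by_cases h1 : a = a'
    · subst h1
      obtain ⟨y, hy, e⟩ := exists_chart_aux hp h hx hA hB hf hfx h' hx' hfx' hd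
      exact ⟨y, hy, hg.trans e⟩
    by_cases h2 : a = b'
    · subst h2
      obtain ⟨y, hy, e⟩ := exists_chart_aux hp h hx hA hB hf hfx h'.rotate
        (inCell_cellRot.2 hx') (hfx'.trans (cellPoint_cellRot h'.cell x').symm)
        (cellRot_sub_mem_units.2 hd)
      rw [chart_cellRot h'] at e
      exact ⟨y, hy, hg.trans e⟩
    by_cases h3 : a = c'
    · subst h3
      obtain ⟨y, hy, e⟩ := exists_chart_aux hp h hx hA hB hf hfx h'.rotate.rotate
        (inCell_cellRot.2 (inCell_cellRot.2 hx')) (by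
          rw [cellPoint_cellRot h'.rotate.cell, cellPoint_cellRot h'.cell, hfx'])
        (cellRot_sub_mem_units.2 (cellRot_sub_mem_units.2 hd))
      rw [chart_cellRot h'.rotate, chart_cellRot h'] at e
      exact ⟨y, hy, hg.trans e⟩
    · exfalso
      rw [hfx', cellPoint_of_ne h1 h2 h3] at hfa
      omega
  have hw := hf.weight_le hp h.cell hx hfx
  have hs := weight_sum p q x
  obtain ⟨hA, hB, hC⟩ := hx
  have hp' : (0 : ℤ) < p := by exact_mod_cast hp
  -- At most one weight vanishes, since the face is no corner; a rotation makes the first two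
  -- weights positive.
  by_cases h0 : weightA p q x = 0
  · obtain ⟨y, hy, e⟩ := key h.rotate (x := cellRot p q x) (inCell_cellRot.2 ⟨hA, hB, hC⟩)
      (by rw [cellPoint_cellRot h.cell, hfx]) (by rw [weightA_cellRot]; omega)
      (by rw [weightB_cellRot]; omega)
    refine ⟨cellRot p q (cellRot p q y), ?_, ?_⟩
    · rw [← cellRot_sub_mem_units (p := p) (q := q), cellRot_cellRot_cellRot]; exact hy
    · rw [← chart_cellRot h, cellRot_cellRot_cellRot, e]
  · by_cases h1 : weightB p q x = 0
    · obtain ⟨y, hy, e⟩ := key h.rotate.rotate (x := cellRot p q (cellRot p q x))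
        (inCell_cellRot.2 (inCell_cellRot.2 ⟨hA, hB, hC⟩))
        (by rw [cellPoint_cellRot h.rotate.cell, cellPoint_cellRot h.cell, hfx])
        (by rw [weightA_cellRot, weightB_cellRot]; omega)
        (by rw [weightB_cellRot, weightC_cellRot]; omega)
      refine ⟨cellRot p q y, ?_, ?_⟩
      · rw [← cellRot_sub_mem_units (p := p) (q := q),
          ← cellRot_sub_mem_units (p := p) (q := q), cellRot_cellRot_cellRot]; exact hy
      · rw [← chart_cellRot h, ← chart_cellRot h.rotate, cellRot_cellRot_cellRot, e]
    · exact key h ⟨hA, hB, hC⟩ hfx (by omega) (by omega)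

/-- The neighbouring position is in the cell itself or beyond an edge. In the second case the gap
below the corner weight places it in the cell across, which after rotation is the one allowed in the
definition of adjacency. -/
theorem NonCorner.exists_adj_of_unit (hp : 0 < p) {f : FullereneFace p q} (hf : NonCorner f)
    (h : CellStar a b c d₁ d₂ d₃) {x : ℤ × ℤ} (hx : InCell p q x)
    (hfx : f.1 = cellPoint p q a b c x) {y : ℤ × ℤ} (hy : y - x ∈ units) :
    ∃ g, (fullereneFaceGraph p q).Adj f g ∧ g.1 = chart p q a b c d₁ d₂ d₃ y := by
  have key : ∀ {a b c d₁ d₂ d₃ : IcoVertex} (_ : CellStar a b c d₁ d₂ d₃) {x y : ℤ × ℤ}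
      (_ : InCell p q x) (_ : f.1 = cellPoint p q a b c x) (_ : y - x ∈ units)
      (_ : InCell p q y ∨ weightC p q y ≤ 0),
      ∃ g, (fullereneFaceGraph p q).Adj f g ∧ g.1 = chart p q a b c d₁ d₂ d₃ y := by
    intro a b c d₁ d₂ d₃ h x y hx hfx hy hor
    have hne : chart p q a b c d₁ d₂ d₃ y ≠ f.1 := by
      intro e
      rw [hfx, ← chart_of_inCell (d₁ := d₁) (d₂ := d₂) (d₃ := d₃) hx] at e
      rw [chart_injective hp h e, sub_self] at hy
      exact absurd hy (by decide)
    rcases hor with hyc | hyc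
    · have e := chart_of_inCell (a := a) (b := b) (c := c) (d₁ := d₁) (d₂ := d₂) (d₃ := d₃) hyc
      refine ⟨cellFace h.cell hyc, ?_, e.symm⟩
      rw [fullereneFaceGraph, SimpleGraph.fromRel_adj]
      refine ⟨fun e' => hne (e.trans (congrArg Subtype.val e').symm), Or.inl
        ⟨a, b, c, x, y, h.cell, hx, hfx, mem_units_iff.1 hy, Or.inl ⟨hyc, rfl⟩⟩⟩
    · have hw := hf.weight_le hp h.cell hx hfx
      obtain ⟨w1, w2, w3⟩ := weight_step (p := p) (q := q) hy
      rw [abs_le] at w1 w2 w3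
      have hyf : InCell p q (cellFlip p q y) := inCell_cellFlip hyc (by omega) (by omega)
      have e := chart_of_inCell_cellFlip h hyf
      refine ⟨cellFace h.cell₁ hyf, ?_, e.symm⟩
      rw [fullereneFaceGraph, SimpleGraph.fromRel_adj]
      refine ⟨fun e' => hne (e.trans (congrArg Subtype.val e').symm), Or.inl
        ⟨a, b, c, x, y, h.cell, hx, hfx, mem_units_iff.1 hy, Or.inr ⟨d₁, h.cell₁, hyf, rfl⟩⟩⟩
  have hx1 := inCell_cellRot.2 hx
  have hx2 := inCell_cellRot.2 hx1
  have hf1 := hfx.trans (cellPoint_cellRot h.cell x).symm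
  have hf2 := hf1.trans (cellPoint_cellRot h.rotate.cell _).symm
  have hy1 := (cellRot_sub_mem_units (p := p) (q := q)).2 hy
  have hy2 := (cellRot_sub_mem_units (p := p) (q := q)).2 hy1
  by_cases hC : weightC p q y ≤ 0
  · exact key h hx hfx hy (Or.inr hC)
  by_cases hA : weightA p q y ≤ 0
  · obtain ⟨g, hg, e⟩ := key h.rotate hx1 hf1 hy1 (Or.inr (by rwa [weightC_cellRot]))
    exact ⟨g, hg, by rw [e, chart_cellRot h]⟩
  by_cases hB : weightB p q y ≤ 0
  · obtain ⟨g, hg, e⟩ := key h.rotate.rotate hx2 hf2 hy2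
      (Or.inr (by rwa [weightC_cellRot, weightA_cellRot]))
    exact ⟨g, hg, by rw [e, chart_cellRot h.rotate, chart_cellRot h]⟩
  exact key h hx hfx hy (Or.inl ⟨by omega, by omega, by omega⟩)

end

/-! ### The neighbours of a corner -/

section
variable {p q : ℕ} {a b c d₁ d₂ d₃ : IcoVertex}

theorem add_le_latNorm (hp : 0 < p) : (p : ℤ) + q ≤ latNorm ((p : ℤ), (q : ℤ)) := by
  have hp : (1 : ℤ) ≤ p := by exact_mod_cast hp
  have hq : (0 : ℤ) ≤ q := by positivity
  simp only [latNorm]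
  nlinarith

theorem cellPoint_eq_cellFlip {d : IcoVertex} (h : IsCell a b c) (h' : IsCell b a d) {x : ℤ × ℤ}
    (hx : InCell p q x) (hC : weightC p q x = 0) :
    InCell p q (cellFlip p q x) ∧
      cellPoint p q a b c x = cellPoint p q b a d (cellFlip p q x) := by
  obtain ⟨d₁, d₂, d₃, hs⟩ := h.exists_star
  obtain rfl := h'.unique hs.cell₁
  have := weight_sum p q x
  obtain ⟨h1, h2, h3⟩ := hx
  have hf : InCell p q (cellFlip p q x) := inCell_cellFlip hC.le (by omega) (by omega)
  exact ⟨hf, by rw [← chart_of_inCell_cellFlip hs hf, chart_of_inCell ⟨h1, h2, h3⟩]⟩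

/-- A corner and an adjacent face lie in a common cell. -/
theorem exists_cell_of_corner_adj (hp : 0 < p) {f g : FullereneFace p q} {v : IcoVertex}
    (hf : f.1 v = latNorm ((p : ℤ), (q : ℤ))) (h : (fullereneFaceGraph p q).Adj f g) :
    ∃ a b c x y, IsCell a b c ∧ InCell p q x ∧ InCell p q y ∧ f.1 = cellPoint p q a b c x ∧
      g.1 = cellPoint p q a b c y ∧ y - x ∈ units := by
  have hN := latNorm_pos q hp
  have key : ∀ {a b c d : IcoVertex} {x y : ℤ × ℤ}, IsCell a b c → IsCell b a d → InCell p q x →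
      InCell p q (cellFlip p q y) → f.1 = cellPoint p q a b c x →
      g.1 = cellPoint p q b a d (cellFlip p q y) → y - x ∈ units →
      ∃ a b c x y, IsCell a b c ∧ InCell p q x ∧ InCell p q y ∧ f.1 = cellPoint p q a b c x ∧
      g.1 = cellPoint p q a b c y ∧ y - x ∈ units := by
    intro a b c d x y h1 h2 hx hy hfx hgy hu
    have hs := weight_sum p q x
    have hx' := hx
    obtain ⟨hA, hB, hC⟩ := hx
    by_cases hC0 : weightC p q x = 0
    · obtain ⟨e1, e2⟩ := cellPoint_eq_cellFlip h1 h2 hx' hC0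
      exact ⟨b, a, d, _, _, h2, e1, hy, hfx.trans e2, hgy, cellFlip_sub_mem_units.2 hu⟩
    · have hvc : v = c := by
        by_contra hvc
        by_cases hva : v = a
        · subst hva
          rw [hfx, cellPoint_first h1] at hf
          omega
        by_cases hvb : v = b
        · subst hvb
          rw [hfx, cellPoint_second h1] at hf
          omega
        rw [hfx, cellPoint_of_ne hva hvb hvc] at hf
        omega
      subst hvc
      rw [hfx, cellPoint_third h1] at hf
      obtain ⟨-, -, w⟩ := weight_step (p := p) (q := q) hu
      rw [abs_le] at w
      -- The step starts at the corner `c` and lowers its weight by at most p + q, which is at most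
      -- the full weight. So it ends at best on the edge `a b`, and the end also belongs to the
      -- first cell.
      have hle := add_le_latNorm (q := q) hp
      have h3 := hy.2.2
      rw [weightC_cellFlip] at h3
      have hC' : weightC p q (cellFlip p q y) = 0 := by rw [weightC_cellFlip]; omega
      obtain ⟨e1, e2⟩ := cellPoint_eq_cellFlip h2 h1 hy hC'
      rw [cellFlip_cellFlip] at e1 e2
      exact ⟨a, b, v, x, y, h1, hx', e1, hfx, hgy.trans e2, hu⟩
  rw [fullereneFaceGraph, SimpleGraph.fromRel_adj] at h
  obtain ⟨-, ⟨a, b, c, x, y, hc, hx, hfx, hd, hg⟩ | ⟨a, b, c, x, y, hc, hx, hfx, hd, hg⟩⟩ := h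
  · rw [← mem_units_iff] at hd
    rcases hg with ⟨hy, hg⟩ | ⟨d, hcd, hy, hg⟩
    · exact ⟨a, b, c, x, y, hc, hx, hy, hfx, hg, hd⟩
    · exact key hc hcd hx hy hfx hg hd
  · rw [← mem_units_iff] at hd
    rcases hg with ⟨hy, hg⟩ | ⟨d, hcd, hy, hg⟩
    · exact ⟨a, b, c, y, x, hc, hy, hx, hg, hfx, sub_mem_units_comm.1 hd⟩
    · exact key hcd hc hy (by rwa [cellFlip_cellFlip]) hg (by rwa [cellFlip_cellFlip])
        (cellFlip_sub_mem_units.2 (sub_mem_units_comm.1 hd))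

theorem inCell_zero_one (hp : 0 < p) : InCell p q (0, 1) := by
  have := add_le_latNorm (q := q) hp
  simp only [InCell, weightA, weightB, weightC]
  refine ⟨?_, ?_, ?_⟩ <;> simp
  linarith

/-- The faces next to a corner, one in each cell around it. -/
theorem exists_cell_zero_one_of_corner_adj (hp : 0 < p) {f g : FullereneFace p q} {v : IcoVertex}
    (hf : f.1 v = latNorm ((p : ℤ), (q : ℤ))) (h : (fullereneFaceGraph p q).Adj f g) :
    ∃ b c, IsCell v b c ∧ f.1 = cellPoint p q v b c 0 ∧ g.1 = cellPoint p q v b c (0, 1) := by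
  have hN := latNorm_pos q hp
  have key : ∀ {b c : IcoVertex} {x y : ℤ × ℤ}, IsCell v b c → InCell p q x → InCell p q y →
      f.1 = cellPoint p q v b c x → g.1 = cellPoint p q v b c y → y - x ∈ units →
      ∃ b c, IsCell v b c ∧ f.1 = cellPoint p q v b c 0 ∧
        g.1 = cellPoint p q v b c (0, 1) := by
    intro b c x y hc hx hy hfx hgy hu
    have hs := weight_sum p q x
    rw [hfx, cellPoint_first hc] at hf
    obtain ⟨hA, hB, hC⟩ := hx
    have hx0 : x = 0 := eq_of_weight_eq (q := q) hp (by simp [weightB] at *; omega)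
      (by simp [weightC] at *; omega)
    subst hx0
    rw [sub_zero] at hu
    have hp' : (0 : ℤ) < p := by exact_mod_cast hp
    have hq : (0 : ℤ) ≤ q := by positivity
    have hy' := hy
    obtain ⟨hA', hB', hC'⟩ := hy
    simp only [units, List.mem_cons, List.not_mem_nil, or_false] at hu
    rcases hu with rfl | rfl | rfl | rfl | rfl | rfl <;>
      simp only [weightB, weightC] at hB' hC'
    -- The position (1, 0) lies in the cell only for q = 0, and then on the edge `v b`; the cell
    -- across that edge shows it at (0, 1).
    · have hq0 : q = 0 := by omega
      subst hq0
      obtain ⟨d, hd⟩ := hc.exists_opposite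
      obtain ⟨-, e⟩ := cellPoint_eq_cellFlip hc hd (x := (1, 0))
        hy' (by simp [weightC])
      obtain ⟨-, e'⟩ := cellPoint_eq_cellFlip hc hd (p := p) (q := 0) (x := 0)
        ⟨hA, hB, hC⟩ (by simp [weightC])
      refine ⟨d, b, hd.rotate, ?_, ?_⟩
      · rw [hfx, e', ← cellPoint_cellRot hd]
        congr 1
        simp [cellRot, cellFlip]
      · rw [hgy, e, ← cellPoint_cellRot hd]
        congr 1
        simp [cellRot, cellFlip]
    · exact ⟨b, c, hc, hfx, hgy⟩
    all_goals exfalso; omega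
  obtain ⟨a, b, c, x, y, hc, hx, hy, hfx, hgy, hu⟩ := exists_cell_of_corner_adj hp hf h
  by_cases h1 : v = a
  · subst h1; exact key hc hx hy hfx hgy hu
  by_cases h2 : v = b
  · subst h2
    exact key hc.rotate (inCell_cellRot.2 hx) (inCell_cellRot.2 hy)
      (hfx.trans (cellPoint_cellRot hc x).symm) (hgy.trans (cellPoint_cellRot hc y).symm)
      (cellRot_sub_mem_units.2 hu)
  by_cases h3 : v = c
  · subst h3
    refine key hc.rotate.rotate (inCell_cellRot.2 (inCell_cellRot.2 hx))
      (inCell_cellRot.2 (inCell_cellRot.2 hy)) ?_ ?_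
      (cellRot_sub_mem_units.2 (cellRot_sub_mem_units.2 hu))
    · rw [cellPoint_cellRot hc.rotate, cellPoint_cellRot hc, hfx]
    · rw [cellPoint_cellRot hc.rotate, cellPoint_cellRot hc, hgy]
  · exfalso
    rw [hfx, cellPoint_of_ne h1 h2 h3] at hf
    omega

theorem inCell_cellFlip_of_unit (hp : 0 < p) {f : FullereneFace p q} (hf : NonCorner f)
    (h : CellStar a b c d₁ d₂ d₃) {x y : ℤ × ℤ} (hx : InCell p q x)
    (hfx : f.1 = cellPoint p q a b c x) (hu : y - x ∈ units) (hC : weightC p q y ≤ 0) :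
    InCell p q (cellFlip p q y) := by
  have hw := hf.weight_le hp h.cell hx hfx
  obtain ⟨w1, w2, w3⟩ := weight_step (p := p) (q := q) hu
  rw [abs_le] at w1 w2 w3
  exact inCell_cellFlip hC (by omega) (by omega)

/-- Adjacent neighbours of a face, which is no corner, are adjacent in the chart. -/
theorem NonCorner.sub_mem_units_of_adj (hp : 0 < p) {f g g' : FullereneFace p q}
    (hf : NonCorner f) (h : CellStar a b c d₁ d₂ d₃) {x y y' : ℤ × ℤ} (hx : InCell p q x)
    (hfx : f.1 = cellPoint p q a b c x) (hu : y - x ∈ units) (hu' : y' - x ∈ units)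
    (hg : g.1 = chart p q a b c d₁ d₂ d₃ y) (hg' : g'.1 = chart p q a b c d₁ d₂ d₃ y')
    (hgg : (fullereneFaceGraph p q).Adj g g') : y' - y ∈ units := by
  have key : ∀ {g g' : FullereneFace p q} {a b c d₁ d₂ d₃ : IcoVertex}
      (_ : CellStar a b c d₁ d₂ d₃) {x y y' : ℤ × ℤ} (_ : InCell p q x)
      (_ : f.1 = cellPoint p q a b c x) (_ : y - x ∈ units) (_ : y' - x ∈ units)
      (_ : g.1 = chart p q a b c d₁ d₂ d₃ y) (_ : g'.1 = chart p q a b c d₁ d₂ d₃ y')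
      (_ : (fullereneFaceGraph p q).Adj g g') (_ : NonCorner g)
      (_ : InCell p q y ∨ weightC p q y ≤ 0), y' - y ∈ units := by
    intro g g' a b c d₁ d₂ d₃ h x y y' hx hfx hu hu' hg hg' hgg hgc hor
    rcases hor with hy | hy
    · obtain ⟨y'', h1, h2⟩ := hgc.exists_unit_of_adj hp h hy (hg.trans (chart_of_inCell hy)) hgg
      rwa [chart_injective hp h (hg'.symm.trans h2)]
    · have hfl := inCell_cellFlip_of_unit hp hf h hx hfx hu hy
      obtain ⟨e₁, e₂, h'⟩ := h.opposite
      obtain ⟨w, h1, h2⟩ := hgc.exists_unit_of_adj hp h' hfl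
        (hg.trans (chart_of_inCell_cellFlip h hfl)) hgg
      rw [← cellFlip_cellFlip p q w] at h2
      rw [eq_of_chart_eq_chart_cellFlip hp h h' (hg'.symm.trans h2),
        ← cellFlip_sub_mem_units (p := p) (q := q), cellFlip_cellFlip]
      exact h1
  have key' : ∀ {g g' : FullereneFace p q} {x y y' : ℤ × ℤ} (_ : InCell p q x)
      (_ : f.1 = cellPoint p q a b c x) (_ : y - x ∈ units) (_ : y' - x ∈ units)
      (_ : g.1 = chart p q a b c d₁ d₂ d₃ y) (_ : g'.1 = chart p q a b c d₁ d₂ d₃ y')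
      (_ : (fullereneFaceGraph p q).Adj g g') (_ : NonCorner g), y' - y ∈ units := by
    intro g g' x y y' hx hfx hu hu' hg hg' hgg hgc
    by_cases hC : weightC p q y ≤ 0
    · exact key h hx hfx hu hu' hg hg' hgg hgc (Or.inr hC)
    by_cases hA : weightA p q y ≤ 0
    · rw [← cellRot_sub_mem_units (p := p) (q := q)] at hu hu' ⊢
      rw [← chart_cellRot h] at hg hg'
      exact key h.rotate (inCell_cellRot.2 hx) (by rw [cellPoint_cellRot h.cell, hfx]) hu hu'
        hg hg' hgg hgc (Or.inr (by rwa [weightC_cellRot]))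
    by_cases hB : weightB p q y ≤ 0
    · rw [← cellRot_sub_mem_units (p := p) (q := q),
        ← cellRot_sub_mem_units (p := p) (q := q)] at hu hu' ⊢
      rw [← chart_cellRot h, ← chart_cellRot h.rotate] at hg hg'
      exact key h.rotate.rotate (inCell_cellRot.2 (inCell_cellRot.2 hx))
        (by rw [cellPoint_cellRot h.rotate.cell, cellPoint_cellRot h.cell, hfx]) hu hu'
        hg hg' hgg hgc (Or.inr (by rwa [weightC_cellRot, weightA_cellRot]))
    · exact key h hx hfx hu hu' hg hg' hgg hgc (Or.inl ⟨by omega, by omega, by omega⟩)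
  by_cases h1 : NonCorner g
  · exact key' hx hfx hu hu' hg hg' hgg h1
  by_cases h2 : NonCorner g'
  · exact sub_mem_units_comm.1 (key' hx hfx hu' hu hg' hg hgg.symm h2)
  -- If both neighbours are corners, position (0, 1) of some cell is a corner. The cells are then so
  -- small that the bounds for a face which is no corner contradict the sum of its weights.
  exfalso
  simp only [NonCorner, not_forall, not_not] at h1 h2
  obtain ⟨v, hv⟩ := h1
  obtain ⟨w, hw⟩ := h2
  obtain ⟨b', c', hc, -, hg''⟩ := exists_cell_zero_one_of_corner_adj hp hv hgg
  have hw' := hf.weight_le hp h.cell hx hfx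
  have hs := weight_sum p q x
  have hN := latNorm_pos q hp
  have hq : (0 : ℤ) ≤ q := by positivity
  have hp' : (0 : ℤ) < p := by exact_mod_cast hp
  rw [hg'', cellPoint_eq_add hc] at hw
  have e1 : weightB p q (0, 1) = q := by simp [weightB]
  have e2 : weightC p q (0, 1) = p := by simp [weightC]
  have e3 := weight_sum p q (0, 1)
  have hne := hc.ne
  split_ifs at hw <;> first | omega | simp_all

end

/-! ### Local charts and straight lines through hexagons -/

/-- The neighbours of a face lie around it like those of a lattice point. -/
structure LocalChart {V : Type*} (G : SimpleGraph V) (f : V) (X : ℤ × ℤ → V) : Prop where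
  adj : ∀ d ∈ units, G.Adj f (X d)
  exists_of_adj : ∀ g, G.Adj f g → ∃ d ∈ units, g = X d
  inj : ∀ d ∈ units, ∀ d' ∈ units, X d = X d' → d = d'
  sub_mem : ∀ d ∈ units, ∀ d' ∈ units, G.Adj (X d) (X d') → d' - d ∈ units

theorem LocalChart.isHexagon {V : Type*} {G : SimpleGraph V} {f : V} {X : ℤ × ℤ → V}
    (h : LocalChart G f X) : IsHexagon G f := by
  classical
  have : G.neighborSet f = ((units.toFinset.image X : Finset V) : Set V) := by
    ext g
    simp only [SimpleGraph.mem_neighborSet, Finset.coe_image, List.coe_toFinset, Set.mem_image,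
      Set.mem_ofPred_eq]
    constructor
    · intro hg
      obtain ⟨d, hd, rfl⟩ := h.exists_of_adj g hg
      exact ⟨d, hd, rfl⟩
    · rintro ⟨d, hd, rfl⟩
      exact h.adj d hd
  rw [IsHexagon, this, Set.ncard_coe_finset, Finset.card_image_of_injOn]
  · rfl
  · intro d hd d' hd' e
    simp only [List.coe_toFinset, Set.mem_ofPred_eq] at hd hd'
    exact h.inj d hd d' hd' e

theorem LocalChart.isStraight {V : Type*} {G : SimpleGraph V} {f : V} {X : ℤ × ℤ → V}
    (h : LocalChart G f X) {d : ℤ × ℤ} (hd : d ∈ units) : IsStraight G (X d) f (X (-d)) := by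
  have hd' := neg_mem_units hd
  have k1 : ∀ d ∈ units, d ≠ -d ∧ -d - d ∉ units := by decide
  have k2 : ∀ d ∈ units, ∀ x ∈ units, ¬ (d - x ∈ units ∧ -d - x ∈ units) := by decide
  refine ⟨h.isHexagon, h.adj d hd, h.adj _ hd', fun e => (k1 d hd).1 (h.inj _ hd _ hd' e),
    fun e => (k1 d hd).2 (h.sub_mem _ hd _ hd' e), ?_⟩
  rintro x hx ⟨h1, h2⟩
  obtain ⟨e, he, rfl⟩ := h.exists_of_adj x hx
  exact k2 d hd e he ⟨h.sub_mem _ he _ hd h1, h.sub_mem _ he _ hd' h2⟩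

/-- The chart around a face which is no corner. -/
theorem NonCorner.exists_localChart {p q : ℕ} {a b c d₁ d₂ d₃ : IcoVertex} (hp : 0 < p)
    {f : FullereneFace p q} (hf : NonCorner f)
    (h : CellStar a b c d₁ d₂ d₃) {x : ℤ × ℤ} (hx : InCell p q x)
    (hfx : f.1 = cellPoint p q a b c x) :
    ∃ X, LocalChart (fullereneFaceGraph p q) f X ∧
      ∀ d ∈ units, (X d).1 = chart p q a b c d₁ d₂ d₃ (x + d) := by
  have : ∀ d : ℤ × ℤ, ∃ g, d ∈ units → (fullereneFaceGraph p q).Adj f g ∧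
      g.1 = chart p q a b c d₁ d₂ d₃ (x + d) := by
    intro d
    by_cases hd : d ∈ units
    · obtain ⟨g, hg⟩ := hf.exists_adj_of_unit hp h hx hfx (y := x + d) (by simpa using hd)
      exact ⟨g, fun _ => hg⟩
    · exact ⟨f, fun h => absurd h hd⟩
  choose X hX using this
  refine ⟨X, ⟨fun d hd => (hX d hd).1, fun g hg => ?_, fun d hd d' hd' e => ?_,
    fun d hd d' hd' e => ?_⟩, fun d hd => (hX d hd).2⟩
  · obtain ⟨y, hy, e⟩ := hf.exists_unit_of_adj hp h hx hfx hg
    refine ⟨y - x, hy, Subtype.ext ?_⟩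
    rw [(hX _ hy).2, e, add_sub_cancel]
  · have e1 := (hX d hd).2
    rw [e, (hX d' hd').2] at e1
    exact (add_left_cancel (chart_injective hp h e1)).symm
  · have := hf.sub_mem_units_of_adj hp h hx hfx (y := x + d) (y' := x + d') (by simpa using hd)
      (by simpa using hd') (hX d hd).2 (hX d' hd').2 e
    simpa using this

/-! ### Free triangles and caps of the index lattice -/

/-- The labels of the two cells `T = (a, b, c)` and `T' = (c, b, t)` of the cap with given class. -/
def capA (α : Cls) : IcoVertex := label (α + cls (-1, 1))
/-- See `capA`. -/
def capB (α : Cls) : IcoVertex := label (α + cls (1, 0))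
/-- See `capA`. -/
def capC (α : Cls) : IcoVertex := label (α + cls (0, 1))
/-- See `capA`. -/
def capT (α : Cls) : IcoVertex := label (α + cls (1, 1))

/-- The triangle with corners `e`, `e + u`, `e + ω u` of the index lattice has no corner in the
ideal of index seven; `c` is the class of `e`. -/
def LabelledTriangle (c : Cls) (u : ℤ × ℤ) : Prop :=
  c.1 ≠ 0 ∧ (c + cls u).1 ≠ 0 ∧ (c + cls (rot u)).1 ≠ 0

instance (c : Cls) (u : ℤ × ℤ) : Decidable (LabelledTriangle c u) := by
  unfold LabelledTriangle; infer_instance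

/-- The triangle is labelled, and it is not the outer triangle of a cap. -/
def FreeTriangle (c : Cls) (u : ℤ × ℤ) : Prop :=
  LabelledTriangle c u ∧
  ∀ t ∈ [(((1, -1) : ℤ × ℤ), ((0, 1) : ℤ × ℤ)), ((0, 1), (1, 0)), ((-1, 0), (1, 1)),
    ((-1, 1), (0, -1)), ((0, -1), (-1, 0)), ((1, 0), (-1, -1))],
    ¬ (u = t.1 ∧ (c - cls t.2).1 = 0)

instance (c : Cls) (u : ℤ × ℤ) : Decidable (FreeTriangle c u) := by
  unfold FreeTriangle; infer_instance

/-- The free triangle on the left of the edge from `c` to `c + u` touches a cap along this edge: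
along `c a`, `a b` or `t c`. -/
def TouchesCap (c : Cls) (u : ℤ × ℤ) : Prop :=
  (u = (1, 0) ∧ (c + cls (1, -1)).1 = 0) ∨ (u = (0, 1) ∧ (c + cls (1, 0)).1 = 0) ∨
    (u = (1, 0) ∧ (c + cls (0, -1)).1 = 0)

instance (c : Cls) (u : ℤ × ℤ) : Decidable (TouchesCap c u) := by
  unfold TouchesCap; infer_instance

theorem LabelledTriangle.rotate : ∀ {c : Cls} {u : ℤ × ℤ}, u ∈ units → LabelledTriangle c u →
    LabelledTriangle (c + cls u) (rot (rot u)) := by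
  have : ∀ c : Cls, ∀ u ∈ units, LabelledTriangle c u →
    LabelledTriangle (c + cls u) (rot (rot u)) := by decide +kernel
  exact @fun c u hu h => this c u hu h

theorem LabelledTriangle.neg : ∀ {c : Cls} {u : ℤ × ℤ}, u ∈ units → LabelledTriangle c u →
    LabelledTriangle (-c) (-u) := by
  have : ∀ c : Cls, ∀ u ∈ units, LabelledTriangle c u → LabelledTriangle (-c) (-u) := by
    decide +kernel
  exact @fun c u hu h => this c u hu h

theorem FreeTriangle.rotate : ∀ {c : Cls} {u : ℤ × ℤ}, u ∈ units → FreeTriangle c u →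
    FreeTriangle (c + cls u) (rot (rot u)) := by
  have : ∀ c : Cls, ∀ u ∈ units, FreeTriangle c u →
    FreeTriangle (c + cls u) (rot (rot u)) := by decide +kernel
  exact @fun c u hu h => this c u hu h

theorem FreeTriangle.neg : ∀ {c : Cls} {u : ℤ × ℤ}, u ∈ units → FreeTriangle c u →
    FreeTriangle (-c) (-u) := by
  have : ∀ c : Cls, ∀ u ∈ units, FreeTriangle c u → FreeTriangle (-c) (-u) := by decide +kernel
  exact @fun c u hu h => this c u hu h

/-- Across a side of a free triangle lies a free triangle or a cap. A cap is drawn at one of two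
antipodal positions around its hexagon, so the side may touch it only after negation. -/
theorem FreeTriangle.across : ∀ {c : Cls} {u : ℤ × ℤ}, u ∈ units → FreeTriangle c u →
    FreeTriangle (c + cls u) (-u) ∨ TouchesCap c u ∨ TouchesCap (-c) (-u) := by
  have : ∀ c : Cls, ∀ u ∈ units, FreeTriangle c u →
    FreeTriangle (c + cls u) (-u) ∨ TouchesCap c u ∨ TouchesCap (-c) (-u) := by decide +kernel
  exact @fun c u hu h => this c u hu h

theorem LabelledTriangle.isCell {c : Cls} {u : ℤ × ℤ} (hu : u ∈ units)
    (h : LabelledTriangle c u) :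
    IsCell (label c) (label (c + cls u)) (label (c + cls (rot u))) :=
  isCell_label c u hu h.1 h.2.1 h.2.2

/-- Labels are injective around an index point. This makes a triangle recognizable by two of its
labels once the class of a corner is known. -/
theorem label_add_inj : ∀ c : Cls, ∀ u ∈ units, ∀ u' ∈ units, c.1 ≠ 0 → (c + cls u).1 ≠ 0 →
    (c + cls u').1 ≠ 0 → label (c + cls u) = label (c + cls u') → u = u' := by decide +kernel

theorem label_cap_neg : ∀ α : Cls, α.1 = 0 → label (α + cls (-1, 0)) = capB α := by
  decide +kernel

theorem freeTriangle_cap : ∀ α : Cls, α.1 = 0 → FreeTriangle (α + cls (-1, 1)) (1, 0) ∧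
    FreeTriangle (α + cls (-1, 0)) (0, 1) ∧ FreeTriangle (α + cls (0, 1)) (1, 0) ∧
    LabelledTriangle (α + cls (0, 1)) (1, -1) := by decide +kernel

theorem isCell_cap : ∀ α : Cls, α.1 = 0 → IsCell (capA α) (capB α) (capC α) ∧
    IsCell (capC α) (capB α) (capT α) := by decide +kernel

/-- The edge `b c` of a cap belongs to its two cells only, so positive coordinates at `b` and `c`
exclude any other kind of position. -/
theorem FreeTriangle.not_cap : ∀ {c : Cls} {u : ℤ × ℤ} {α : Cls}, u ∈ units → FreeTriangle c u →
    α.1 = 0 →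
    ¬ (capB α ∈ [label c, label (c + cls u), label (c + cls (rot u))] ∧
      capC α ∈ [label c, label (c + cls u), label (c + cls (rot u))]) := by
  have : ∀ c : Cls, ∀ u ∈ units, ∀ α : Cls, FreeTriangle c u → α.1 = 0 →
    ¬ (capB α ∈ [label c, label (c + cls u), label (c + cls (rot u))] ∧
      capC α ∈ [label c, label (c + cls u), label (c + cls (rot u))]) := by decide +kernel
  exact @fun c u α hu h hα => this c u hu α h hα

theorem cap_eq_of_mem : ∀ α α' : Cls, α.1 = 0 → α'.1 = 0 →
    (capB α' ∈ [capA α, capB α, capC α] ∧ capC α' ∈ [capA α, capB α, capC α] ∨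
    capB α' ∈ [capC α, capB α, capT α] ∧ capC α' ∈ [capC α, capB α, capT α]) → α' = α := by
  decide +kernel

/-- Every cell is shown by a free triangle or is one of the cells of a cap. -/
theorem IsCell.free_or_cap : ∀ {a b c : IcoVertex}, IsCell a b c →
    (∃ γ : Cls, ∃ u ∈ units, FreeTriangle γ u ∧ a = label γ ∧ b = label (γ + cls u) ∧
      c = label (γ + cls (rot u))) ∨
    ∃ α : Cls, α.1 = 0 ∧ ((a, b, c) ∈ [(capA α, capB α, capC α), (capB α, capC α, capA α),
      (capC α, capA α, capB α), (capC α, capB α, capT α), (capB α, capT α, capC α),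
      (capT α, capC α, capB α)]) := by
  have key : ∀ a b : IcoVertex, (apex a b).isSome →
    (∃ γ : Cls, ∃ u ∈ units, FreeTriangle γ u ∧ a = label γ ∧ b = label (γ + cls u) ∧
      apexD a b = label (γ + cls (rot u))) ∨
    ∃ α : Cls, α.1 = 0 ∧ ((a, b, apexD a b) ∈ [(capA α, capB α, capC α),
      (capB α, capC α, capA α), (capC α, capA α, capB α), (capC α, capB α, capT α),
      (capB α, capT α, capC α), (capT α, capC α, capB α)]) := by decide +kernel
  intro a b c h
  have := key a b (by rw [isCell_iff_apex.1 h]; rfl)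
  rwa [h.apexD_eq] at this

theorem exists_cls_eq (c : Cls) : ∃ e, cls e = c := by
  have : ∀ c : Cls, ∃ i : Fin 14, ∃ j : Fin 2, cls ((i : ℕ), (j : ℕ)) = c := by decide +kernel
  obtain ⟨i, j, h⟩ := this c
  exact ⟨_, h⟩

/-! ### Lifts of faces to the plane -/

/-- The face `f` is at position `y` of the triangle with corners `e`, `e + u`, `e + ω u` of the
index lattice, whose corners are labelled, and at the point `x` of the plane. -/
structure TriangleLift (p q : ℕ) (e u y : ℤ × ℤ) (f : FullereneFace p q) (x : ℤ × ℤ) : Prop where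
  mem : u ∈ units
  labelled : LabelledTriangle (cls e) u
  inCell : InCell p q y
  val : f.1 = cellPoint p q (label (cls e)) (label (cls e + cls u)) (label (cls e + cls (rot u))) y
  eq : x = emul ((p : ℤ), (q : ℤ)) e + emul u y

section
variable {p q : ℕ} {e u y x e' u' y' x' : ℤ × ℤ} {f : FullereneFace p q}

theorem rot_rot_mem_units : ∀ {u : ℤ × ℤ}, u ∈ units → rot (rot u) ∈ units := by
  have : ∀ u ∈ units, rot (rot u) ∈ units := by decide
  exact @fun u hu => this u hu

theorem TriangleLift.isCell (h : TriangleLift p q e u y f x) :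
    IsCell (label (cls e)) (label (cls e + cls u)) (label (cls e + cls (rot u))) :=
  h.labelled.isCell h.mem

theorem TriangleLift.rotate (h : TriangleLift p q e u y f x) :
    TriangleLift p q (e + u) (rot (rot u)) (cellRot p q y) f x := by
  refine ⟨rot_rot_mem_units h.mem, ?_, inCell_cellRot.2 h.inCell, ?_, ?_⟩
  · rw [cls_add]; exact h.labelled.rotate h.mem
  · have e1 : cls (e + u) + cls (rot (rot u)) = cls e + cls (rot u) := by
      rw [cls_add, add_assoc, ← cls_add]; congr 2; ext <;> simp [rot]; ring
    have e2 : cls (e + u) + cls (rot (rot (rot u))) = cls e := by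
      rw [← cls_add]; congr 1; ext <;> simp [rot]
    rw [e1, e2, cls_add, h.val, cellPoint_cellRot h.isCell]
  · rw [h.eq]
    ext <;> simp [emul, rot, cellRot] <;> ring

theorem TriangleLift.neg (h : TriangleLift p q e u y f x) :
    TriangleLift p q (-e) (-u) y f (-x) := by
  have e3 : rot (-u) = -rot u := by ext <;> simp [rot]; ring
  refine ⟨neg_mem_units h.mem, ?_, h.inCell, ?_, ?_⟩
  · rw [cls_neg]; exact h.labelled.neg h.mem
  · rw [e3, ← cls_add, ← cls_add, ← neg_add, ← neg_add, cls_neg, cls_neg, cls_neg, label_neg,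
      label_neg, label_neg, cls_add, cls_add, h.val]
  · rw [h.eq]
    ext <;> simp [emul] <;> ring

theorem TriangleLift.exists_first (h : TriangleLift p q e u y f x) {v : IcoVertex}
    (hv : f.1 v ≠ 0) : ∃ e u y, TriangleLift p q e u y f x ∧ label (cls e) = v := by
  by_cases h1 : v = label (cls e)
  · exact ⟨_, _, _, h, h1.symm⟩
  by_cases h2 : v = label (cls e + cls u)
  · exact ⟨_, _, _, h.rotate, by rw [cls_add, h2]⟩
  by_cases h3 : v = label (cls e + cls (rot u))
  · refine ⟨_, _, _, h.rotate.rotate, ?_⟩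
    rw [h3, ← cls_add]
    congr 2
    ext <;> simp [rot] <;> ring
  · exact absurd (by rw [h.val, cellPoint_of_ne h1 h2 h3]) hv

theorem FullereneFace.exists_ne_zero (hp : 0 < p) (f : FullereneFace p q) : ∃ v, f.1 v ≠ 0 := by
  obtain ⟨a, b, c, x, hc, hx, hf⟩ := f.2
  have hN := latNorm_pos q hp
  have hs := weight_sum p q x
  by_contra! h
  have h1 := h a
  have h2 := h b
  have h3 := h c
  rw [hf, cellPoint_first hc] at h1
  rw [hf, cellPoint_second hc] at h2
  rw [hf, cellPoint_third hc] at h3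
  omega

/-- The face has a positive coordinate at the second corner of the first triangle, so that corner
also occurs in the second triangle. Either the triangles agree, or u = ω u' and the face lies on
their common side. -/
theorem TriangleLift.emul_eq_aux (hp : 0 < p) (h : TriangleLift p q e u y f x)
    (h' : TriangleLift p q e' u' y' f x') (he : cls e' = cls e) (hB : 0 < weightB p q y) :
    emul u y = emul u' y' := by
  have hc := h.isCell
  have hc' := h'.isCell
  have hl := h.labelled
  have hl' := h'.labelled
  have hv := h.val
  have hv' := h'.val
  rw [he] at hc' hl' hv'
  obtain ⟨hl1, hl2, hl3⟩ := hl
  obtain ⟨-, hl2', hl3'⟩ := hl'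
  have hmem : ∀ u ∈ units, rot u ∈ units ∧ rot u ≠ u ∧ rot (rot u) ≠ u := by decide
  obtain ⟨hr, hr1, hr2⟩ := hmem u h.mem
  obtain ⟨hr', hr1', hr2'⟩ := hmem u' h'.mem
  obtain ⟨n1, n2, n3⟩ := hc.ne
  by_cases huu : u = u'
  · subst huu
    rw [eq_of_cellPoint_eq hp hc (hv.symm.trans hv')]
  · have hfb : f.1 (label (cls e + cls u)) = weightB p q y := by rw [hv, cellPoint_second hc]
    have hfc : f.1 (label (cls e + cls (rot u))) = weightC p q y := by
      rw [hv, cellPoint_third hc]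
    have hfb' : f.1 (label (cls e + cls u')) = weightB p q y' := by rw [hv', cellPoint_second hc']
    have hfc' : f.1 (label (cls e + cls (rot u'))) = weightC p q y' := by
      rw [hv', cellPoint_third hc']
    have hur : u = rot u' := by
      by_contra hne
      rw [hv', cellPoint_of_ne n1.symm (fun e => huu (label_add_inj _ _ h.mem _ h'.mem hl1 hl2 hl2' e))
        (fun e => hne (label_add_inj _ _ h.mem _ hr' hl1 hl2 hl3' e))] at hfb
      omega
    have hC : weightC p q y = 0 := by
      rw [← hfc, hv', cellPoint_of_ne n3.symm
        (fun e => hr2' (hur ▸ label_add_inj _ _ hr _ h'.mem hl1 hl3 hl2' e))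
        (fun e => hr1 ((label_add_inj _ _ hr _ hr' hl1 hl3 hl3' e).trans hur.symm))]
    have hB' : weightB p q y' = 0 := by
      rw [← hfb', hv, cellPoint_of_ne hc'.ne.1.symm
        (fun e => huu (label_add_inj _ _ h'.mem _ h.mem hl1 hl2' hl2 e).symm)
        (fun e => hr2' ((congrArg rot hur.symm).trans
          (label_add_inj _ _ h'.mem _ hr hl1 hl2' hl3 e).symm))]
    have hC' : weightC p q y' = weightB p q y := by rw [← hfc', ← hur, hfb]
    have e1 : y' = rot y := by
      apply eq_of_weight_eq (q := q) hp
      · rw [hB']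
        simp only [weightB, weightC, rot] at hC ⊢
        linear_combination hC
      · rw [hC']
        simp only [weightB, weightC, rot] at hC ⊢
        linear_combination -hC
    rw [e1, hur]
    ext <;> simp [emul, rot] <;> ring

theorem TriangleLift.emul_eq (hp : 0 < p) (h : TriangleLift p q e u y f x)
    (h' : TriangleLift p q e' u' y' f x') (he : cls e' = cls e) :
    emul u y = emul u' y' := by
  have hi := h.inCell
  have hi' := h'.inCell
  by_cases hB : 0 < weightB p q y
  · exact h.emul_eq_aux hp h' he hB
  by_cases hB' : 0 < weightB p q y'
  · exact (h'.emul_eq_aux hp h he.symm hB').symm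
  have hB : weightB p q y = 0 := le_antisymm (not_lt.1 hB) hi.2.1
  have hB' : weightB p q y' = 0 := le_antisymm (not_lt.1 hB') hi'.2.1
  have hA : weightA p q y = weightA p q y' := by
    rw [← cellPoint_first h.isCell, ← h.val, ← cellPoint_first h'.isCell, ← h'.val, he]
  have hs := weight_sum p q y
  have hs' := weight_sum p q y'
  have hyy : y = y' := eq_of_weight_eq (q := q) hp (by omega) (by omega)
  subst hyy
  by_cases hC : weightC p q y = 0
  · have : y = 0 := eq_of_weight_eq (q := q) hp (by rw [hB]; simp [weightB])
      (by rw [hC]; simp [weightC])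
    subst this
    simp [emul]
  · have hfc : f.1 (label (cls e + cls (rot u))) = weightC p q y := by
      rw [h.val, cellPoint_third h.isCell]
    have hv' := h'.val
    have hl' := h'.labelled
    rw [he] at hv' hl'
    obtain ⟨hl1, hl2, hl3⟩ := h.labelled
    have hmem : ∀ u ∈ units, rot u ∈ units := by decide
    have hur : rot u = rot u' := by
      by_contra hne
      by_cases hne' : rot u = u'
      · rw [hne', hv'] at hfc
        have hc' := h'.isCell
        rw [he] at hc'
        rw [cellPoint_second hc'] at hfc
        omega
      · rw [hv', cellPoint_of_ne h.isCell.ne.2.2.symm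
          (fun e => hne' (label_add_inj _ _ (hmem _ h.mem) _ h'.mem hl1 hl3 hl'.2.1 e))
          (fun e => hne (label_add_inj _ _ (hmem _ h.mem) _ (hmem _ h'.mem) hl1 hl3 hl'.2.2 e))]
          at hfc
        exact hC hfc.symm
    have : u = u' := by
      simp only [rot, Prod.mk.injEq] at hur
      ext <;> omega
    rw [this]

/-- Two positions of a face in labelled triangles differ by a translation or a point reflection
which preserves the labels. -/
theorem TriangleLift.unique (hp : 0 < p) (h : TriangleLift p q e u y f x)
    (h' : TriangleLift p q e' u' y' f x') : ∃ l, cls l = 0 ∧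
      (x' = x + emul ((p : ℤ), (q : ℤ)) l ∨ x' = -x + emul ((p : ℤ), (q : ℤ)) l) := by
  obtain ⟨v, hv⟩ := f.exists_ne_zero hp
  obtain ⟨e, u, y, h, h1⟩ := h.exists_first hv
  obtain ⟨e', u', y', h', h2⟩ := h'.exists_first hv
  have key : ∀ {e u y x : ℤ × ℤ}, TriangleLift p q e u y f x → cls e' = cls e →
      cls (e' - e) = 0 ∧ x' = x + emul ((p : ℤ), (q : ℤ)) (e' - e) := by
    intro e u y x h he
    refine ⟨by rw [sub_eq_add_neg, cls_add, cls_neg, he, add_neg_cancel], ?_⟩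
    rw [h.eq, h'.eq, h.emul_eq hp h' he]
    ext <;> simp [emul] <;> ring
  rcases label_eq_label _ _ h.labelled.1 h'.labelled.1 (h1.trans h2.symm) with he | he
  · obtain ⟨e1, e2⟩ := key h he
    exact ⟨_, e1, Or.inl e2⟩
  · obtain ⟨e1, e2⟩ := key h.neg (he.trans (cls_neg e).symm)
    exact ⟨_, e1, Or.inr e2⟩

end

/-- The position in the cell `(c, b, t)` of the point with position `y` in the plane of the cell
`(a, b, c)`. -/
def capFlip (p q : ℕ) (y : ℤ × ℤ) : ℤ × ℤ := (p + q - y.2, y.1 + y.2 - p)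

theorem capFlip_eq (p q : ℕ) (y : ℤ × ℤ) : capFlip p q y = cellFlip p q (cellRot p q y) := by
  ext <;> simp [capFlip, cellFlip, cellRot] <;> ring

/-- The face `f` is at position `y` of the cap with class `α`. -/
def CapFace (p q : ℕ) (α : Cls) (y : ℤ × ℤ) (f : FullereneFace p q) : Prop :=
  (InCell p q y ∧ f.1 = cellPoint p q (capA α) (capB α) (capC α) y) ∨
  (InCell p q (capFlip p q y) ∧
    f.1 = cellPoint p q (capC α) (capB α) (capT α) (capFlip p q y))

/-- The three parts into which the cap is divided by its cuts. -/
def Piece (p q : ℕ) (i : Fin 3) (y : ℤ × ℤ) : Prop :=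
  match i with
  | 0 => y.1 ≤ 0 ∧ y.2 ≤ p + q
  | 1 => 0 ≤ y.1 ∧ y.1 + y.2 ≤ p + q
  | 2 => (p : ℤ) + q ≤ y.2 ∨ p + q ≤ y.1 + y.2

/-- The positions of the three parts of the cap in the plane. -/
def develop (p q : ℕ) (i : Fin 3) (y : ℤ × ℤ) : ℤ × ℤ :=
  match i with
  | 0 => (y.1 + y.2 - p - q, p - y.1)
  | 1 => (y.2 - p - q, p - y.1 - y.2)
  | 2 => y

/-- The region of the plane of a cap containing its two cells. -/
def InCap (p q : ℕ) (y : ℤ × ℤ) : Prop := InCell p q y ∨ InCell p q (capFlip p q y)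

section
variable {p q : ℕ} {α : Cls} {y y' : ℤ × ℤ} {f : FullereneFace p q}

theorem CapFace.inCap (h : CapFace p q α y f) : InCap p q y := by
  rcases h with h | h
  exacts [Or.inl h.1, Or.inr h.1]

theorem weightA_capFlip (p q : ℕ) (y : ℤ × ℤ) :
    weightA p q (capFlip p q y) = weightC p q y + weightA p q y := by
  rw [capFlip_eq, weightA_cellFlip, weightB_cellRot, weightC_cellRot]

theorem weightB_capFlip (p q : ℕ) (y : ℤ × ℤ) :
    weightB p q (capFlip p q y) = weightB p q y + weightA p q y := by
  rw [capFlip_eq, weightB_cellFlip, weightA_cellRot, weightC_cellRot]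

theorem weightC_capFlip (p q : ℕ) (y : ℤ × ℤ) :
    weightC p q (capFlip p q y) = -weightA p q y := by
  rw [capFlip_eq, weightC_cellFlip, weightC_cellRot]

theorem inCell_capFlip : InCell p q (capFlip p q y) ↔ 0 ≤ weightC p q y + weightA p q y ∧
    0 ≤ weightB p q y + weightA p q y ∧ weightA p q y ≤ 0 := by
  rw [InCell, weightA_capFlip, weightB_capFlip, weightC_capFlip, neg_nonneg]

theorem InCap.weight_bounds (h : InCap p q y) :
    0 ≤ weightB p q y ∧ weightB p q y ≤ latNorm ((p : ℤ), (q : ℤ)) ∧ 0 ≤ weightC p q y ∧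
      weightC p q y ≤ latNorm ((p : ℤ), (q : ℤ)) := by
  have := weight_sum p q y
  rcases h with ⟨h1, h2, h3⟩ | h
  · omega
  · rw [inCell_capFlip] at h
    omega

theorem cap_ne (hα : α.1 = 0) : capA α ≠ capB α ∧ capB α ≠ capC α ∧ capA α ≠ capC α ∧
    capA α ≠ capT α ∧ capB α ≠ capT α ∧ capC α ≠ capT α := by
  have : ∀ α : Cls, α.1 = 0 → capA α ≠ capB α ∧ capB α ≠ capC α ∧ capA α ≠ capC α ∧
    capA α ≠ capT α ∧ capB α ≠ capT α ∧ capC α ≠ capT α := by decide +kernel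
  exact this α hα

/-- The outer cell continues the plane of the inner cell across `b c`, and there t = b + c - a.
Hence one linear formula serves both cells. -/
theorem CapFace.weight_eq (hα : α.1 = 0) (h : CapFace p q α y f) :
    weightA p q y = f.1 (capA α) - f.1 (capT α) ∧ weightB p q y = f.1 (capB α) + f.1 (capT α) ∧
      weightC p q y = f.1 (capC α) + f.1 (capT α) := by
  obtain ⟨h1, h2⟩ := isCell_cap α hα
  obtain ⟨n1, n2, n3, n4, n5, n6⟩ := cap_ne hα
  rcases h with ⟨-, h⟩ | ⟨-, h⟩
  · rw [h, cellPoint_first h1, cellPoint_second h1, cellPoint_third h1,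
      cellPoint_of_ne n4.symm n5.symm n6.symm]
    simp
  · rw [h, cellPoint_first h2, cellPoint_second h2, cellPoint_third h2,
      cellPoint_of_ne n3 n1 n4, weightA_capFlip, weightB_capFlip, weightC_capFlip]
    simp

theorem CapFace.position_unique (hp : 0 < p) (hα : α.1 = 0) (h : CapFace p q α y f)
    (h' : CapFace p q α y' f) : y = y' := by
  obtain ⟨-, h1, h2⟩ := h.weight_eq hα
  obtain ⟨-, h1', h2'⟩ := h'.weight_eq hα
  exact eq_of_weight_eq (q := q) hp (by omega) (by omega)

theorem CapFace.face_unique {g : FullereneFace p q} (hα : α.1 = 0) (h : CapFace p q α y f)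
    (h' : CapFace p q α y g) : f = g := by
  obtain ⟨h1, h2⟩ := isCell_cap α hα
  have hs := weight_sum p q y
  apply Subtype.ext
  have key : ∀ f g : FullereneFace p q, InCell p q y → InCell p q (capFlip p q y) →
      f.1 = cellPoint p q (capA α) (capB α) (capC α) y →
      g.1 = cellPoint p q (capC α) (capB α) (capT α) (capFlip p q y) → f.1 = g.1 := by
    intro f g hy hy' hf hg
    rw [inCell_capFlip] at hy'
    have h0 : weightC p q (cellRot p q y) = 0 := by
      rw [weightC_cellRot]; exact le_antisymm hy'.2.2 hy.1
    rw [hf, hg, ← cellPoint_cellRot h1, capFlip_eq,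
      ← (cellPoint_eq_cellFlip h1.rotate h2 (inCell_cellRot.2 hy) h0).2]
  rcases h with ⟨hy, h⟩ | ⟨hy, h⟩ <;> rcases h' with ⟨hy', h'⟩ | ⟨hy', h'⟩
  · rw [h, h']
  · exact key f g hy hy' h h'
  · exact (key g f hy' hy h' h).symm
  · rw [h, h']

end

section
variable {p q : ℕ} {α : Cls} {y y' : ℤ × ℤ} {f : FullereneFace p q}

theorem position_eq (p q : ℕ) (y : ℤ × ℤ) :
    latNorm ((p : ℤ), (q : ℤ)) * y.1 = weightB p q y * p - weightC p q y * q ∧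
      latNorm ((p : ℤ), (q : ℤ)) * y.2 = weightB p q y * q + weightC p q y * (p + q) := by
  simp only [weightB, weightC, latNorm]
  constructor <;> ring

theorem CapFace.of_nonneg (hα : α.1 = 0) (h : CapFace p q α y f) (hA : 0 ≤ weightA p q y) :
    InCell p q y ∧ f.1 = cellPoint p q (capA α) (capB α) (capC α) y := by
  rcases h with h | ⟨hy, h⟩
  · exact h
  · obtain ⟨h1, h2⟩ := isCell_cap α hα
    have hy' := inCell_capFlip.1 hy
    have hi : InCell p q y := ⟨hA, by omega, by omega⟩
    refine ⟨hi, ?_⟩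
    have h0 : weightC p q (cellRot p q y) = 0 := by
      rw [weightC_cellRot]; exact le_antisymm hy'.2.2 hA
    rw [h, ← cellPoint_cellRot h1, capFlip_eq,
      ← (cellPoint_eq_cellFlip h1.rotate h2 (inCell_cellRot.2 hi) h0).2]

theorem CapFace.of_nonpos (hα : α.1 = 0) (h : CapFace p q α y f) (hA : weightA p q y ≤ 0) :
    InCell p q (capFlip p q y) ∧
      f.1 = cellPoint p q (capC α) (capB α) (capT α) (capFlip p q y) := by
  rcases h with ⟨hy, h⟩ | h
  · obtain ⟨h1, h2⟩ := isCell_cap α hα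
    have h0 : weightC p q (cellRot p q y) = 0 := by
      rw [weightC_cellRot]; exact le_antisymm hA hy.1
    have := cellPoint_eq_cellFlip h1.rotate h2 (inCell_cellRot.2 hy) h0
    rw [h, ← cellPoint_cellRot h1, capFlip_eq]
    exact this
  · exact h

theorem InCap.bounds (hp : 0 < p) (h : InCap p q y) :
    -(q : ℤ) ≤ y.1 ∧ y.1 ≤ p ∧ 0 ≤ y.2 ∧ 0 ≤ y.1 + y.2 := by
  have hN := latNorm_pos q hp
  obtain ⟨e1, e2⟩ := position_eq p q y
  obtain ⟨h1, h2, h3, h4⟩ := h.weight_bounds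
  obtain ⟨h5, h6⟩ := sector_nonneg hp h1 h3
  have hp : (0 : ℤ) < p := by exact_mod_cast hp
  have hq : (0 : ℤ) ≤ q := by positivity
  refine ⟨?_, ?_, h5, h6⟩
  · apply le_of_mul_le_mul_left _ hN
    nlinarith
  · apply le_of_mul_le_mul_left _ hN
    nlinarith

/-- The position of a face on a cap in a labelled triangle of the plane, when the face lies on the
edge `c a`. -/
theorem triangleLift_of_weightB {A : ℤ × ℤ} (hA : (cls A).1 = 0) (hy : InCell p q y)
    (hf : f.1 = cellPoint p q (capA (cls A)) (capB (cls A)) (capC (cls A)) y)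
    (hB : weightB p q y = 0) :
    TriangleLift p q (A + (-1, 1)) (1, 0) (y.1 + y.2, -y.1) f
      (emul ((p : ℤ), (q : ℤ)) A + develop p q 0 y) := by
  obtain ⟨h1, -⟩ := isCell_cap _ hA
  have hl := (freeTriangle_cap _ hA).1
  have e0 : cls (A + (-1, 1)) = cls A + cls (-1, 1) := cls_add _ _
  have e1 : cls A + cls (-1, 1) + cls (1, 0) = cls A + cls (0, 1) := by
    rw [add_assoc, ← cls_add]; rfl
  have hy2 := inCell_cellRot.2 (inCell_cellRot.2 hy)
  have hC : weightC p q (cellRot p q (cellRot p q y)) = 0 := by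
    rw [weightC_cellRot, weightA_cellRot, hB]
  have hc := hl.1.isCell (by decide)
  rw [e1] at hc
  have key := cellPoint_eq_cellFlip h1.rotate.rotate hc hy2 hC
  have ey : (y.1 + y.2, -y.1) = cellFlip p q (cellRot p q (cellRot p q y)) := by
    ext <;> simp [cellFlip, cellRot] <;> ring
  refine ⟨by decide, by rw [e0]; exact hl.1, by rw [ey]; exact key.1, ?_, ?_⟩
  · rw [e0, e1, hf, ← cellPoint_cellRot h1, ← cellPoint_cellRot h1.rotate, ey]
    exact key.2
  · ext <;> simp [emul, develop] <;> ring

theorem triangleLift_of_weightC {A : ℤ × ℤ} (hA : (cls A).1 = 0) (hy : InCell p q y)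
    (hf : f.1 = cellPoint p q (capA (cls A)) (capB (cls A)) (capC (cls A)) y)
    (hC : weightC p q y = 0) :
    TriangleLift p q (A + (-1, 0)) (0, 1) (cellFlip p q y) f
      (emul ((p : ℤ), (q : ℤ)) A + develop p q 1 y) := by
  obtain ⟨h1, -⟩ := isCell_cap _ hA
  have hl := (freeTriangle_cap _ hA).2.1
  have e0 : cls (A + (-1, 0)) = cls A + cls (-1, 0) := cls_add _ _
  have e1 : cls A + cls (-1, 0) + cls (0, 1) = cls A + cls (-1, 1) := by
    rw [add_assoc, ← cls_add]; rfl
  have hc := hl.1.isCell (by decide)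
  rw [e1, label_cap_neg _ hA] at hc
  have key := cellPoint_eq_cellFlip h1 hc hy hC
  refine ⟨by decide, by rw [e0]; exact hl.1, key.1, ?_, ?_⟩
  · rw [e0, e1, label_cap_neg _ hA, hf]
    exact key.2
  · ext <;> simp [emul, develop, cellFlip] <;> ring

/-- Part 2 is developed by the identity, so the outer cell stays in its own labelled triangle. This
covers the whole outer cell, including what the cuts assign to the other two parts. -/
theorem triangleLift_of_capFlip {A : ℤ × ℤ} (hA : (cls A).1 = 0) (hy : InCell p q (capFlip p q y))
    (hf : f.1 = cellPoint p q (capC (cls A)) (capB (cls A)) (capT (cls A)) (capFlip p q y)) :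
    TriangleLift p q (A + (0, 1)) (1, -1) (capFlip p q y) f
      (emul ((p : ℤ), (q : ℤ)) A + develop p q 2 y) := by
  have hl := (freeTriangle_cap _ hA).2.2.2
  have e0 : cls (A + (0, 1)) = cls A + cls (0, 1) := cls_add _ _
  have e1 : cls A + cls (0, 1) + cls (1, -1) = cls A + cls (1, 0) := by
    rw [add_assoc, ← cls_add]; rfl
  have e2 : cls A + cls (0, 1) + cls (rot (1, -1)) = cls A + cls (1, 1) := by
    rw [add_assoc, ← cls_add]; rfl
  refine ⟨by decide, by rw [e0]; exact hl, hy, ?_, ?_⟩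
  · rw [e0, e1, e2]; exact hf
  · ext <;> simp [emul, develop, capFlip] <;> ring

end

/-- The face `f` is at position `y` of the cap around `A`, in part `i`, and at the point `x` of
the plane. On the first two parts only positions in `S` are admitted. -/
structure CapLift (p q : ℕ) (S : ℤ × ℤ → Prop) (A : ℤ × ℤ) (i : Fin 3) (y : ℤ × ℤ)
    (f : FullereneFace p q) (x : ℤ × ℤ) : Prop where
  center : (cls A).1 = 0
  piece : Piece p q i y
  good : i ≠ 2 → S y
  face : CapFace p q (cls A) y f
  eq : x = emul ((p : ℤ), (q : ℤ)) A + develop p q i y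

/-- The positions of a face in the plane, up to sign. -/
def HalfLift (p q : ℕ) (S : ℤ × ℤ → Prop) (f : FullereneFace p q) (x : ℤ × ℤ) : Prop :=
  (∃ e u y, FreeTriangle (cls e) u ∧ TriangleLift p q e u y f x) ∨
    ∃ A i y, CapLift p q S A i y f x

/-- The positions of a face in the plane. -/
def Lift (p q : ℕ) (S : ℤ × ℤ → Prop) (f : FullereneFace p q) (x : ℤ × ℤ) : Prop :=
  HalfLift p q S f x ∨ HalfLift p q S f (-x)

/-- A face which lies on an edge or in a cell between the second and third corner of a cap. -/
def InnerFace {p q : ℕ} (α : Cls) (f : FullereneFace p q) : Prop :=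
  f.1 (capB α) ≠ 0 ∧ f.1 (capC α) ≠ 0

section
variable {p q : ℕ} {S : ℤ × ℤ → Prop} {A : ℤ × ℤ} {i : Fin 3} {y x : ℤ × ℤ}
  {f : FullereneFace p q}

/-- The third part of a cap lies in its outer cell. -/
theorem InCap.weightA_nonpos (hp : 0 < p) (hy : InCap p q y) (hpiece : Piece p q 2 y) :
    weightA p q y ≤ 0 := by
  have hN := latNorm_pos q hp
  obtain ⟨e1, e2⟩ := position_eq p q y
  obtain ⟨hB0, hBN, hC0, hCN⟩ := hy.weight_bounds
  have hP : (0 : ℤ) < p := by exact_mod_cast hp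
  have hQ : (0 : ℤ) ≤ q := by positivity
  simp only [Piece] at hpiece
  rcases hpiece with h | h
  · have : 0 ≤ latNorm ((p : ℤ), (q : ℤ)) * (y.2 - (p + q)) :=
      mul_nonneg hN.le (by omega)
    have : weightA p q y * (p + q) + weightB p q y * p ≤ 0 := by
      rw [weightA]
      linarith
    nlinarith
  · have : 0 ≤ latNorm ((p : ℤ), (q : ℤ)) * (y.1 + y.2 - (p + q)) :=
      mul_nonneg hN.le (by omega)
    have : weightA p q y * p + (latNorm ((p : ℤ), (q : ℤ)) - weightB p q y) * q ≤ 0 := by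
      rw [weightA]
      linarith
    nlinarith

/-- Here N is the norm, (m, n) the position and A, B, C are the weights. The last hypothesis puts
the position on one of the edges `b t` and `c t`; part 0 meets them only in the corner c. -/
theorem edge_piece_zero {N P Q m n A B C : ℤ} (hN : 0 < N) (hP : 0 < P) (hQ : 0 ≤ Q)
    (e1 : N * m = B * P - C * Q) (e2 : N * n = B * Q + C * (P + Q)) (hs : A + B + C = N)
    (hA : A ≤ 0) (hm : m ≤ 0) (hn : n ≤ P + Q)
    (h : C + A = 0 ∨ B + A = 0) : B = 0 ∧ A = 0 := by
  have h1 : N * m ≤ 0 := mul_nonpos_of_nonneg_of_nonpos hN.le hm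
  have h2 : N * n ≤ N * (P + Q) := mul_le_mul_of_nonneg_left hn hN.le
  rcases h with h | h
  · exfalso
    have hB : B = N := by omega
    subst hB
    have h3 : C * P ≤ 0 := by linarith
    have h4 := mul_nonpos_of_nonpos_of_nonneg (nonpos_of_mul_nonpos_left h3 hP) hQ
    have := mul_pos hN hP
    linarith
  · have hC : C = N := by omega
    subst hC
    have h3 : B * Q ≤ 0 := by linarith
    have hB : B = 0 := by
      rcases hQ.eq_or_lt with h | h
      · subst h
        have : B * P ≤ 0 := by linarith
        have := nonpos_of_mul_nonpos_left this hP
        omega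
      · have := nonpos_of_mul_nonpos_left h3 h
        omega
    omega

/-- In the same notation, part 1 meets the edges `b t` and `c t` in the corner b, or in the corner c
when that corner has m = 0, which happens for q = 0. -/
theorem edge_piece_one {N P Q m n A B C : ℤ} (hN : 0 < N) (hP : 0 < P) (hQ : 0 ≤ Q)
    (e1 : N * m = B * P - C * Q) (e2 : N * n = B * Q + C * (P + Q)) (hs : A + B + C = N)
    (hA : A ≤ 0) (hBA : 0 ≤ B + A) (hm : 0 ≤ m) (hn : m + n ≤ P + Q)
    (h : C + A = 0 ∨ B + A = 0) : (C = 0 ∧ A = 0) ∨ (B = 0 ∧ A = 0 ∧ m = 0) := by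
  have h1 : 0 ≤ N * m := mul_nonneg hN.le hm
  have h2 : N * (m + n) ≤ N * (P + Q) := mul_le_mul_of_nonneg_left hn hN.le
  rw [mul_add] at h2
  rcases h with h | h
  · left
    have hB : B = N := by omega
    subst hB
    have : C * P ≤ 0 := by linarith
    have := nonpos_of_mul_nonpos_left this hP
    omega
  · right
    have hC : C = N := by omega
    subst hC
    have h3 : B * Q ≤ 0 := by linarith
    have hB : B = 0 := by
      rcases hQ.eq_or_lt with h | h
      · subst h
        have : B * P ≤ 0 := by linarith
        have := nonpos_of_mul_nonpos_left this hP
        omega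
      · have := nonpos_of_mul_nonpos_left h3 h
        omega
    subst hB
    refine ⟨rfl, by omega, ?_⟩
    have h4 : 0 ≤ C * Q := mul_nonneg hN.le hQ
    have : C * m = 0 := by linarith
    simpa [hN.ne'] using this

/-- A face whose coordinate at b or c vanishes is on the boundary of the cap, and the boundary is
developed onto sides of labelled triangles. The part may change: part 1 meets `c a` only where `y.1
= 0`, and such points are also in part 0. -/
theorem CapLift.inner_or (hp : 0 < p) (h : CapLift p q S A i y f x) :
    InnerFace (cls A) f ∨ ∃ j e u y', Piece p q j y ∧ (j ≠ 2 → S y) ∧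
      TriangleLift p q e u y' f (emul ((p : ℤ), (q : ℤ)) A + develop p q j y) := by
  rw [or_iff_not_imp_left]
  intro hin
  have hα := h.center
  have hN := latNorm_pos q hp
  obtain ⟨e1, e2⟩ := position_eq p q y
  obtain ⟨hB0, hBN, hC0, hCN⟩ := h.face.inCap.weight_bounds
  obtain ⟨hb1, hb2, hb3, hb4⟩ := h.face.inCap.bounds hp
  obtain ⟨c1, c2⟩ := isCell_cap _ hα
  have hs := weight_sum p q y
  have hP : (0 : ℤ) < p := by exact_mod_cast hp
  have hQ : (0 : ℤ) ≤ q := by positivity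
  have hpiece := h.piece
  have hgood := h.good
  have hBd : weightB p q y = y.1 * (p + q) + y.2 * q := rfl
  have hCd : weightC p q y = y.2 * p - y.1 * q := rfl
  rcases le_total 0 (weightA p q y) with hA | hA
  · obtain ⟨hy, hf⟩ := h.face.of_nonneg hα hA
    have hin' : ¬ (weightB p q y ≠ 0 ∧ weightC p q y ≠ 0) := by
      rw [← cellPoint_second c1, ← cellPoint_third c1, ← hf]; exact hin
    fin_cases i
    · simp only [Piece] at hpiece
      have hB : weightB p q y = 0 := by
        by_contra hB
        have hC : weightC p q y = 0 := by tauto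
        have h2 : y.2 = 0 := by
          rcases hb3.eq_or_lt with h | h
          · exact h.symm
          · nlinarith
        rw [h2, zero_mul, add_zero] at hBd
        have : y.1 * ((p : ℤ) + q) ≤ 0 := mul_nonpos_of_nonpos_of_nonneg hpiece.1 (by omega)
        omega
      exact ⟨0, _, _, _, hpiece, hgood, triangleLift_of_weightB hα hy hf hB⟩
    · simp only [Piece] at hpiece
      by_cases hC : weightC p q y = 0
      · exact ⟨1, _, _, _, hpiece, hgood, triangleLift_of_weightC hα hy hf hC⟩
      · have hB : weightB p q y = 0 := by tauto
        have h1 : y.1 = 0 := by nlinarith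
        exact ⟨0, _, _, _, ⟨h1.le, by have := hpiece.2; omega⟩, fun _ => hgood (by decide),
          triangleLift_of_weightB hα hy hf hB⟩
    · simp only [Piece] at hpiece
      have hA0 := h.face.inCap.weightA_nonpos hp h.piece
      obtain ⟨hy, hf⟩ := h.face.of_nonpos hα hA0
      exact ⟨2, _, _, _, hpiece, hgood, triangleLift_of_capFlip hα hy hf⟩
  · obtain ⟨hy, hf⟩ := h.face.of_nonpos hα hA
    have hy' := inCell_capFlip.1 hy
    have hin' : ¬ (weightC p q y + weightA p q y ≠ 0 ∧ weightB p q y + weightA p q y ≠ 0) := by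
      rw [← weightA_capFlip, ← weightB_capFlip, ← cellPoint_second c2, ← cellPoint_first c2, ← hf,
        and_comm]
      exact hin
    fin_cases i
    · simp only [Piece] at hpiece
      obtain ⟨hB, hA0⟩ := edge_piece_zero hN hP hQ e1 e2 hs hA hpiece.1 hpiece.2
        (by tauto)
      obtain ⟨hy, hf⟩ := h.face.of_nonneg hα hA0.ge
      exact ⟨0, _, _, _, hpiece, hgood, triangleLift_of_weightB hα hy hf hB⟩
    · simp only [Piece] at hpiece
      rcases edge_piece_one hN hP hQ e1 e2 hs hA hy'.2.1 hpiece.1 hpiece.2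
        (by tauto) with ⟨hC, hA0⟩ | ⟨hB, hA0, hy1⟩
      · obtain ⟨hy, hf⟩ := h.face.of_nonneg hα hA0.ge
        exact ⟨1, _, _, _, hpiece, hgood, triangleLift_of_weightC hα hy hf hC⟩
      · obtain ⟨hy, hf⟩ := h.face.of_nonneg hα hA0.ge
        exact ⟨0, _, _, _, ⟨hy1.le, by have := hpiece.2; omega⟩, fun _ => hgood (by decide),
          triangleLift_of_weightB hα hy hf hB⟩
    · exact ⟨2, _, _, _, hpiece, hgood, triangleLift_of_capFlip hα hy hf⟩

theorem CapFace.class_unique {α α' : Cls} (hα : α.1 = 0) (hα' : α'.1 = 0)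
    (h : CapFace p q α y f) (hin : InnerFace α' f) : α' = α := by
  apply cap_eq_of_mem α α' hα hα'
  have key : ∀ {a b c v : IcoVertex} {y : ℤ × ℤ}, f.1 = cellPoint p q a b c y → f.1 v ≠ 0 →
      v ∈ [a, b, c] := by
    intro a b c v y hf hv
    by_contra hn
    simp only [List.mem_cons, List.not_mem_nil, or_false, not_or] at hn
    exact hv (by rw [hf, cellPoint_of_ne hn.1 hn.2.1 hn.2.2])
  rcases h with ⟨-, h⟩ | ⟨-, h⟩
  · exact Or.inl ⟨key h hin.1, key h hin.2⟩
  · exact Or.inr ⟨key h hin.1, key h hin.2⟩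

theorem TriangleLift.not_inner {e u : ℤ × ℤ} {α : Cls} (hα : α.1 = 0)
    (h : TriangleLift p q e u y f x) (hF : FreeTriangle (cls e) u) : ¬ InnerFace α f := by
  intro hin
  have key : ∀ {a b c v : IcoVertex} {y : ℤ × ℤ}, f.1 = cellPoint p q a b c y → f.1 v ≠ 0 →
      v ∈ [a, b, c] := by
    intro a b c v y hf hv
    by_contra hn
    simp only [List.mem_cons, List.not_mem_nil, or_false, not_or] at hn
    exact hv (by rw [hf, cellPoint_of_ne hn.1 hn.2.1 hn.2.2])
  exact hF.not_cap h.mem hα ⟨key h.val hin.1, key h.val hin.2⟩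

/-- Two positions of a face in the plane are related by the symmetries of the labels and by
passing across the gaps. -/
theorem Lift.unique (hp : 0 < p) {R : ℤ × ℤ → ℤ × ℤ → Prop} (hR : Equivalence R)
    (hneg : ∀ x, R x (-x)) (htr : ∀ x l, cls l = 0 → R x (x + emul ((p : ℤ), (q : ℤ)) l))
    (hgap : ∀ A i j y, (cls A).1 = 0 → InCap p q y → Piece p q i y → Piece p q j y →
      (i ≠ 2 → S y) → (j ≠ 2 → S y) →
      R (emul ((p : ℤ), (q : ℤ)) A + develop p q i y) (emul ((p : ℤ), (q : ℤ)) A + develop p q j y))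
    {x' : ℤ × ℤ} (h : Lift p q S f x) (h' : Lift p q S f x') : R x x' := by
  have key : ∀ {x x' : ℤ × ℤ}, HalfLift p q S f x → HalfLift p q S f x' → R x x' := by
    intro x x' h h'
    -- An inner face is seen in a single class of caps and at a single position there, so only the
    -- part and the centre can vary. Every other face also has a position in a labelled triangle,
    -- where `TriangleLift.unique` applies.
    by_cases hin : ∃ α : Cls, α.1 = 0 ∧ InnerFace α f
    · obtain ⟨α, hα, hin⟩ := hin
      have red : ∀ {x : ℤ × ℤ}, HalfLift p q S f x → ∃ A i y, CapLift p q S A i y f x ∧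
          cls A = α := by
        rintro x (⟨e, u, y, hF, h⟩ | ⟨A, i, y, h⟩)
        · exact absurd hin (h.not_inner hα hF)
        · exact ⟨A, i, y, h, (h.face.class_unique h.center hα hin).symm⟩
      obtain ⟨A, i, y, h1, e1⟩ := red h
      obtain ⟨A', i', y', h2, e2⟩ := red h'
      have e : cls A' = cls A := e2.trans e1.symm
      have hf' := h2.face
      rw [e] at hf'
      obtain rfl := h1.face.position_unique hp h1.center hf'
      have r1 := hgap A i i' y h1.center h1.face.inCap h1.piece h2.piece h1.good h2.good
      have r2 := htr (emul ((p : ℤ), (q : ℤ)) A + develop p q i' y) (A' - A)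
        (by rw [sub_eq_add_neg, cls_add, cls_neg, e, add_neg_cancel])
      rw [h1.eq, h2.eq]
      convert hR.trans r1 r2 using 1
      ext <;> simp [emul] <;> ring
    · have red : ∀ {x : ℤ × ℤ}, HalfLift p q S f x → ∃ e u y x', TriangleLift p q e u y f x' ∧
          R x x' := by
        rintro x (⟨e, u, y, hF, h⟩ | ⟨A, i, y, h⟩)
        · exact ⟨e, u, y, x, h, hR.refl x⟩
        · rcases h.inner_or hp with h0 | ⟨j, e, u, y', h1, h2, h3⟩
          · exact absurd ⟨_, h.center, h0⟩ hin
          · refine ⟨e, u, y', _, h3, ?_⟩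
            rw [h.eq]
            exact hgap A i j y h.center h.face.inCap h.piece h1 h.good h2
      obtain ⟨e, u, y, x₁, h1, r1⟩ := red h
      obtain ⟨e', u', y', x₂, h2, r2⟩ := red h'
      obtain ⟨l, hl, hx⟩ := h1.unique hp h2
      refine hR.trans r1 (hR.trans ?_ (hR.symm r2))
      rcases hx with rfl | rfl
      · exact htr _ _ hl
      · exact hR.trans (hneg _) (htr _ _ hl)
  rcases h with h | h <;> rcases h' with h' | h'
  · exact key h h'
  · exact hR.trans (key h h') (hR.symm (hneg _))
  · exact hR.trans (hneg _) (key h h')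
  · exact hR.trans (hneg _) (hR.trans (key h h') (hR.symm (hneg _)))

end

/-! ### Steps between adjacent faces in the plane -/

/-- The face `f` is at the point `x` of the plane, which lies in a labelled triangle. -/
def PlaneSpot (p q : ℕ) (f : FullereneFace p q) (x : ℤ × ℤ) : Prop :=
  (∃ e u y, TriangleLift p q e u y f x) ∧ ∀ S, Lift p q S f x

/-- The face `f` is at position `y` of the cap around `A`, or next to it. -/
def CapSpot (p q : ℕ) (A : ℤ × ℤ) (i : Fin 3) (y : ℤ × ℤ) (f : FullereneFace p q) : Prop :=
  CapFace p q (cls A) y f ∨ PlaneSpot p q f (emul ((p : ℤ), (q : ℤ)) A + develop p q i y)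

section
variable {p q : ℕ} {S : ℤ × ℤ → Prop} {A : ℤ × ℤ} {i : Fin 3} {e u y y' x d : ℤ × ℤ}
  {f g : FullereneFace p q}

theorem Lift.neg (h : Lift p q S f x) : Lift p q S f (-x) := by
  rcases h with h | h
  · exact Or.inr (by rwa [neg_neg])
  · exact Or.inl h

theorem CapLift.lift (h : CapLift p q S A i y f x) : Lift p q S f x :=
  Or.inl (Or.inr ⟨A, i, y, h⟩)

theorem TriangleLift.planeSpot (h : TriangleLift p q e u y f x) (hF : FreeTriangle (cls e) u) :
    PlaneSpot p q f x := ⟨⟨e, u, y, h⟩, fun _ => Or.inl (Or.inl ⟨e, u, y, hF, h⟩)⟩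

theorem InCell.bounds (hp : 0 < p) (h : InCell p q y) :
    0 ≤ y.2 ∧ 0 ≤ y.1 + y.2 ∧ y.1 ≤ p ∧ -(q : ℤ) ≤ y.1 ∧ y.2 ≤ p + q ∧ y.1 + y.2 ≤ p + q := by
  obtain ⟨h1, h2, h3, h4⟩ := InCap.bounds hp (Or.inl h)
  have hr := inCell_cellRot.2 h
  obtain ⟨-, h5⟩ := sector_nonneg hp hr.2.1 hr.2.2
  obtain ⟨h6, -⟩ := sector_nonneg hp hr.2.1 hr.2.2
  have hr2 := inCell_cellRot.2 hr
  obtain ⟨h7, h8⟩ := sector_nonneg hp hr2.2.1 hr2.2.2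
  simp only [cellRot] at h5 h6 h7 h8
  refine ⟨h3, h4, h2, h1, ?_, ?_⟩
  · obtain ⟨e1, e2⟩ := position_eq p q y
    have hN := latNorm_pos q hp
    have hs := weight_sum p q y
    obtain ⟨w1, w2, w3⟩ := h
    have hq : (0 : ℤ) ≤ q := by positivity
    have hp : (0 : ℤ) < p := by exact_mod_cast hp
    apply le_of_mul_le_mul_left _ hN
    nlinarith [mul_nonneg w1 (add_nonneg hp.le hq), mul_nonneg w2 hp.le]
  · omega

theorem InCell.bounds_of_pos (hp : 0 < p) (h : InCell p q y) (hC : 0 < weightC p q y) :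
    1 ≤ y.2 ∧ y.1 + 1 ≤ p ∧ 1 ≤ y.1 + y.2 := by
  obtain ⟨e1, e2⟩ := position_eq p q y
  have hN := latNorm_pos q hp
  have hs := weight_sum p q y
  obtain ⟨w1, w2, w3⟩ := h
  have hq : (0 : ℤ) ≤ q := by positivity
  have hp : (0 : ℤ) < p := by exact_mod_cast hp
  have c1 := mul_pos hC hp
  have c2 := mul_nonneg w2 hp.le
  have c3 := mul_nonneg w2 hq
  have c4 := mul_nonneg hC.le hq
  have c5 := mul_nonneg w1 hp.le
  refine ⟨?_, ?_, ?_⟩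
  · have : 0 < latNorm ((p : ℤ), (q : ℤ)) * y.2 := by rw [e2]; linarith
    have := pos_of_mul_pos_right this hN.le
    omega
  · have : 0 < latNorm ((p : ℤ), (q : ℤ)) * (p - y.1) := by
      rw [mul_sub, e1, ← hs]; linarith
    have := pos_of_mul_pos_right this hN.le
    omega
  · have : 0 < latNorm ((p : ℤ), (q : ℤ)) * (y.1 + y.2) := by
      rw [mul_add, e1, e2]; linarith
    have := pos_of_mul_pos_right this hN.le
    omega

theorem unit_bounds (hd : d ∈ units) : -1 ≤ d.1 ∧ d.1 ≤ 1 ∧ -1 ≤ d.2 ∧ d.2 ≤ 1 ∧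
    -1 ≤ d.1 + d.2 ∧ d.1 + d.2 ≤ 1 := by
  have : ∀ d ∈ units, -1 ≤ d.1 ∧ d.1 ≤ 1 ∧ -1 ≤ d.2 ∧ d.2 ≤ 1 ∧
    -1 ≤ d.1 + d.2 ∧ d.1 + d.2 ≤ 1 := by decide
  exact this d hd

/-- Neighbouring positions in a cap lie in a common part. -/
theorem exists_piece (hd : y' - y ∈ units) : ∃ i, Piece p q i y ∧ Piece p q i y' := by
  obtain ⟨h1, h2, h3, h4, h5, h6⟩ := unit_bounds hd
  simp only [Prod.fst_sub, Prod.snd_sub] at h1 h2 h3 h4 h5 h6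
  by_cases h : ((p : ℤ) + q ≤ y.2 ∨ (p : ℤ) + q ≤ y.1 + y.2) ∧
    ((p : ℤ) + q ≤ y'.2 ∨ (p : ℤ) + q ≤ y'.1 + y'.2)
  · exact ⟨2, h⟩
  by_cases h' : y.1 ≤ 0 ∧ y'.1 ≤ 0
  · refine ⟨0, ?_, ?_⟩ <;> simp only [Piece] <;> omega
  · refine ⟨1, ?_, ?_⟩ <;> simp only [Piece] <;> omega

/-- Faces at the points `x` and `x'` of one sheet of the plane. -/
def HalfStep (p q : ℕ) (f g : FullereneFace p q) (x x' : ℤ × ℤ) : Prop :=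
  (PlaneSpot p q f x ∧ PlaneSpot p q g x') ∨
    ∃ A i y y', (cls A).1 = 0 ∧ Piece p q i y ∧ Piece p q i y' ∧ CapSpot p q A i y f ∧
      CapSpot p q A i y' g ∧ x = emul ((p : ℤ), (q : ℤ)) A + develop p q i y ∧
      x' = emul ((p : ℤ), (q : ℤ)) A + develop p q i y'

/-- Faces at the points `x` and `x'` of one sheet of the plane. -/
def Step (p q : ℕ) (f g : FullereneFace p q) (x x' : ℤ × ℤ) : Prop :=
  HalfStep p q f g x x' ∨ HalfStep p q f g (-x) (-x')

/-- The faces across an edge of a free triangle which touches a cap lie in this cap. -/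
theorem TouchesCap.exists_cap (hu : u ∈ units) (ht : TouchesCap (cls e) u) :
    ∃ A i, (cls A).1 = 0 ∧ ∃ φ : ℤ × ℤ → ℤ × ℤ,
      (∀ y, emul ((p : ℤ), (q : ℤ)) A + develop p q i (φ y) =
        emul ((p : ℤ), (q : ℤ)) e + emul u y) ∧
      (∀ (g : FullereneFace p q) (w : IcoVertex) (y : ℤ × ℤ),
        IsCell (label (cls e + cls u)) (label (cls e)) w →
        InCell p q (cellFlip p q y) →
        g.1 = cellPoint p q (label (cls e + cls u)) (label (cls e)) w (cellFlip p q y) →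
        CapFace p q (cls A) (φ y) g) ∧
      ∀ y : ℤ × ℤ, 0 ≤ y.2 → y.1 ≤ p → 0 ≤ y.1 + y.2 → y.1 + y.2 ≤ p + q →
        Piece p q i (φ y) := by
  rcases ht with ⟨rfl, ht⟩ | ⟨rfl, ht⟩ | ⟨rfl, ht⟩
  · have e0 : cls e = cls (e + (1, -1)) + cls (-1, 1) := by
      rw [← cls_add, add_assoc]; congr 1; ext <;> simp
    have e1 : cls e + cls (1, 0) = cls (e + (1, -1)) + cls (0, 1) := by
      rw [← cls_add, ← cls_add, add_assoc]; simp
    rw [← cls_add] at ht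
    refine ⟨e + (1, -1), 0, ht, fun y => (-y.2, y.1 + y.2), ?_, ?_, ?_⟩
    · intro y
      ext <;> simp [emul, develop] <;> ring
    · intro g w y hw hy hg
      rw [e1] at hw hg
      rw [e0] at hw hg
      obtain ⟨h1, -⟩ := isCell_cap _ ht
      obtain rfl : w = capB _ := hw.unique h1.rotate.rotate
      left
      have e : (-y.2, y.1 + y.2) = cellRot p q (cellFlip p q y) := by
        ext <;> simp [cellRot, cellFlip]
      show InCell p q (-y.2, y.1 + y.2) ∧ g.1 = cellPoint p q _ _ _ (-y.2, y.1 + y.2)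
      rw [e]
      refine ⟨inCell_cellRot.2 hy, hg.trans (cellPoint_cellRot hw _).symm⟩
    · intro y h1 h2 h3 h4
      simp only [Piece]
      omega
  · have e0 : cls e = cls (e + (1, 0)) + cls (-1, 0) := by
      rw [← cls_add, add_assoc]; congr 1; ext <;> simp
    have e1 : cls e + cls (0, 1) = cls (e + (1, 0)) + cls (-1, 1) := by
      rw [← cls_add, ← cls_add, add_assoc]; simp
    rw [← cls_add] at ht
    refine ⟨e + (1, 0), 1, ht, fun y => cellFlip p q y, ?_, ?_, ?_⟩
    · intro y
      ext <;> simp [emul, develop, cellFlip] <;> ring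
    · intro g w y hw hy hg
      rw [e1] at hw hg
      rw [e0, label_cap_neg _ ht] at hw hg
      obtain ⟨h1, -⟩ := isCell_cap _ ht
      obtain rfl : w = capC _ := hw.unique h1
      exact Or.inl ⟨hy, hg⟩
    · intro y h1 h2 h3 h4
      simp only [Piece, cellFlip, Prod.fst_sub, Prod.snd_sub]
      omega
  · have e0 : cls e = cls (e + (0, -1)) + cls (0, 1) := by
      rw [← cls_add, add_assoc]; congr 1; ext <;> simp
    have e1 : cls e + cls (1, 0) = cls (e + (0, -1)) + cls (1, 1) := by
      rw [← cls_add, ← cls_add, add_assoc]; simp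
    rw [← cls_add] at ht
    refine ⟨e + (0, -1), 2, ht, fun y => (y.1 - q, p + q + y.2), ?_, ?_, ?_⟩
    · intro y
      ext <;> simp [emul, develop] <;> ring
    · intro g w y hw hy hg
      rw [e1] at hw hg
      rw [e0] at hw hg
      obtain ⟨-, h1⟩ := isCell_cap _ ht
      obtain rfl : w = capB _ := hw.unique h1.rotate.rotate
      right
      have e : capFlip p q (y.1 - q, p + q + y.2) = cellRot p q (cellFlip p q y) := by
        ext <;> simp [cellRot, cellFlip, capFlip] <;> ring
      rw [e]
      refine ⟨inCell_cellRot.2 hy, hg.trans (cellPoint_cellRot hw _).symm⟩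
    · intro y h1 h2 h3 h4
      simp only [Piece]
      omega

theorem TriangleLift.halfStep_of_touchesCap (hp : 0 < p) (h : TriangleLift p q e u y f x)
    (hF : FreeTriangle (cls e) u) (ht : TouchesCap (cls e) u)
    (hcap : ∀ α y, α.1 = 0 → ¬ CapFace p q α y f) (hd : y' - y ∈ units) {w : IcoVertex}
    (hw : IsCell (label (cls e + cls u)) (label (cls e)) w) (hy' : InCell p q (cellFlip p q y'))
    (hg : g.1 = cellPoint p q (label (cls e + cls u)) (label (cls e)) w (cellFlip p q y')) :
    HalfStep p q f g x (x + emul u (y' - y)) := by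
  obtain ⟨A, i, hA, φ, h1, h2, h3⟩ := ht.exists_cap (p := p) (q := q) h.mem
  have hi := h.inCell
  -- The face lies in no cap, hence not on the common edge. The strict inequality gives the room
  -- needed to place it in the same part as its neighbour.
  have hC : 0 < weightC p q y := by
    by_contra hC
    have hC0 : weightC p q y = 0 := le_antisymm (not_lt.1 hC) hi.2.2
    obtain ⟨k1, k2⟩ := cellPoint_eq_cellFlip h.isCell hw hi hC0
    exact hcap _ _ hA (h2 f w y hw k1 (h.val.trans k2))
  obtain ⟨b1, b2, b3⟩ := hi.bounds_of_pos hp hC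
  obtain ⟨b4, b5, b6, b7, b8, b9⟩ := hi.bounds hp
  obtain ⟨c1, c2, c3, c4, c5, c6⟩ := hy'.bounds hp
  obtain ⟨u1, u2, u3, u4, u5, u6⟩ := unit_bounds hd
  simp only [Prod.fst_sub, Prod.snd_sub, cellFlip] at c1 c2 c3 c4 c5 c6 u1 u2 u3 u4 u5 u6
  refine Or.inr ⟨A, i, φ y, φ y', hA, h3 y (by omega) (by omega) (by omega) (by omega),
    h3 y' (by omega) (by omega) (by omega) (by omega), Or.inr ?_, Or.inl (h2 g w y' hw hy' hg),
    ?_, ?_⟩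
  · rw [h1, ← h.eq]
    exact h.planeSpot hF
  · rw [h1, h.eq]
  · rw [h1, h.eq]
    ext <;> simp [emul] <;> ring

theorem TriangleLift.step_aux (hp : 0 < p) (h : TriangleLift p q e u y f x)
    (hF : FreeTriangle (cls e) u) (hcap : ∀ α y, α.1 = 0 → ¬ CapFace p q α y f)
    {d₁ d₂ d₃ : IcoVertex}
    (hs : CellStar (label (cls e)) (label (cls e + cls u)) (label (cls e + cls (rot u))) d₁ d₂ d₃)
    (hd : y' - y ∈ units)
    (hg : g.1 = chart p q (label (cls e)) (label (cls e + cls u)) (label (cls e + cls (rot u)))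
      d₁ d₂ d₃ y') (hy' : InCell p q y' ∨ InCell p q (cellFlip p q y')) :
    Step p q f g x (x + emul u (y' - y)) := by
  rcases hy' with hy' | hy'
  · rw [chart_of_inCell hy'] at hg
    refine Or.inl (Or.inl ⟨h.planeSpot hF, TriangleLift.planeSpot (e := e) (u := u) (y := y')
      ⟨h.mem, h.labelled, hy', hg, ?_⟩ hF⟩)
    rw [h.eq]
    ext <;> simp [emul] <;> ring
  · rw [chart_of_inCell_cellFlip hs hy'] at hg
    rcases hF.across h.mem with ha | ha | ha
    · have e0 : cls e + cls u + cls (-u) = cls e := by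
        rw [cls_neg, add_neg_cancel_right]
      have hc := ha.1.isCell (neg_mem_units h.mem)
      rw [e0] at hc
      obtain rfl := hc.unique hs.cell₁
      rw [← cls_add] at ha
      refine Or.inl (Or.inl ⟨h.planeSpot hF, TriangleLift.planeSpot (e := e + u) (u := -u)
        (y := cellFlip p q y') ⟨neg_mem_units h.mem, ha.1, hy', ?_, ?_⟩ ha⟩)
      · rw [cls_add, e0, hg]
      · rw [h.eq]
        ext <;> simp [emul, cellFlip] <;> ring
    · exact Or.inl (h.halfStep_of_touchesCap hp hF ha hcap hd hs.cell₁ hy' hg)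
    -- The cap is touched at its antipodal position, so both points are negated.
    · right
      have e1 : label (cls (-e)) = label (cls e) := by rw [cls_neg, label_neg]
      have e2 : label (cls (-e) + cls (-u)) = label (cls e + cls u) := by
        rw [cls_neg, cls_neg, ← neg_add, label_neg]
      have hF' := hF.neg h.mem
      rw [← cls_neg] at hF' ha
      have := h.neg.halfStep_of_touchesCap (g := g) hp hF' ha hcap hd (w := d₁)
        (by rw [e1, e2]; exact hs.cell₁) hy' (by rw [e1, e2]; exact hg)
      convert this using 1
      ext <;> simp [emul] <;> ring

/-- The neighbours of a face which is no corner and lies in no cap. -/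
theorem TriangleLift.exists_localChart (hp : 0 < p) (h : TriangleLift p q e u y f x)
    (hF : FreeTriangle (cls e) u) (hcap : ∀ α y, α.1 = 0 → ¬ CapFace p q α y f)
    (hf : NonCorner f) :
    ∃ X, LocalChart (fullereneFaceGraph p q) f X ∧
      ∀ d ∈ units, Step p q f (X d) x (x + emul u d) := by
  obtain ⟨d₁, d₂, d₃, hs⟩ := h.isCell.exists_star
  obtain ⟨X, hX, hX'⟩ := hf.exists_localChart hp hs h.inCell h.val
  refine ⟨X, hX, fun d hd => ?_⟩
  have hg := hX' d hd
  set y' := y + d with hy'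
  have hd' : y' - y ∈ units := by simpa [hy'] using hd
  have hxd : emul u d = emul u (y' - y) := by simp [hy']
  rw [hxd]
  have r1 := (cellRot_sub_mem_units (p := p) (q := q)).2 hd'
  have r2 := (cellRot_sub_mem_units (p := p) (q := q)).2 r1
  have e1 : emul (rot (rot u)) (cellRot p q y' - cellRot p q y) = emul u (y' - y) := by
    ext <;> simp [emul, rot, cellRot] <;> ring
  have e2 : emul (rot (rot (rot (rot u)))) (cellRot p q (cellRot p q y') -
      cellRot p q (cellRot p q y)) = emul u (y' - y) := by
    ext <;> simp [emul, rot, cellRot] <;> ring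
  have n1 : cls (e + u) = cls e + cls u := cls_add _ _
  have n2 : cls (e + u) + cls (rot (rot u)) = cls e + cls (rot u) := by
    simp only [← cls_add]; congr 1; ext <;> simp [rot] <;> ring
  have n3 : cls (e + u) + cls (rot (rot (rot u))) = cls e := by
    simp only [← cls_add]; congr 1; ext <;> simp [rot]
  have n4 : cls (e + u + rot (rot u)) = cls e + cls (rot u) := by
    rw [cls_add, n2]
  have n5 : cls (e + u + rot (rot u)) + cls (rot (rot (rot (rot u)))) = cls e := by
    simp only [← cls_add]; congr 1; ext <;> simp [rot] <;> ring
  have n6 : cls (e + u + rot (rot u)) + cls (rot (rot (rot (rot (rot u))))) =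
      cls e + cls u := by
    simp only [← cls_add]; congr 1; ext <;> simp [rot] <;> ring
  have hF1 := hF.rotate h.mem
  have hF2 := hF1.rotate h.rotate.mem
  rw [← n1] at hF1 hF2
  rw [← cls_add] at hF2
  by_cases hC : weightC p q y' ≤ 0
  · exact h.step_aux hp hF hcap hs hd' hg
      (Or.inr (inCell_cellFlip_of_unit hp hf hs h.inCell h.val hd' hC))
  by_cases hA : weightA p q y' ≤ 0
  · have := h.rotate.step_aux hp hF1 hcap (d₁ := d₂) (d₂ := d₃) (d₃ := d₁) (by rw [n2, n3, n1]; exact hs.rotate) r1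
      (by rw [n2, n3, n1, chart_cellRot hs, hg]) (Or.inr ?_)
    · rwa [e1] at this
    · exact inCell_cellFlip_of_unit hp hf hs.rotate (inCell_cellRot.2 h.inCell)
        (h.val.trans (cellPoint_cellRot hs.cell y).symm) r1 (by rwa [weightC_cellRot])
  by_cases hB : weightB p q y' ≤ 0
  · have := h.rotate.rotate.step_aux hp hF2 hcap (d₁ := d₃) (d₂ := d₁) (d₃ := d₂)
      (by rw [n5, n6, n4]; exact hs.rotate.rotate) r2
      (by rw [n5, n6, n4, chart_cellRot hs.rotate, chart_cellRot hs, hg]) (Or.inr ?_)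
    · rwa [e2] at this
    · refine inCell_cellFlip_of_unit hp hf hs.rotate.rotate
        (inCell_cellRot.2 (inCell_cellRot.2 h.inCell)) ?_ r2
        (by rwa [weightC_cellRot, weightA_cellRot])
      rw [cellPoint_cellRot hs.rotate.cell, cellPoint_cellRot hs.cell, h.val]
  · exact h.step_aux hp hF hcap hs hd' hg (Or.inl ⟨by omega, by omega, by omega⟩)

end

/-! ### Charts around the faces of a cap -/

/-- The outer cells come in pairs: the cell beyond `b t` is itself the outer cell of a cap, whose
centre is found by a point reflection. This is the one neighbour of a cap that is not free. -/
theorem cap_opposite : ∀ α : Cls, α.1 = 0 → LabelledTriangle (α + cls (1, 1)) (0, -1) ∧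
    (-α + cls (-2, -1)).1 = 0 ∧ capB (-α + cls (-2, -1)) = capT α ∧
    capT (-α + cls (-2, -1)) = capB α := by decide +kernel

section
variable {p q : ℕ} {A y d : ℤ × ℤ} {f : FullereneFace p q}

/-- The edge `b c` leads into the outer cell and the edges `c a`, `a b` into free triangles next to
parts 0 and 1. The last clause lets consecutive faces of a cut be recognized in the chart. -/
theorem CapFace.exists_localChart_of_inCell (hp : 0 < p) (hA : (cls A).1 = 0) (hy : InCell p q y)
    (h : f.1 = cellPoint p q (capA (cls A)) (capB (cls A)) (capC (cls A)) y) (hf : NonCorner f) :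
    ∃ X, LocalChart (fullereneFaceGraph p q) f X ∧ ∀ d ∈ units, ∃ i, Piece p q i y ∧
      Piece p q i (y + d) ∧ CapSpot p q A i (y + d) (X d) ∧
        ∀ g, CapFace p q (cls A) (y + d) g → g = X d := by
  obtain ⟨c1, c2⟩ := isCell_cap _ hA
  obtain ⟨hF1, hF2, hF3, -⟩ := freeTriangle_cap _ hA
  obtain ⟨d₁, d₂, d₃, hs⟩ := c1.exists_star
  obtain ⟨X, hX, hX'⟩ := hf.exists_localChart hp hs hy h
  refine ⟨X, hX, fun d hd => ?_⟩
  have hg := hX' d hd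
  have huniq : ∀ g, CapFace p q (cls A) (y + d) g → g = X d := by
    rintro g (⟨k1, k2⟩ | ⟨k1, k2⟩)
    · exact Subtype.ext (by rw [hg, chart_of_inCell k1, k2])
    · obtain rfl := hs.cell₂.unique c2
      rw [capFlip_eq] at k1 k2
      exact Subtype.ext (by rw [hg, k2, ← chart_cellRot hs, chart_of_inCell_cellFlip hs.rotate k1])
  suffices ∃ i, Piece p q i y ∧ Piece p q i (y + d) ∧ CapSpot p q A i (y + d) (X d) by
    obtain ⟨i, k1, k2, k3⟩ := this
    exact ⟨i, k1, k2, k3, huniq⟩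
  set y' := y + d with hy'
  have hd' : y' - y ∈ units := by simpa [hy'] using hd
  have r1 := (cellRot_sub_mem_units (p := p) (q := q)).2 hd'
  have r2 := (cellRot_sub_mem_units (p := p) (q := q)).2 r1
  obtain ⟨u1, u2, u3, u4, u5, u6⟩ := unit_bounds hd'
  obtain ⟨b1, b2, b3, b4, b5, b6⟩ := hy.bounds hp
  simp only [Prod.fst_sub, Prod.snd_sub] at u1 u2 u3 u4 u5 u6
  have hfr := h.trans (cellPoint_cellRot c1 y).symm
  by_cases hA' : weightA p q y' ≤ 0
  · obtain ⟨i, hi, hi'⟩ := exists_piece (p := p) (q := q) hd'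
    refine ⟨i, hi, hi', Or.inl (Or.inr ?_)⟩
    have hfl := inCell_cellFlip_of_unit hp hf hs.rotate (inCell_cellRot.2 hy) hfr r1
      (by rwa [weightC_cellRot])
    obtain rfl := hs.cell₂.unique c2
    rw [capFlip_eq]
    refine ⟨hfl, ?_⟩
    rw [hg, ← chart_cellRot hs, chart_of_inCell_cellFlip hs.rotate hfl]
  by_cases hB : weightB p q y' < 0
  · have hfl := inCell_cellFlip_of_unit hp hf hs.rotate.rotate
      (inCell_cellRot.2 (inCell_cellRot.2 hy))
      (hfr.trans (cellPoint_cellRot c1.rotate _).symm) r2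
      (by rw [weightC_cellRot, weightA_cellRot]; exact hB.le)
    have hv : cellFlip p q (cellRot p q (cellRot p q y')) = (y'.1 + y'.2, -y'.1) := by
      ext <;> simp [cellFlip, cellRot] <;> ring
    have hpos : 0 < weightC p q (y'.1 + y'.2, -y'.1) := by
      rw [← hv, weightC_cellFlip, weightC_cellRot, weightA_cellRot]; omega
    have hval := chart_of_inCell_cellFlip hs.rotate.rotate hfl
    rw [chart_cellRot hs.rotate, chart_cellRot hs, ← hg, hv] at hval
    rw [hv] at hfl
    obtain ⟨v1, v2, v3⟩ := hfl.bounds_of_pos hp hpos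
    obtain ⟨w1, w2, w3, w4, w5, w6⟩ := hfl.bounds hp
    have e0 : cls (A + (-1, 1)) = cls A + cls (-1, 1) := cls_add _ _
    have e1 : cls A + cls (-1, 1) + cls (1, 0) = cls A + cls (0, 1) := by
      rw [add_assoc, ← cls_add]; rfl
    have hc := hF1.1.isCell (by decide)
    rw [e1] at hc
    obtain rfl := hc.unique hs.cell₃
    refine ⟨0, ?_, ?_, Or.inr (TriangleLift.planeSpot (e := A + (-1, 1)) (u := (1, 0))
      (y := (y'.1 + y'.2, -y'.1)) ⟨by decide, by rw [e0]; exact hF1.1, hfl, ?_, ?_⟩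
      (by rw [e0]; exact hF1))⟩
    · simp only [Piece]; simp only at v1; omega
    · simp only [Piece]; simp only at v1 w6; omega
    · rw [e0, e1]; exact hval
    · ext <;> simp [emul, develop] <;> ring
  by_cases hC : weightC p q y' < 0
  · have hfl := inCell_cellFlip_of_unit hp hf hs hy h hd' hC.le
    have hpos : 0 < weightC p q (cellFlip p q y') := by
      rw [weightC_cellFlip]; omega
    have hval := chart_of_inCell_cellFlip hs hfl
    rw [← hg] at hval
    obtain ⟨v1, v2, v3⟩ := hfl.bounds_of_pos hp hpos
    have e0 : cls (A + (-1, 0)) = cls A + cls (-1, 0) := cls_add _ _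
    have e1 : cls A + cls (-1, 0) + cls (0, 1) = cls A + cls (-1, 1) := by
      rw [add_assoc, ← cls_add]; rfl
    have hc := hF2.1.isCell (by decide)
    rw [e1, label_cap_neg _ hA] at hc
    obtain rfl := hc.unique hs.cell₁
    refine ⟨1, ?_, ?_, Or.inr (TriangleLift.planeSpot (e := A + (-1, 0)) (u := (0, 1))
      (y := cellFlip p q y') ⟨by decide, by rw [e0]; exact hF2.1, hfl, ?_, ?_⟩
      (by rw [e0]; exact hF2))⟩
    · simp only [Piece]; simp only [cellFlip, Prod.fst_sub, Prod.snd_sub] at v1 v2 v3; omega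
    · simp only [Piece]; simp only [cellFlip, Prod.fst_sub, Prod.snd_sub] at v1 v2 v3; omega
    · rw [e0, e1, label_cap_neg _ hA]; exact hval
    · ext <;> simp [emul, develop, cellFlip] <;> ring
  · obtain ⟨i, hi, hi'⟩ := exists_piece (p := p) (q := q) hd'
    have hy'' : InCell p q y' := ⟨by omega, by omega, by omega⟩
    rw [chart_of_inCell hy''] at hg
    exact ⟨i, hi, hi', Or.inl (Or.inl ⟨hy'', hg⟩)⟩

/-- The coordinates of the outer cell are turned by 60° against those of the cap, so directions pass
through `rot`. -/
theorem CapFace.exists_localChart_of_inCell_capFlip (hp : 0 < p) (hA : (cls A).1 = 0)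
    (hy : InCell p q (capFlip p q y))
    (h : f.1 = cellPoint p q (capC (cls A)) (capB (cls A)) (capT (cls A)) (capFlip p q y))
    (hf : NonCorner f) :
    ∃ X, LocalChart (fullereneFaceGraph p q) f X ∧ ∀ d ∈ units, ∃ i, Piece p q i y ∧
      Piece p q i (y + d) ∧ CapSpot p q A i (y + d) (X d) ∧
        ∀ g, CapFace p q (cls A) (y + d) g → g = X d := by
  obtain ⟨c1, c2⟩ := isCell_cap _ hA
  obtain ⟨hF1, hF2, hF3, -⟩ := freeTriangle_cap _ hA
  obtain ⟨hL, hα', lB, lT⟩ := cap_opposite _ hA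
  obtain ⟨d₁, d₂, d₃, hs⟩ := c2.exists_star
  obtain ⟨X, hX, hX'⟩ := hf.exists_localChart hp hs hy h
  have hX2 : ∀ d ∈ units, ∃ d' ∈ units, capFlip p q (y + d) = capFlip p q y + d' := by
    intro d hd
    refine ⟨capFlip p q (y + d) - capFlip p q y, ?_, by abel⟩
    rw [capFlip_eq, capFlip_eq, cellFlip_sub_mem_units, cellRot_sub_mem_units]
    simpa using hd
  have hlin : ∀ d d' : ℤ × ℤ, capFlip p q (y + d) = capFlip p q y + d' → d' = rot d := by
    intro d d' e
    simp only [capFlip, Prod.ext_iff, Prod.fst_add, Prod.snd_add] at e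
    ext <;> simp only [rot] <;> omega
  have hrot : ∀ d ∈ units, rot d ∈ units := by decide
  have hrot' : ∀ d ∈ units, ∃ d' ∈ units, rot d' = d := by decide
  have hri : ∀ d d' : ℤ × ℤ, rot d = rot d' → d = d' := by
    intro d d' e
    simp only [rot, Prod.mk.injEq] at e
    ext <;> omega
  have hcr : ∀ d, capFlip p q (y + d) = capFlip p q y + rot d := by
    intro d
    ext <;> simp [capFlip, rot] <;> ring
  refine ⟨fun d => X (rot d), ⟨fun d hd => hX.adj _ (hrot d hd), fun g hg => ?_,
    fun d hd d' hd' e => hri _ _ (hX.inj _ (hrot d hd) _ (hrot d' hd') e),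
    fun d hd d' hd' e => ?_⟩, fun d hd => ?_⟩
  · obtain ⟨d, hd, e⟩ := hX.exists_of_adj g hg
    obtain ⟨d', hd', rfl⟩ := hrot' d hd
    exact ⟨d', hd', e⟩
  · have := hX.sub_mem _ (hrot d hd) _ (hrot d' hd') e
    have key : rot d' - rot d = rot (d' - d) := by ext <;> simp [rot] <;> ring
    rw [key] at this
    obtain ⟨d'', h1, h2⟩ := hrot' _ this
    rwa [← hri _ _ h2]
  have hg := hX' _ (hrot d hd)
  rw [← hcr] at hg
  have huniq : ∀ g, CapFace p q (cls A) (y + d) g → g = X (rot d) := by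
    rintro g (⟨k1, k2⟩ | ⟨k1, k2⟩)
    · obtain rfl := hs.cell₁.unique c1.rotate
      refine Subtype.ext ?_
      have k3 : InCell p q (cellFlip p q (capFlip p q (y + d))) := by
        rwa [capFlip_eq, cellFlip_cellFlip, inCell_cellRot]
      rw [hg, chart_of_inCell_cellFlip hs k3, capFlip_eq, cellFlip_cellFlip, cellPoint_cellRot c1, k2]
    · exact Subtype.ext (by rw [hg, chart_of_inCell k1, k2])
  suffices ∃ i, Piece p q i y ∧ Piece p q i (y + d) ∧ CapSpot p q A i (y + d) (X (rot d)) by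
    obtain ⟨i, k1, k2, k3⟩ := this
    exact ⟨i, k1, k2, k3, huniq⟩
  set y' := y + d with hy'
  have hd' : y' - y ∈ units := by simpa [hy'] using hd
  have r0 : capFlip p q y' - capFlip p q y ∈ units := by
    rw [hcr, add_sub_cancel_left]; exact hrot d hd
  have r1 := (cellRot_sub_mem_units (p := p) (q := q)).2 r0
  have r2 := (cellRot_sub_mem_units (p := p) (q := q)).2 r1
  obtain ⟨u1, u2, u3, u4, u5, u6⟩ := unit_bounds hd'
  obtain ⟨b1, b2, b3, b4, b5, b6⟩ := hy.bounds hp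
  -- In the cap only the corner t reaches the value 2p + q. The strict bound keeps the neighbour
  -- across `b t` in the third part of the opposite cap.
  have hsum : y.1 + y.2 < 2 * p + q := by
    have hw := hf.weight_le hp c2 hy h
    obtain ⟨e1, e2⟩ := position_eq p q (capFlip p q y)
    have hN := latNorm_pos q hp
    have hsw := weight_sum p q (capFlip p q y)
    have hP : (0 : ℤ) < p := by exact_mod_cast hp
    have hQ : (0 : ℤ) ≤ q := by positivity
    by_contra! hge
    have h2 : (capFlip p q y).2 = p + q := by
      have : (capFlip p q y).2 = y.1 + y.2 - p := rfl
      omega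
    rw [h2, ← hsw] at e2
    have c1 := mul_nonneg hy.1 hQ
    have c2 : 0 < (weightA p q (capFlip p q y) + weightB p q (capFlip p q y)) * (p : ℤ) :=
      mul_pos (by omega) hP
    linarith
  simp only [Prod.fst_sub, Prod.snd_sub] at u1 u2 u3 u4 u5 u6
  have hfr := h.trans (cellPoint_cellRot c2 _).symm
  by_cases hC' : weightC p q (capFlip p q y') ≤ 0
  · obtain ⟨i, hi, hi'⟩ := exists_piece (p := p) (q := q) hd'
    refine ⟨i, hi, hi', Or.inl (Or.inl ?_)⟩
    have hfl := inCell_cellFlip_of_unit hp hf hs hy h r0 hC'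
    have hval := chart_of_inCell_cellFlip hs hfl
    obtain rfl := hs.cell₁.unique c1.rotate
    rw [← hg, capFlip_eq, cellFlip_cellFlip, cellPoint_cellRot c1] at hval
    rw [capFlip_eq, cellFlip_cellFlip, inCell_cellRot] at hfl
    exact ⟨hfl, hval⟩
  by_cases hA' : weightA p q (capFlip p q y') < 0
  · have hfl := inCell_cellFlip_of_unit hp hf hs.rotate (inCell_cellRot.2 hy) hfr r1
      (by rw [weightC_cellRot]; exact hA'.le)
    have hpos : 0 < weightC p q (cellFlip p q (cellRot p q (capFlip p q y'))) := by
      rw [weightC_cellFlip, weightC_cellRot]; omega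
    have hval := chart_of_inCell_cellFlip hs.rotate hfl
    rw [chart_cellRot hs, ← hg] at hval
    obtain ⟨v1, v2, v3⟩ := hfl.bounds_of_pos hp hpos
    have e0 : cls (A + (1, 1)) = cls A + cls (1, 1) := cls_add _ _
    have e1 : cls A + cls (1, 1) + cls (0, -1) = cls A + cls (1, 0) := by
      rw [add_assoc, ← cls_add]; rfl
    have hc := hL.isCell (by decide)
    rw [e1] at hc
    obtain rfl := hc.unique hs.cell₂
    have hs1 : (cellFlip p q (cellRot p q (capFlip p q y'))).1 = 2 * p + q - (y'.1 + y'.2) := by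
      simp [cellFlip, cellRot, capFlip]; ring
    -- The triangle beyond `b t` is not free, so the position comes from the opposite cap after
    -- negation. Its centre is -A - (2, 1), and (2p - q, p + 3q) is z (2 + ω).
    refine ⟨2, ?_, ?_, Or.inr ⟨⟨A + (1, 1), (0, -1),
      cellFlip p q (cellRot p q (capFlip p q y')), ⟨by decide, by rw [e0]; exact hL, hfl, ?_, ?_⟩⟩,
      fun S => Or.inr (Or.inr ⟨-A + (-2, -1), 2, (2 * p - q - y'.1, p + 3 * q - y'.2), ?_⟩)⟩⟩
    · simp only [Piece]; omega
    · simp only [Piece]; omega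
    · rw [e0, e1]; exact hval
    · ext <;> simp [emul, develop, cellFlip, cellRot, capFlip] <;> ring
    · have e3 : cls (-A + (-2, -1)) = -cls A + cls (-2, -1) := by rw [cls_add, cls_neg]
      obtain ⟨-, c3⟩ := isCell_cap _ hα'
      rw [lB, lT] at c3
      have h3 := c3.rotate.unique hc
      have e4 : capFlip p q (2 * p - q - y'.1, p + 3 * q - y'.2) =
          cellRot p q (cellRot p q (cellFlip p q (cellRot p q (capFlip p q y')))) := by
        ext <;> simp [cellFlip, cellRot, capFlip] <;> ring
      refine ⟨by rw [e3]; exact hα', ?_, fun h => absurd rfl h, Or.inr ⟨?_, ?_⟩, ?_⟩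
      · simp only [Piece]; omega
      · rw [e4]; exact inCell_cellRot.2 (inCell_cellRot.2 hfl)
      · rw [e3, lB, lT, e4]
        rw [cellPoint_cellRot c3.rotate.rotate, cellPoint_cellRot c3.rotate, h3]
        exact hval
      · ext <;> simp [emul, develop] <;> ring
  by_cases hB : weightB p q (capFlip p q y') < 0
  · have hfl := inCell_cellFlip_of_unit hp hf hs.rotate.rotate
      (inCell_cellRot.2 (inCell_cellRot.2 hy))
      (hfr.trans (cellPoint_cellRot c2.rotate _).symm) r2
      (by rw [weightC_cellRot, weightA_cellRot]; exact hB.le)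
    have hpos : 0 < weightC p q
        (cellFlip p q (cellRot p q (cellRot p q (capFlip p q y')))) := by
      rw [weightC_cellFlip, weightC_cellRot, weightA_cellRot]; omega
    have hval := chart_of_inCell_cellFlip hs.rotate.rotate hfl
    rw [chart_cellRot hs.rotate, chart_cellRot hs, ← hg] at hval
    obtain ⟨v1, v2, v3⟩ := hfl.bounds_of_pos hp hpos
    have e0 : cls (A + (0, 1)) = cls A + cls (0, 1) := cls_add _ _
    have e1 : cls A + cls (0, 1) + cls (1, 0) = cls A + cls (1, 1) := by
      rw [add_assoc, ← cls_add]; rfl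
    have hc := hF3.1.isCell (by decide)
    rw [e1] at hc
    obtain rfl := hc.unique hs.cell₃
    have hs1 : (cellFlip p q (cellRot p q (cellRot p q (capFlip p q y')))).2 =
        y'.2 - p - q := by
      simp [cellFlip, cellRot, capFlip]; ring
    refine ⟨2, ?_, ?_, Or.inr (TriangleLift.planeSpot (e := A + (0, 1)) (u := (1, 0))
      (y := cellFlip p q (cellRot p q (cellRot p q (capFlip p q y'))))
      ⟨by decide, by rw [e0]; exact hF3.1, hfl, ?_, ?_⟩ (by rw [e0]; exact hF3))⟩
    · simp only [Piece]; omega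
    · simp only [Piece]; omega
    · rw [e0, e1]; exact hval
    · ext <;> simp [emul, develop, cellFlip, cellRot, capFlip] <;> ring
  · obtain ⟨i, hi, hi'⟩ := exists_piece (p := p) (q := q) hd'
    have hy'' : InCell p q (capFlip p q y') := ⟨by omega, by omega, by omega⟩
    rw [chart_of_inCell hy''] at hg
    exact ⟨i, hi, hi', Or.inl (Or.inr ⟨hy'', hg⟩)⟩

/-- The neighbours of a face of a cap which is no corner. -/
theorem CapFace.exists_localChart (hp : 0 < p) (hA : (cls A).1 = 0)
    (h : CapFace p q (cls A) y f) (hf : NonCorner f) :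
    ∃ X, LocalChart (fullereneFaceGraph p q) f X ∧ ∀ d ∈ units, ∃ i, Piece p q i y ∧
      Piece p q i (y + d) ∧ CapSpot p q A i (y + d) (X d) ∧
        ∀ g, CapFace p q (cls A) (y + d) g → g = X d := by
  rcases h with ⟨hy, h⟩ | ⟨hy, h⟩
  · exact CapFace.exists_localChart_of_inCell hp hA hy h hf
  · exact CapFace.exists_localChart_of_inCell_capFlip hp hA hy h hf

end

/-! ### The parity of the rows -/

section
variable {p q : ℕ} {S : ℤ × ℤ → Prop} {x x' : ℤ × ℤ} {f g : FullereneFace p q}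

/-- Each cell is shown by a free triangle or lies in a cap. -/
theorem IsCell.exists_position {a b c : IcoVertex} (p q : ℕ) (h : IsCell a b c) :
    (∃ e u, u ∈ units ∧ FreeTriangle (cls e) u ∧ a = label (cls e) ∧
      b = label (cls e + cls u) ∧ c = label (cls e + cls (rot u))) ∨
    ∃ A, ∃ φ : ℤ × ℤ → ℤ × ℤ, (cls A).1 = 0 ∧ (∀ y y', φ y' - φ y ∈ units ↔ y' - y ∈ units) ∧
      ∀ (f : FullereneFace p q) (y : ℤ × ℤ), InCell p q y → f.1 = cellPoint p q a b c y →
        CapFace p q (cls A) (φ y) f := by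
  rcases h.free_or_cap with ⟨γ, u, hu, hF, ha, hb, hc⟩ | ⟨α, hα, hm⟩
  · obtain ⟨e, rfl⟩ := exists_cls_eq γ
    exact Or.inl ⟨e, u, hu, hF, ha, hb, hc⟩
  right
  obtain ⟨A, rfl⟩ := exists_cls_eq α
  obtain ⟨c1, c2⟩ := isCell_cap _ hα
  have key : ∀ y, capFlip p q (cellRot p q (cellRot p q (cellFlip p q y))) = y := by
    intro y; rw [capFlip_eq, cellRot_cellRot_cellRot, cellFlip_cellFlip]
  have k1 : ∀ y y', cellRot p q y' - cellRot p q y ∈ units ↔ y' - y ∈ units :=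
    fun y y' => cellRot_sub_mem_units
  have k2 : ∀ y y', cellRot p q (cellRot p q y') - cellRot p q (cellRot p q y) ∈ units ↔
      y' - y ∈ units := fun y y' => by rw [k1, k1]
  have k3 : ∀ y y', cellRot p q (cellRot p q (cellFlip p q y')) -
      cellRot p q (cellRot p q (cellFlip p q y)) ∈ units ↔ y' - y ∈ units :=
    fun y y' => by rw [k2, cellFlip_sub_mem_units]
  simp only [List.mem_cons, Prod.mk.injEq, List.not_mem_nil, or_false] at hm
  rcases hm with ⟨rfl, rfl, rfl⟩ | ⟨rfl, rfl, rfl⟩ | ⟨rfl, rfl, rfl⟩ | ⟨rfl, rfl, rfl⟩ |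
    ⟨rfl, rfl, rfl⟩ | ⟨rfl, rfl, rfl⟩
  · exact ⟨A, id, hα, fun _ _ => Iff.rfl, fun f y hy hf => Or.inl ⟨hy, hf⟩⟩
  · refine ⟨A, fun y => cellRot p q (cellRot p q y), hα, k2, fun f y hy hf =>
      Or.inl ⟨inCell_cellRot.2 (inCell_cellRot.2 hy), ?_⟩⟩
    rw [cellPoint_cellRot h.rotate, cellPoint_cellRot h, hf]
  · refine ⟨A, fun y => cellRot p q y, hα, k1, fun f y hy hf => Or.inl ⟨inCell_cellRot.2 hy, ?_⟩⟩
    rw [cellPoint_cellRot h, hf]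
  · refine ⟨A, fun y => cellRot p q (cellRot p q (cellFlip p q y)), hα, k3, fun f y hy hf =>
      Or.inr ⟨by rwa [key], by rw [key, hf]⟩⟩
  · refine ⟨A, fun y => cellRot p q (cellRot p q (cellFlip p q (cellRot p q (cellRot p q y)))),
      hα, fun y y' => by rw [k3, k2], fun f y hy hf => Or.inr ⟨?_, ?_⟩⟩
    · rw [key]; exact inCell_cellRot.2 (inCell_cellRot.2 hy)
    · rw [key, cellPoint_cellRot h.rotate, cellPoint_cellRot h, hf]
  · refine ⟨A, fun y => cellRot p q (cellRot p q (cellFlip p q (cellRot p q y))),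
      hα, fun y y' => by rw [k3, k1], fun f y hy hf => Or.inr ⟨?_, ?_⟩⟩
    · rw [key]; exact inCell_cellRot.2 hy
    · rw [key, cellPoint_cellRot h, hf]

theorem FullereneFace.exists_position (f : FullereneFace p q) :
    (∃ A y, (cls A).1 = 0 ∧ CapFace p q (cls A) y f) ∨
      ((∀ α y, α.1 = 0 → ¬ CapFace p q α y f) ∧
        ∃ e u y x, FreeTriangle (cls e) u ∧ TriangleLift p q e u y f x) := by
  by_cases h : ∃ A y, (cls A).1 = 0 ∧ CapFace p q (cls A) y f
  · exact Or.inl h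
  right
  constructor
  · intro α y hα hf
    obtain ⟨A, rfl⟩ := exists_cls_eq α
    exact h ⟨A, y, hα, hf⟩
  · obtain ⟨a, b, c, x, hc, hx, hf⟩ := f.2
    rcases hc.exists_position p q with ⟨e, u, hu, hF, rfl, rfl, rfl⟩ | ⟨A, φ, hA, -, hφ⟩
    · exact ⟨e, u, x, _, hF, hu, hF.1, hx, hf, rfl⟩
    · exact absurd ⟨A, φ x, hA, hφ f x hx hf⟩ h

theorem CapFace.exists_lift {A y : ℤ × ℤ} (hA : (cls A).1 = 0) (h : CapFace p q (cls A) y f)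
    (hS : ¬ S y → Piece p q 2 y) : ∃ x, Lift p q S f x := by
  by_cases hy : S y
  · obtain ⟨i, hi, -⟩ := exists_piece (p := p) (q := q) (y := y) (y' := y + (1, 0))
      (by rw [add_sub_cancel_left]; decide)
    exact ⟨_, CapLift.lift (i := i) ⟨hA, hi, fun _ => hy, h, rfl⟩⟩
  · exact ⟨_, CapLift.lift (i := 2) ⟨hA, hS hy, fun h => absurd rfl h, h, rfl⟩⟩

theorem FullereneFace.exists_lift (hS : ∀ y, ¬ S y → Piece p q 2 y) (f : FullereneFace p q) :
    ∃ x, Lift p q S f x := by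
  rcases f.exists_position with ⟨A, y, hA, h⟩ | ⟨-, e, u, y, x, hF, h⟩
  · exact h.exists_lift hA (hS y)
  · exact ⟨x, Or.inl (Or.inl ⟨e, u, y, hF, h⟩)⟩

/-- The row of a point of the plane modulo two. -/
def rowParity (x : ℤ × ℤ) : ZMod 2 := (x.1 : ZMod 2)

/-- Translations come from index vectors with both coordinates even, and signs do not matter modulo
two. Across a gap the row is kept between parts 0 and 1 and between 0 and 2, and reflected in the
centre between 1 and 2. -/
theorem Lift.rowParity_eq (hp : 0 < p) (h : Lift p q (fun _ => True) f x)
    (h' : Lift p q (fun _ => True) f x') : rowParity x = rowParity x' := by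
  have key : ∀ a b : ℤ, (a : ZMod 2) = b ↔ a % 2 = b % 2 := fun a b => ZMod.intCast_eq_intCast_iff' a b 2
  refine h.unique (R := fun x x' => rowParity x = rowParity x') hp
    ⟨fun _ => rfl, fun h => h.symm, fun h h' => h.trans h'⟩ ?_ ?_ ?_ h'
  · intro x
    simp only [rowParity, key, Prod.fst_neg]
    omega
  · intro x l hl
    simp only [cls, Prod.ext_iff, Prod.fst_zero, Prod.snd_zero] at hl
    simp only [rowParity, Prod.fst_add, emul]
    push_cast
    rw [hl.2.1, hl.2.2]
    ring
  · intro A i j y hA hy hi hj _ _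
    simp only [rowParity, key, Prod.fst_add]
    fin_cases i <;> fin_cases j <;> simp only [Piece, develop] at hi hj ⊢ <;> omega

open Classical in
/-- The parity of the row of a face. -/
noncomputable def eps (f : FullereneFace p q) : ZMod 2 :=
  if h : ∃ x, Lift p q (fun _ => True) f x then rowParity h.choose else 0

theorem Lift.eps_eq (hp : 0 < p) (h : Lift p q (fun _ => True) f x) : eps f = rowParity x := by
  have he : ∃ x, Lift p q (fun _ => True) f x := ⟨x, h⟩
  rw [eps, dif_pos he]
  exact he.choose_spec.rowParity_eq hp h

theorem rowParity_neg (x : ℤ × ℤ) : rowParity (-x) = rowParity x := by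
  simp only [rowParity, Prod.fst_neg, ZMod.intCast_eq_intCast_iff' _ _ 2]
  push_cast
  omega

theorem CapSpot.eps_eq (hp : 0 < p) {A y : ℤ × ℤ} {i : Fin 3} (hA : (cls A).1 = 0)
    (hi : Piece p q i y) (h : CapSpot p q A i y f) :
    eps f = rowParity (emul ((p : ℤ), (q : ℤ)) A + develop p q i y) := by
  rcases h with h | h
  · exact (CapLift.lift (S := fun _ => True) ⟨hA, hi, fun _ => trivial, h, rfl⟩).eps_eq hp
  · exact (h.2 _).eps_eq hp

theorem HalfStep.eps_eq (hp : 0 < p) (h : HalfStep p q f g x x') :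
    eps f = rowParity x ∧ eps g = rowParity x' := by
  rcases h with ⟨h, h'⟩ | ⟨A, i, y, y', hA, hi, hi', h, h', rfl, rfl⟩
  · exact ⟨(h.2 _).eps_eq hp, (h'.2 _).eps_eq hp⟩
  · exact ⟨h.eps_eq hp hA hi, h'.eps_eq hp hA hi'⟩

theorem Step.eps_eq (hp : 0 < p) (h : Step p q f g x x') :
    eps f = rowParity x ∧ eps g = rowParity x' := by
  rcases h with h | h
  · exact h.eps_eq hp
  · rw [← rowParity_neg x, ← rowParity_neg x']
    exact h.eps_eq hp

theorem HalfStep.symm (h : HalfStep p q f g x x') : HalfStep p q g f x' x := by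
  rcases h with ⟨h, h'⟩ | ⟨A, i, y, y', hA, hi, hi', h, h', e, e'⟩
  · exact Or.inl ⟨h', h⟩
  · exact Or.inr ⟨A, i, y', y, hA, hi', hi, h', h, e', e⟩

theorem Step.symm (h : Step p q f g x x') : Step p q g f x' x := by
  rcases h with h | h
  · exact Or.inl h.symm
  · exact Or.inr h.symm

theorem develop_sub_mem_units {i : Fin 3} {y y' : ℤ × ℤ} (h : y' - y ∈ units) :
    develop p q i y' - develop p q i y ∈ units := by
  rw [mem_units_iff] at h ⊢
  simp only [latNorm, Prod.fst_sub, Prod.snd_sub] at h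
  fin_cases i <;> simp only [develop, latNorm, Prod.fst_sub, Prod.snd_sub] <;> rw [← h] <;> ring

theorem emul_mem_units {u d : ℤ × ℤ} (hu : u ∈ units) (hd : d ∈ units) : emul u d ∈ units := by
  have : ∀ u ∈ units, ∀ d ∈ units, emul u d ∈ units := by decide
  exact this u hu d hd

/-- Adjacent faces lie next to each other in the plane. -/
theorem exists_step_of_adj (hp : 0 < p) (h : (fullereneFaceGraph p q).Adj f g) :
    ∃ x x', x' - x ∈ units ∧ Step p q f g x x' := by
  have key : ∀ {f g : FullereneFace p q}, NonCorner f → (fullereneFaceGraph p q).Adj f g →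
      ∃ x x', x' - x ∈ units ∧ Step p q f g x x' := by
    intro f g hf h
    rcases f.exists_position with ⟨A, y, hA, hc⟩ | ⟨hcap, e, u, y, x, hF, hl⟩
    · obtain ⟨X, hX, hX'⟩ := hc.exists_localChart hp hA hf
      obtain ⟨d, hd, rfl⟩ := hX.exists_of_adj g h
      obtain ⟨i, hi, hi', hs, -⟩ := hX' d hd
      refine ⟨emul ((p : ℤ), (q : ℤ)) A + develop p q i y,
        emul ((p : ℤ), (q : ℤ)) A + develop p q i (y + d), ?_,
        Or.inl (Or.inr ⟨A, i, y, y + d, hA, hi, hi', Or.inl hc, hs, rfl, rfl⟩)⟩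
      rw [add_sub_add_left_eq_sub]
      exact develop_sub_mem_units (by simpa using hd)
    · obtain ⟨X, hX, hX'⟩ := hl.exists_localChart hp hF hcap hf
      obtain ⟨d, hd, rfl⟩ := hX.exists_of_adj g h
      refine ⟨x, x + emul u d, ?_, hX' d hd⟩
      rw [add_sub_cancel_left]
      exact emul_mem_units hl.mem hd
  by_cases hf : NonCorner f
  · exact key hf h
  by_cases hg : NonCorner g
  · obtain ⟨x, x', h1, h2⟩ := key hg h.symm
    exact ⟨x', x, sub_mem_units_comm.1 h1, h2.symm⟩
  simp only [NonCorner, not_forall, not_not] at hf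
  obtain ⟨v, hv⟩ := hf
  obtain ⟨b, c, hc, hf, hg⟩ := exists_cell_zero_one_of_corner_adj hp hv h
  have h0 : InCell p q 0 := by
    have := latNorm_pos q hp
    simp only [InCell, weightA, weightB, weightC, Prod.fst_zero, Prod.snd_zero]
    omega
  have h1 := inCell_zero_one (q := q) hp
  rcases hc.exists_position p q with ⟨e, u, hu, hF, rfl, rfl, rfl⟩ | ⟨A, φ, hA, hφ', hφ⟩
  · have l0 : TriangleLift p q e u 0 f _ := ⟨hu, hF.1, h0, hf, rfl⟩
    have l1 : TriangleLift p q e u (0, 1) g _ := ⟨hu, hF.1, h1, hg, rfl⟩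
    refine ⟨_, _, ?_, Or.inl (Or.inl ⟨l0.planeSpot hF, l1.planeSpot hF⟩)⟩
    rw [add_sub_add_left_eq_sub]
    have : emul u (0, 1) - emul u 0 = emul u (0, 1) := by simp [emul]
    rw [this]
    exact emul_mem_units hu (by decide)
  · have c0 := hφ f 0 h0 hf
    have c1 := hφ g (0, 1) h1 hg
    have hu := (hφ' 0 (0, 1)).2 (by decide)
    obtain ⟨i, hi, hi'⟩ := exists_piece (p := p) (q := q) hu
    refine ⟨_, _, ?_, Or.inl (Or.inr ⟨A, i, _, _, hA, hi, hi', Or.inl c0, Or.inl c1, rfl, rfl⟩)⟩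
    rw [add_sub_add_left_eq_sub]
    exact develop_sub_mem_units hu

end

/-! ### The length of closed walks along rows -/

theorem zmod_two_add_self (x : ZMod 2) : x + x = 0 := CharTwo.add_self_eq_zero x

/-- Modulo two the sums to the right and to the left of 0 need no sign. -/
theorem exists_primitive (t : ℤ → ZMod 2) : ∃ s : ℤ → ZMod 2, ∀ n, s (n + 1) = s n + t n := by
  refine ⟨fun n => ∑ i ∈ Finset.Ico 0 n, t i + ∑ i ∈ Finset.Ico n 0, t i, fun n => ?_⟩
  beta_reduce
  rcases le_or_gt 0 n with h | h
  · rw [Finset.Ico_eq_empty (a := n + 1) (by omega), Finset.Ico_eq_empty (a := n) (by omega)]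
    have : Finset.Ico 0 (n + 1) = insert n (Finset.Ico 0 n) := by
      ext i; simp only [Finset.mem_Ico, Finset.mem_insert]; omega
    rw [this, Finset.sum_insert (by simp)]
    simp [add_comm]
  · rw [Finset.Ico_eq_empty (b := n + 1) (by omega), Finset.Ico_eq_empty (b := n) (by omega)]
    have : Finset.Ico n 0 = insert n (Finset.Ico (n + 1) 0) := by
      ext i; simp only [Finset.mem_Ico, Finset.mem_insert]; omega
    rw [this, Finset.sum_insert (by simp)]
    linear_combination -zmod_two_add_self (t n)

/-- The steps `w → w + ω` in a row of the gaps around the origin which count twice. -/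
def Designated (p q : ℕ) (w : ℤ × ℤ) : Prop :=
  -- In a row m < 0 the three alternatives belong to the gaps between parts 0 and 2 (from p - m to p
  -- + q), between parts 1 and 0 (from -q - m to p), and between the reflected part 2 and part 1
  -- (from -m - p - q to -q). A step is taken only when the width, m + q, m + p + q or m + p, is
  -- odd. In the last gap it is the final step, since the first may lie outside the hexagon.
  w.1 < 0 ∧ ((w.2 = p - w.1 ∧ -(q : ℤ) < w.1 ∧ (w.1 + q) % 2 = 1) ∨
    (w.2 = -q - w.1 ∧ -(p : ℤ) - q < w.1 ∧ (w.1 + p + q) % 2 = 1) ∨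
    (w.2 = -q - 1 ∧ -(p : ℤ) < w.1 ∧ (w.1 + p) % 2 = 1))

/-- The step from `x` to `x + ω` is designated with respect to the center `A`. -/
def DesignatedAt (p q : ℕ) (A x : ℤ × ℤ) : Prop :=
  Designated p q (x - emul ((p : ℤ), (q : ℤ)) A) ∨
    Designated p q (-(x - emul ((p : ℤ), (q : ℤ)) A) - (0, 1))

open Classical in
/-- The correction to the length of the step from `x` to `x + ω`. -/
noncomputable def stepWeight (p q : ℕ) (x : ℤ × ℤ) : ZMod 2 :=
  if ∃ A, (cls A).1 = 0 ∧ DesignatedAt p q A x then 1 else 0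

theorem exists_potential (p q : ℕ) : ∃ s : ℤ × ℤ → ZMod 2,
    ∀ x, s (x + (0, 1)) = s x + 1 + stepWeight p q x := by
  have : ∀ m : ℤ, ∃ s : ℤ → ZMod 2, ∀ n, s (n + 1) = s n + (1 + stepWeight p q (m, n)) :=
    fun m => exists_primitive _
  choose s hs using this
  exact ⟨fun x => s x.1 x.2, fun x => by
    simp only [Prod.fst_add, Prod.snd_add, add_zero, hs, add_assoc]⟩

/-- The length of the row up to a given point, modulo two. -/
noncomputable def potential (p q : ℕ) : ℤ × ℤ → ZMod 2 := (exists_potential p q).choose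

theorem potential_add (p q : ℕ) (x : ℤ × ℤ) :
    potential p q (x + (0, 1)) = potential p q x + 1 + stepWeight p q x :=
  (exists_potential p q).choose_spec x

section
variable {p q : ℕ}

/-- Only the residue modulo the ideal has to vanish, not the class: the corrections depend on the
set of centres, and so have a finer period than the labels. -/
theorem stepWeight_add {l : ℤ × ℤ} (hl : (cls l).1 = 0) (x : ℤ × ℤ) :
    stepWeight p q (x + emul ((p : ℤ), (q : ℤ)) l) = stepWeight p q x := by
  have key : ∀ A : ℤ × ℤ, x + emul ((p : ℤ), (q : ℤ)) l - emul ((p : ℤ), (q : ℤ)) (A + l) =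
      x - emul ((p : ℤ), (q : ℤ)) A := by
    intro A; ext <;> simp [emul] <;> ring
  have hiff : (∃ A, (cls A).1 = 0 ∧ DesignatedAt p q A (x + emul ((p : ℤ), (q : ℤ)) l)) ↔
      ∃ A, (cls A).1 = 0 ∧ DesignatedAt p q A x := by
    constructor
    · rintro ⟨A, hA, h⟩
      refine ⟨A - l, ?_, ?_⟩
      · rw [sub_eq_add_neg, cls_add, cls_neg, Prod.fst_add, Prod.fst_neg, hA, hl]; simp
      · rwa [DesignatedAt, ← key, sub_add_cancel]
    · rintro ⟨A, hA, h⟩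
      refine ⟨A + l, ?_, ?_⟩
      · rw [cls_add, Prod.fst_add, hA, hl, add_zero]
      · rwa [DesignatedAt, key]
  classical exact if_congr hiff rfl rfl

/-- The point reflection takes the step from x to x + ω to the step from -x - ω to -x, reversed. -/
theorem stepWeight_neg (x : ℤ × ℤ) :
    stepWeight p q (-x - (0, 1)) = stepWeight p q x := by
  have key : ∀ A x : ℤ × ℤ, DesignatedAt p q A x → DesignatedAt p q (-A) (-x - (0, 1)) := by
    rintro A x (h | h)
    · right
      convert h using 1
      ext <;> simp [emul] <;> ring
    · left
      convert h using 1
      ext <;> simp [emul] <;> ring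
  have hc : ∀ A : ℤ × ℤ, (cls A).1 = 0 → (cls (-A)).1 = 0 := by
    intro A hA; rw [cls_neg, Prod.fst_neg, hA, neg_zero]
  have hiff : (∃ A, (cls A).1 = 0 ∧ DesignatedAt p q A (-x - (0, 1))) ↔
      ∃ A, (cls A).1 = 0 ∧ DesignatedAt p q A x := by
    constructor
    · rintro ⟨A, hA, h⟩
      refine ⟨-A, hc A hA, ?_⟩
      have := key _ _ h
      simpa using this
    · rintro ⟨A, hA, h⟩
      exact ⟨-A, hc A hA, key _ _ h⟩
  classical exact if_congr hiff rfl rfl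

/-- A function of the plane which does not change along rows. -/
theorem eq_of_row_eq {F : ℤ × ℤ → ZMod 2} (hF : ∀ x, F (x + (0, 1)) = F x) {x y : ℤ × ℤ}
    (h : x.1 = y.1) : F x = F y := by
  have key : ∀ (m n : ℤ), F (m, n) = F (m, 0) := by
    intro m n
    induction n using Int.induction_on with
    | zero => rfl
    | succ i ih => rw [← ih, ← hF (m, (i : ℤ))]; simp
    | pred i ih => rw [← ih, ← hF (m, -(i : ℤ) - 1)]; simp
  obtain ⟨m, n⟩ := x
  obtain ⟨m', n'⟩ := y
  simp only at h
  subst h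
  rw [key m n, key m n']

/-- The translate satisfies the same recursion along the row as the potential itself, so the two
differ by a constant on each row. -/
theorem potential_add_row {l : ℤ × ℤ} (hl : (cls l).1 = 0) {x y : ℤ × ℤ} (h : x.1 = y.1) :
    potential p q (x + emul ((p : ℤ), (q : ℤ)) l) + potential p q x =
      potential p q (y + emul ((p : ℤ), (q : ℤ)) l) + potential p q y := by
  refine eq_of_row_eq (F := fun x => potential p q (x + emul ((p : ℤ), (q : ℤ)) l) +
    potential p q x) (fun x => ?_) h
  rw [add_right_comm, potential_add, potential_add, stepWeight_add hl]
  linear_combination zmod_two_add_self (1 + stepWeight p q x)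

theorem potential_neg_row {x y : ℤ × ℤ} (h : x.1 = y.1) :
    potential p q (-x) + potential p q x = potential p q (-y) + potential p q y := by
  refine eq_of_row_eq (F := fun x => potential p q (-x) + potential p q x) (fun x => ?_) h
  have := potential_add p q (-x - (0, 1))
  rw [sub_add_cancel, stepWeight_neg] at this
  rw [potential_add, this]
  have e : -(x + (0, 1)) = -x - (0, 1) := by abel
  rw [e]
  ring

/-- The symmetries of the labelled plane. -/
def IsSymmetry (p q : ℕ) (γ : ℤ × ℤ → ℤ × ℤ) : Prop :=
  ∃ l, cls l = 0 ∧ ((∀ x, γ x = x + emul ((p : ℤ), (q : ℤ)) l) ∨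
    ∀ x, γ x = -x + emul ((p : ℤ), (q : ℤ)) l)

theorem emul_add (z l m : ℤ × ℤ) : emul z (l + m) = emul z l + emul z m := by
  ext <;> simp [emul] <;> ring

theorem emul_neg (z l : ℤ × ℤ) : emul z (-l) = -emul z l := by
  ext <;> simp [emul] <;> ring

theorem IsSymmetry.comp {γ γ' : ℤ × ℤ → ℤ × ℤ} (h : IsSymmetry p q γ) (h' : IsSymmetry p q γ') :
    IsSymmetry p q (γ ∘ γ') := by
  obtain ⟨l, hl, h⟩ := h
  obtain ⟨l', hl', h'⟩ := h'
  rcases h with h | h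
  · refine ⟨l + l', by rw [cls_add, hl, hl', add_zero], ?_⟩
    rcases h' with h' | h'
    · exact Or.inl fun x => by simp only [Function.comp, h, h', emul_add]; abel
    · exact Or.inr fun x => by simp only [Function.comp, h, h', emul_add]; abel
  · refine ⟨l + -l', by rw [cls_add, cls_neg, hl, hl', neg_zero, add_zero], ?_⟩
    rcases h' with h' | h'
    · exact Or.inr fun x => by simp only [Function.comp, h, h', emul_add, emul_neg]; abel
    · exact Or.inl fun x => by simp only [Function.comp, h, h', emul_add, emul_neg]; abel

theorem IsSymmetry.exists_inverse {γ : ℤ × ℤ → ℤ × ℤ} (h : IsSymmetry p q γ) :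
    ∃ γ', IsSymmetry p q γ' ∧ ∀ x, γ' (γ x) = x := by
  obtain ⟨l, hl, h | h⟩ := h
  · exact ⟨fun x => x + emul ((p : ℤ), (q : ℤ)) (-l), ⟨-l, by rw [cls_neg, hl, neg_zero],
      Or.inl fun _ => rfl⟩, fun x => by simp only [h, emul_neg]; abel⟩
  · exact ⟨fun x => -x + emul ((p : ℤ), (q : ℤ)) l, ⟨l, hl, Or.inr fun _ => rfl⟩,
      fun x => by simp only [h]; abel⟩

theorem isSymmetry_id : IsSymmetry p q id :=
  ⟨0, by simp [cls], Or.inl fun x => by simp [emul]⟩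

theorem cls_fst_eq_zero {l : ℤ × ℤ} (hl : cls l = 0) : (cls l).1 = 0 := by rw [hl]; rfl

theorem IsSymmetry.row_eq {γ : ℤ × ℤ → ℤ × ℤ} (h : IsSymmetry p q γ) {x y : ℤ × ℤ}
    (hxy : x.1 = y.1) : (γ x).1 = (γ y).1 := by
  obtain ⟨l, hl, h | h⟩ := h <;> simp [h, hxy]

theorem IsSymmetry.potential_eq {γ : ℤ × ℤ → ℤ × ℤ} (h : IsSymmetry p q γ) {x y : ℤ × ℤ}
    (hxy : x.1 = y.1) : potential p q (γ x) + potential p q x =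
      potential p q (γ y) + potential p q y := by
  obtain ⟨l, hl, h | h⟩ := h
  · rw [h, h]
    exact potential_add_row (cls_fst_eq_zero hl) hxy
  · rw [h, h]
    have h1 := potential_add_row (p := p) (q := q) (cls_fst_eq_zero hl) (x := -x) (y := -y)
      (by simp [hxy])
    have h2 := potential_neg_row (p := p) (q := q) hxy
    linear_combination h1 + h2 - zmod_two_add_self (potential p q (-x)) +
      zmod_two_add_self (potential p q (-y))

/-- A symmetry which preserves a row does not change the potential there. -/
theorem IsSymmetry.potential_eq_self {γ : ℤ × ℤ → ℤ × ℤ} (h : IsSymmetry p q γ) {x : ℤ × ℤ}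
    (hx : (γ x).1 = x.1) : potential p q (γ x) = potential p q x := by
  obtain ⟨l, hl, h⟩ := h
  -- The vector l is twice an element k of the ideal, and translation by w = z k preserves the step
  -- weights. A translation is thus made of two equal halves, whose contributions cancel modulo two.
  -- A reflection has centre w, and the two half rows at w match.
  obtain ⟨k, hk⟩ : ∃ k : ℤ × ℤ, l = k + k := by
    simp only [cls, Prod.ext_iff, Prod.fst_zero, Prod.snd_zero, 
      ZMod.intCast_zmod_eq_zero_iff_dvd] at hl
    obtain ⟨-, ⟨i, hi⟩, j, hj⟩ := hl
    exact ⟨(i, j), by ext <;> simp <;> push_cast at hi hj <;> omega⟩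
  have hk0 : (cls k).1 = 0 := by
    have h1 := cls_fst_eq_zero hl
    rw [hk, cls_add, Prod.fst_add] at h1
    have : ∀ a : ZMod 7, a + a = 0 → a = 0 := by decide
    exact this _ h1
  rw [hk, emul_add] at h
  set w := emul ((p : ℤ), (q : ℤ)) k with hw
  rcases h with h | h
  · have hw1 : w.1 = 0 := by
      have := hx
      rw [h] at this
      simp only [Prod.fst_add] at this
      omega
    have h1 := potential_add_row (p := p) (q := q) hk0 (x := x + w) (y := x) (by simp [hw1])
    rw [← hw] at h1
    rw [h, ← add_assoc]
    linear_combination h1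
  · have hw1 : w.1 = x.1 := by
      have := hx
      rw [h] at this
      simp only [Prod.fst_add, Prod.fst_neg] at this
      omega
    have h1 := potential_add_row (p := p) (q := q) hk0 (x := -x + w) (y := x - w)
      (by simp [hw1])
    have h2 := potential_neg_row (p := p) (q := q) (x := x - w) (y := 0) (by simp [hw1])
    rw [← hw, sub_add_cancel] at h1
    have e : -(x - w) = -x + w := by abel
    rw [e, neg_zero] at h2
    rw [h, ← add_assoc]
    linear_combination h1 + h2 + zmod_two_add_self (potential p q 0) -
      zmod_two_add_self (potential p q (-x + w))

/-- Points of the plane which are mapped to the same point, up to even motions in rows. -/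
def RowEquiv (p q : ℕ) (x x' : ℤ × ℤ) : Prop :=
  ∃ γ, IsSymmetry p q γ ∧ (γ x).1 = x'.1 ∧ potential p q (γ x) = potential p q x'

theorem rowEquiv_equivalence : Equivalence (RowEquiv p q) := by
  refine ⟨fun x => ⟨id, isSymmetry_id, rfl, rfl⟩, ?_, ?_⟩
  · rintro x x' ⟨γ, hγ, h1, h2⟩
    obtain ⟨γ', hγ', h3⟩ := hγ.exists_inverse
    refine ⟨γ', hγ', ?_, ?_⟩
    · rw [← hγ'.row_eq h1, h3]
    · have := hγ'.potential_eq h1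
      rw [h3, h2] at this
      exact (add_right_cancel this).symm
  · rintro x x' x'' ⟨γ, hγ, h1, h2⟩ ⟨γ', hγ', h1', h2'⟩
    refine ⟨γ' ∘ γ, hγ'.comp hγ, (hγ'.row_eq h1).trans h1', ?_⟩
    have := hγ'.potential_eq h1
    rw [h2] at this
    exact (add_right_cancel this).trans h2'

end

/-! ### Corrected steps lie in the gaps -/

/-- The open hexagon around the origin. -/
def InHexagon (p q : ℕ) (w : ℤ × ℤ) : Prop :=
  |weightB p q w| < latNorm ((p : ℤ), (q : ℤ)) ∧ |weightC p q w| < latNorm ((p : ℤ), (q : ℤ)) ∧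
    |weightB p q w + weightC p q w| < latNorm ((p : ℤ), (q : ℤ))

section
variable {p q : ℕ}

theorem weightB_neg (w : ℤ × ℤ) : weightB p q (-w) = -weightB p q w := by
  simp [weightB]; ring

theorem weightC_neg (w : ℤ × ℤ) : weightC p q (-w) = -weightC p q w := by
  simp [weightC]; ring

theorem InHexagon.of_neg {w : ℤ × ℤ} (h : InHexagon p q (-w)) : InHexagon p q w := by
  rw [InHexagon, weightB_neg, weightC_neg, ← neg_add, abs_neg, abs_neg, abs_neg] at h
  exact h

/-- Gaps extend beyond the hexagon into the outer triangle, but the corrected steps touch the open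
hexagon and can therefore be assigned to their centre. The first two kinds start in it, the third
kind ends in it. -/
theorem Designated.inHexagon (hp : 0 < p) {w : ℤ × ℤ} (h : Designated p q w) :
    InHexagon p q w ∨ InHexagon p q (w + (0, 1)) := by
  obtain ⟨m, n⟩ := w
  have hP : (0 : ℤ) < p := by exact_mod_cast hp
  have hQ : (0 : ℤ) ≤ q := by positivity
  simp only [Designated] at h
  obtain ⟨hm, ⟨rfl, h, -⟩ | ⟨rfl, h, -⟩ | ⟨rfl, h, -⟩⟩ := h
  · left
    have h1 : 0 < (p : ℤ) * (m + q) := mul_pos hP (by omega)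
    have h2 : (p : ℤ) * m < 0 := mul_neg_of_pos_of_neg hP hm
    have h3 : 0 ≤ (q : ℤ) * (m + q) := mul_nonneg hQ (by omega)
    have h4 : (q : ℤ) * m ≤ 0 := mul_nonpos_of_nonneg_of_nonpos hQ hm.le
    have h5 : 0 < (p : ℤ) * p := mul_pos hP hP
    have h6 : 0 ≤ (q : ℤ) * q := mul_nonneg hQ hQ
    have h7 : 0 ≤ (p : ℤ) * q := mul_nonneg hP.le hQ
    simp only [InHexagon, weightB, weightC, latNorm, abs_lt]
    refine ⟨⟨?_, ?_⟩, ⟨?_, ?_⟩, ?_, ?_⟩ <;> nlinarith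
  · left
    have h1 : 0 < (p : ℤ) * (m + p + q) := mul_pos hP (by omega)
    have h2 : (p : ℤ) * m < 0 := mul_neg_of_pos_of_neg hP hm
    have h3 : 0 ≤ (q : ℤ) * (m + p + q) := mul_nonneg hQ (by omega)
    have h4 : (q : ℤ) * m ≤ 0 := mul_nonpos_of_nonneg_of_nonpos hQ hm.le
    have h5 : 0 < (p : ℤ) * p := mul_pos hP hP
    have h6 : 0 ≤ (q : ℤ) * q := mul_nonneg hQ hQ
    have h7 : 0 ≤ (p : ℤ) * q := mul_nonneg hP.le hQ
    simp only [InHexagon, weightB, weightC, latNorm, abs_lt]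
    refine ⟨⟨?_, ?_⟩, ⟨?_, ?_⟩, ?_, ?_⟩ <;> nlinarith
  · right
    have h1 : 0 < (p : ℤ) * (m + p) := mul_pos hP (by omega)
    have h2 : (p : ℤ) * m < 0 := mul_neg_of_pos_of_neg hP hm
    have h3 : 0 ≤ (q : ℤ) * (m + p) := mul_nonneg hQ (by omega)
    have h4 : (q : ℤ) * m ≤ 0 := mul_nonpos_of_nonneg_of_nonpos hQ hm.le
    have h5 : 0 < (p : ℤ) * p := mul_pos hP hP
    have h6 : 0 ≤ (q : ℤ) * q := mul_nonneg hQ hQ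
    have h7 : 0 ≤ (p : ℤ) * q := mul_nonneg hP.le hQ
    simp only [InHexagon, weightB, weightC, latNorm, abs_lt, Prod.mk_add_mk]
    refine ⟨⟨?_, ?_⟩, ⟨?_, ?_⟩, ?_, ?_⟩ <;> nlinarith

theorem DesignatedAt.inHexagon (hp : 0 < p) {A x : ℤ × ℤ} (h : DesignatedAt p q A x) :
    InHexagon p q (x - emul ((p : ℤ), (q : ℤ)) A) ∨
      InHexagon p q (x + (0, 1) - emul ((p : ℤ), (q : ℤ)) A) := by
  have e : x - emul ((p : ℤ), (q : ℤ)) A + (0, 1) =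
      x + (0, 1) - emul ((p : ℤ), (q : ℤ)) A := by abel
  have e' : -(x - emul ((p : ℤ), (q : ℤ)) A) - (0, 1) =
      -(x + (0, 1) - emul ((p : ℤ), (q : ℤ)) A) := by abel
  rcases h with h | h
  · rcases h.inHexagon hp with h | h
    · exact Or.inl h
    · exact Or.inr (e ▸ h)
  · rcases h.inHexagon hp with h | h
    · exact Or.inr (e' ▸ h).of_neg
    · rw [sub_add_cancel] at h
      exact Or.inl h.of_neg

theorem weightB_sub_center (p q : ℕ) (x e A : ℤ × ℤ) :
    weightB p q (emul ((p : ℤ), (q : ℤ)) e + x - emul ((p : ℤ), (q : ℤ)) A) =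
      latNorm ((p : ℤ), (q : ℤ)) * (e.1 - A.1) + weightB p q x := by
  simp [weightB, emul, latNorm]; ring

theorem weightC_sub_center (p q : ℕ) (x e A : ℤ × ℤ) :
    weightC p q (emul ((p : ℤ), (q : ℤ)) e + x - emul ((p : ℤ), (q : ℤ)) A) =
      latNorm ((p : ℤ), (q : ℤ)) * (e.2 - A.2) + weightC p q x := by
  simp [weightC, emul, latNorm]; ring

/-- A triangle meets the open hexagon around the origin only if the origin is a corner; the three
alternatives say which one. -/
theorem hexagon_triangle {N a b c i j : ℤ} (hN : 0 < N) (ha : 0 ≤ a) (hb : 0 ≤ b) (hc : 0 ≤ c)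
    (hs : a + b + c = N) (h1 : |N * i + b| < N) (h2 : |N * j + c| < N)
    (h3 : |N * (i + j) + (b + c)| < N) :
    (i = 0 ∧ j = 0) ∨ (i = -1 ∧ j = 0) ∨ (i = 0 ∧ j = -1) := by
  rw [abs_lt] at h1 h2 h3
  have k1 : i < 1 := by by_contra! h; nlinarith
  have k2 : -2 < i := by by_contra! h; nlinarith
  have k3 : j < 1 := by by_contra! h; nlinarith
  have k4 : -2 < j := by by_contra! h; nlinarith
  have k5 : -2 < i + j := by by_contra! h; nlinarith
  omega

/-- A labelled triangle does not meet the open hexagons around the centers. -/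
theorem TriangleLift.not_inHexagon (hp : 0 < p) {e u y x A : ℤ × ℤ} {f : FullereneFace p q}
    (h : TriangleLift p q e u y f x) (hA : (cls A).1 = 0) :
    ¬ InHexagon p q (x - emul ((p : ℤ), (q : ℤ)) A) := by
  intro hx
  have hN := latNorm_pos q hp
  obtain ⟨y1, y2, y3⟩ := h.inCell
  have hs := weight_sum p q y
  obtain ⟨l1, l2, l3⟩ := h.labelled
  have hne : ∀ e : ℤ × ℤ, (cls e).1 ≠ 0 → A ≠ e := by rintro e he rfl; exact he hA
  rw [← cls_add] at l2 l3
  have n1 := hne _ l1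
  have n2 := hne _ l2
  have n3 := hne _ l3
  have hu := h.mem
  rw [InHexagon, h.eq, weightB_sub_center, weightC_sub_center] at hx
  obtain ⟨x1, x2, x3⟩ := hx
  simp only [ne_eq, Prod.ext_iff, Prod.fst_add, Prod.snd_add, not_and, rot] at n1 n2 n3
  set N := latNorm ((p : ℤ), (q : ℤ)) with hNdef
  simp only [units, List.mem_cons, List.not_mem_nil, or_false] at hu
  have hB : ∀ u : ℤ × ℤ, weightB p q (emul u y) =
      u.1 * weightB p q y - u.2 * weightC p q y := by
    intro u; simp [weightB, weightC, emul]; ring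
  have hC : ∀ u : ℤ × ℤ, weightC p q (emul u y) =
      u.1 * weightC p q y + u.2 * weightB p q y + u.2 * weightC p q y := by
    intro u; simp [weightB, weightC, emul]; ring
  rw [hB] at x1 x3
  rw [hC] at x2 x3
  have key := fun i j => hexagon_triangle (N := N) (i := i) (j := j) hN y1 y2 y3 hs
  rcases hu with rfl | rfl | rfl | rfl | rfl | rfl <;> simp only at x1 x2 x3 n2 n3
  · have := key (e.1 - A.1) (e.2 - A.2) (by convert x1 using 2; ring) (by convert x2 using 2; ring)
      (by convert x3 using 2; ring)
    omega
  · have := key (e.1 - A.1 + (e.2 - A.2)) (-(e.1 - A.1)) (by convert x3 using 2; ring)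
      (by rw [← abs_neg]; convert x1 using 2; ring) (by convert x2 using 2; ring)
    omega
  · have := key (e.2 - A.2) (-(e.1 - A.1) - (e.2 - A.2)) (by convert x2 using 2; ring)
      (by rw [← abs_neg]; convert x3 using 2; ring) (by rw [← abs_neg]; convert x1 using 2; ring)
    omega
  · have := key (-(e.1 - A.1)) (-(e.2 - A.2)) (by rw [← abs_neg]; convert x1 using 2; ring)
      (by rw [← abs_neg]; convert x2 using 2; ring) (by rw [← abs_neg]; convert x3 using 2; ring)
    omega
  · have := key (-(e.1 - A.1) - (e.2 - A.2)) (e.1 - A.1)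
      (by rw [← abs_neg]; convert x3 using 2; ring) (by convert x1 using 2; ring)
      (by rw [← abs_neg]; convert x2 using 2; ring)
    omega
  · have := key (-(e.2 - A.2)) (e.1 - A.1 + (e.2 - A.2))
      (by rw [← abs_neg]; convert x2 using 2; ring) (by convert x3 using 2; ring)
      (by convert x1 using 2; ring)
    omega

theorem units_cls : ∀ d ∈ units, (cls d).1 ≠ 0 := by decide

/-- Norms of nonzero elements of the ideal are divisible by seven, while the listed differences have
norm at most three. -/
theorem center_unique {A A' : ℤ × ℤ} (hA : (cls A).1 = 0) (hA' : (cls A').1 = 0)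
    (h : A - A' = 0 ∨ A - A' ∈ units ∨ A - A' = (1, 1) ∨ A - A' = (-1, -1)) : A' = A := by
  have h0 : (cls (A - A')).1 = 0 := by
    rw [sub_eq_add_neg, cls_add, cls_neg, Prod.fst_add, Prod.fst_neg, hA, hA']; simp
  rcases h with h | h | h | h
  · exact (sub_eq_zero.1 h).symm
  · exact absurd h0 (units_cls _ h)
  · rw [h] at h0; exact absurd h0 (by decide)
  · rw [h] at h0; exact absurd h0 (by decide)

theorem center_unique_of_hexagon (hp : 0 < p) {A A' w : ℤ × ℤ} (hA : (cls A).1 = 0)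
    (hA' : (cls A').1 = 0) (hB : |weightB p q w| ≤ latNorm ((p : ℤ), (q : ℤ)))
    (hC : |weightC p q w| ≤ latNorm ((p : ℤ), (q : ℤ)))
    (hBC : |weightB p q w + weightC p q w| ≤ latNorm ((p : ℤ), (q : ℤ)))
    (h : InHexagon p q (emul ((p : ℤ), (q : ℤ)) A + w - emul ((p : ℤ), (q : ℤ)) A')) :
    A' = A := by
  have hN := latNorm_pos q hp
  rw [InHexagon, weightB_sub_center, weightC_sub_center] at h
  obtain ⟨h1, h2, h3⟩ := h
  rw [abs_lt] at h1 h2 h3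
  rw [abs_le] at hB hC hBC
  apply center_unique hA hA'
  have k1 : A.1 - A'.1 < 2 := by by_contra! h; nlinarith
  have k2 : -2 < A.1 - A'.1 := by by_contra! h; nlinarith
  have k3 : A.2 - A'.2 < 2 := by by_contra! h; nlinarith
  have k4 : -2 < A.2 - A'.2 := by by_contra! h; nlinarith
  have k5 : A.1 - A'.1 + (A.2 - A'.2) < 2 := by by_contra! h; nlinarith
  have k6 : -2 < A.1 - A'.1 + (A.2 - A'.2) := by by_contra! h; nlinarith
  have : A - A' = (A.1 - A'.1, A.2 - A'.2) := rfl
  simp only [this, units, List.mem_cons, List.not_mem_nil, or_false, Prod.mk.injEq,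
    Prod.mk_eq_zero]
  omega

/-- The gaps next to part 2 extend past the hexagon, but stay in the rhombus of the two cells of the
cap or in its reflection. -/
theorem center_unique_of_rhombus (hp : 0 < p) {A A' w : ℤ × ℤ} (hA : (cls A).1 = 0)
    (hA' : (cls A').1 = 0)
    (hw : (0 ≤ weightB p q w ∧ weightB p q w ≤ latNorm ((p : ℤ), (q : ℤ)) ∧
      0 ≤ weightC p q w ∧ weightC p q w ≤ latNorm ((p : ℤ), (q : ℤ))) ∨
      (weightB p q w ≤ 0 ∧ -latNorm ((p : ℤ), (q : ℤ)) ≤ weightB p q w ∧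
      weightC p q w ≤ 0 ∧ -latNorm ((p : ℤ), (q : ℤ)) ≤ weightC p q w))
    (h : InHexagon p q (emul ((p : ℤ), (q : ℤ)) A + w - emul ((p : ℤ), (q : ℤ)) A')) :
    A' = A := by
  have hN := latNorm_pos q hp
  rw [InHexagon, weightB_sub_center, weightC_sub_center] at h
  obtain ⟨h1, h2, h3⟩ := h
  rw [abs_lt] at h1 h2 h3
  apply center_unique hA hA'
  have : A - A' = (A.1 - A'.1, A.2 - A'.2) := rfl
  simp only [this, units, List.mem_cons, List.not_mem_nil, or_false, Prod.mk.injEq,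
    Prod.mk_eq_zero]
  rcases hw with ⟨b1, b2, c1, c2⟩ | ⟨b1, b2, c1, c2⟩
  · have k1 : A.1 - A'.1 < 1 := by by_contra! h; nlinarith
    have k2 : -2 < A.1 - A'.1 := by by_contra! h; nlinarith
    have k3 : A.2 - A'.2 < 1 := by by_contra! h; nlinarith
    have k4 : -2 < A.2 - A'.2 := by by_contra! h; nlinarith
    omega
  · have k1 : A.1 - A'.1 < 2 := by by_contra! h; nlinarith
    have k2 : -1 < A.1 - A'.1 := by by_contra! h; nlinarith
    have k3 : A.2 - A'.2 < 2 := by by_contra! h; nlinarith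
    have k4 : -1 < A.2 - A'.2 := by by_contra! h; nlinarith
    omega

theorem InCap.develop_bounds {i : Fin 3} (hi : i ≠ 2) {y : ℤ × ℤ}
    (h : InCap p q y) :
    |weightB p q (develop p q i y)| ≤ latNorm ((p : ℤ), (q : ℤ)) ∧
    |weightC p q (develop p q i y)| ≤ latNorm ((p : ℤ), (q : ℤ)) ∧
    |weightB p q (develop p q i y) + weightC p q (develop p q i y)| ≤
      latNorm ((p : ℤ), (q : ℤ)) := by
  obtain ⟨b1, b2, c1, c2⟩ := h.weight_bounds
  have e1 : weightB p q (develop p q 0 y) =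
      weightB p q y + weightC p q y - latNorm ((p : ℤ), (q : ℤ)) := by
    simp only [develop, weightB, weightC, latNorm]; ring
  have e2 : weightC p q (develop p q 0 y) =
      latNorm ((p : ℤ), (q : ℤ)) - weightB p q y := by
    simp only [develop, weightB, weightC, latNorm]; ring
  have e3 : weightB p q (develop p q 1 y) =
      weightC p q y - latNorm ((p : ℤ), (q : ℤ)) := by
    simp only [develop, weightB, weightC, latNorm]; ring
  have e4 : weightC p q (develop p q 1 y) =
      latNorm ((p : ℤ), (q : ℤ)) - weightB p q y - weightC p q y := by
    simp only [develop, weightB, weightC, latNorm]; ring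
  simp only [abs_le]
  fin_cases i
  · simp only [Fin.zero_eta, e1, e2]; omega
  · simp only [Fin.mk_one, e3, e4]; omega
  · exact absurd rfl hi

/-- A designated step crosses the border between a part and a gap, so its ends are not both in one
part. The reflected designated steps lie in rows with positive number, which parts 0 and 1 do not
meet. -/
theorem not_designated_develop {i : Fin 3} (hi : i ≠ 2) {y y' : ℤ × ℤ}
    (hy : Piece p q i y) (hy' : Piece p q i y')
    (h : develop p q i y' = develop p q i y + (0, 1)) :
    ¬ Designated p q (develop p q i y) ∧ ¬ Designated p q (-develop p q i y - (0, 1)) := by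
  fin_cases i
  · simp only [Fin.zero_eta, Piece, develop, Designated, Prod.ext_iff, Prod.fst_add, Prod.snd_add,
      Prod.fst_neg, Prod.snd_neg, Prod.fst_sub, Prod.snd_sub] at *
    omega
  · simp only [Fin.mk_one, Piece, develop, Designated, Prod.ext_iff, Prod.fst_add, Prod.snd_add,
      Prod.fst_neg, Prod.snd_neg, Prod.fst_sub, Prod.snd_sub] at *
    omega
  · exact absurd rfl hi

theorem CapSpot.eq_center (hp : 0 < p) {A A' y : ℤ × ℤ} {i : Fin 3} {f : FullereneFace p q}
    (hA : (cls A).1 = 0) (hA' : (cls A').1 = 0) (hy : Piece p q i y) (h : CapSpot p q A i y f)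
    (hx : InHexagon p q (emul ((p : ℤ), (q : ℤ)) A + develop p q i y -
      emul ((p : ℤ), (q : ℤ)) A')) : i ≠ 2 ∧ A' = A := by
  rcases h with h | ⟨⟨e, u, w, h⟩, -⟩
  · by_cases hi : i = 2
    · subst hi
      obtain ⟨k1, k2⟩ := h.of_nonpos hA (h.inCap.weightA_nonpos hp hy)
      exact absurd hx ((triangleLift_of_capFlip hA k1 k2).not_inHexagon hp hA')
    · obtain ⟨k1, k2, k3⟩ := h.inCap.develop_bounds hi
      exact ⟨hi, center_unique_of_hexagon hp hA hA' k1 k2 k3 hx⟩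
  · exact absurd hx (h.not_inHexagon hp hA')

/-- A designated step touches the hexagon of its centre. There, faces are found only in parts 0 and
1 of that same cap, and a step inside one part is not designated. -/
theorem HalfStep.stepWeight_eq_zero (hp : 0 < p) {f g : FullereneFace p q} {x : ℤ × ℤ}
    (h : HalfStep p q f g x (x + (0, 1))) : stepWeight p q x = 0 := by
  rw [stepWeight, if_neg]
  rintro ⟨A', hA', hd⟩
  rcases h with ⟨⟨⟨e, u, w, h⟩, -⟩, ⟨e', u', w', h'⟩, -⟩ |
    ⟨A, i, y, y', hA, hy, hy', h, h', e, e'⟩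
  · rcases hd.inHexagon hp with hd | hd
    · exact h.not_inHexagon hp hA' hd
    · exact h'.not_inHexagon hp hA' hd
  · obtain ⟨hi, rfl⟩ : i ≠ 2 ∧ A' = A := by
      rcases hd.inHexagon hp with hd | hd
      · rw [e] at hd; exact h.eq_center hp hA hA' hy hd
      · rw [e'] at hd; exact h'.eq_center hp hA hA' hy' hd
    have hdev : develop p q i y' = develop p q i y + (0, 1) := by
      rw [e, add_assoc] at e'
      exact (add_left_cancel e').symm
    obtain ⟨k1, k2⟩ := not_designated_develop hi hy hy' hdev
    rw [DesignatedAt, e, add_sub_cancel_left] at hd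
    tauto

end

/-! ### Crossing the gaps -/

section
variable {p q : ℕ}

theorem potential_add_nat (x : ℤ × ℤ) (k : ℕ) : potential p q (x + (0, (k : ℤ))) =
    potential p q x + k + ∑ i ∈ Finset.range k, stepWeight p q (x + (0, (i : ℤ))) := by
  induction k with
  | zero => simp [show x + (0, 0) = x from by ext <;> simp]
  | succ k ih =>
    have e : x + (0, ((k + 1 : ℕ) : ℤ)) = x + (0, (k : ℤ)) + (0, 1) := by
      ext <;> simp [add_assoc]
    rw [e, potential_add, ih, Finset.sum_range_succ]
    push_cast
    ring

/-- Next to the point `w` there is no center other than the origin. -/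
def NearOrigin (p q : ℕ) (w : ℤ × ℤ) : Prop :=
  ∀ A A' : ℤ × ℤ, (cls A).1 = 0 → (cls A').1 = 0 →
    InHexagon p q (emul ((p : ℤ), (q : ℤ)) A + w - emul ((p : ℤ), (q : ℤ)) A') → A' = A

theorem stepWeight_near (hp : 0 < p) {A w : ℤ × ℤ} (hA : (cls A).1 = 0) (h : NearOrigin p q w)
    (h' : NearOrigin p q (w + (0, 1))) (P : Prop) [Decidable P]
    (hP : (Designated p q w ∨ Designated p q (-w - (0, 1))) ↔ P) :
    stepWeight p q (emul ((p : ℤ), (q : ℤ)) A + w) = if P then 1 else 0 := by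
  have : (∃ A', (cls A').1 = 0 ∧ DesignatedAt p q A' (emul ((p : ℤ), (q : ℤ)) A + w)) ↔ P := by
    rw [← hP]
    constructor
    · rintro ⟨A', hA', hd⟩
      obtain rfl : A' = A := by
        rcases hd.inHexagon hp with hx | hx
        · exact h A A' hA hA' hx
        · exact h' A A' hA hA' (by rwa [← add_assoc])
      rwa [DesignatedAt, add_sub_cancel_left] at hd
    · intro hd
      exact ⟨A, hA, by rwa [DesignatedAt, add_sub_cancel_left]⟩
  classical exact if_congr this rfl rfl

/-- A gap row of width k has k steps and, exactly if k is odd, one correction: in total zero modulo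
two. -/
theorem potential_across_gap (hp : 0 < p) {A w : ℤ × ℤ} (hA : (cls A).1 = 0) (k j : ℕ)
    (hj : k % 2 = 1 → j < k) (hn : ∀ i : ℤ, 0 ≤ i → i ≤ k → NearOrigin p q (w + (0, i)))
    (hd : ∀ i : ℤ, 0 ≤ i → i < k → ((Designated p q (w + (0, i)) ∨
      Designated p q (-(w + (0, i)) - (0, 1))) ↔ k % 2 = 1 ∧ i = j)) :
    potential p q (emul ((p : ℤ), (q : ℤ)) A + (w + (0, (k : ℤ)))) =
      potential p q (emul ((p : ℤ), (q : ℤ)) A + w) := by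
  rw [← add_assoc, potential_add_nat]
  have hs : ∀ i ∈ Finset.range k, stepWeight p q (emul ((p : ℤ), (q : ℤ)) A + w + (0, (i : ℤ))) =
      if i = j then (if k % 2 = 1 then 1 else 0) else 0 := by
    intro i hi
    rw [Finset.mem_range] at hi
    rw [add_assoc, stepWeight_near hp hA (hn i (by omega) (by omega))
      (by rw [add_assoc]; exact hn (i + 1) (by omega) (by omega)) (k % 2 = 1 ∧ i = j)
      (by rw [hd i (by omega) (by omega)]; norm_cast)]
    split_ifs <;> first | rfl | omega
  rw [Finset.sum_congr rfl hs, Finset.sum_ite_eq' (Finset.range k) j]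
  simp only [Finset.mem_range]
  rcases Nat.mod_two_eq_zero_or_one k with h | h
  · have : (k : ZMod 2) = 0 := by
      rw [ZMod.natCast_eq_zero_iff]; omega
    simp [this, h]
  · have : (k : ZMod 2) = 1 := by
      rw [← Nat.mod_add_div k 2, h]; push_cast; rw [show (2 : ZMod 2) = 0 from rfl]; ring
    rw [if_pos (hj h), if_pos h, this, add_assoc, zmod_two_add_self, add_zero]

/-- This is the gap of the cut from a, of width n at its n-th face. The common end of the cuts is
excluded: there the gap lies in row 0 relative to the centre, which has no corrected steps, so an
odd width p + q would not be compensated. -/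
theorem rowEquiv_gap_zero_one (hp : 0 < p) {A y : ℤ × ℤ} (hA : (cls A).1 = 0)
    (hy : InCap p q y) (h0 : Piece p q 0 y) (h1 : Piece p q 1 y) (hS : y ≠ (0, (p : ℤ) + q)) :
    RowEquiv p q (emul ((p : ℤ), (q : ℤ)) A + develop p q 0 y)
      (emul ((p : ℤ), (q : ℤ)) A + develop p q 1 y) := by
  obtain ⟨m, n⟩ := y
  have hb := hy.bounds hp
  simp only [Piece] at h0 h1 hb
  obtain rfl : m = 0 := le_antisymm h0.1 h1.1
  have hn : n ≠ p + q := fun h => hS (by rw [h])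
  refine ⟨id, isSymmetry_id, by simp [develop], ?_⟩
  have hP : (0 : ℤ) < p := by exact_mod_cast hp
  have hQ : (0 : ℤ) ≤ q := by positivity
  lift n to ℕ using hb.2.2.1
  have key := potential_across_gap (p := p) (q := q) hp hA (w := develop p q 1 (0, (n : ℤ))) n 0
    (by omega) ?_ ?_
  · rw [id, ← key]
    congr 2
    ext <;> simp [develop]
  · intro i hi hin A₁ A₂ h₁ h₂
    have k1 : 0 ≤ (p : ℤ) * (n - i) := mul_nonneg hP.le (by omega)
    have k2 : 0 ≤ (q : ℤ) * (n - i) := mul_nonneg hQ (by omega)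
    have k3 : 0 ≤ (p : ℤ) * i := mul_nonneg hP.le hi
    have k4 : 0 ≤ (q : ℤ) * i := mul_nonneg hQ hi
    have k5 : 0 ≤ (p : ℤ) * (p + q - n) := mul_nonneg hP.le (by omega)
    have k6 : 0 ≤ (q : ℤ) * (p + q - n) := mul_nonneg hQ (by omega)
    have k7 : 0 ≤ (p : ℤ) * q := mul_nonneg hP.le hQ
    have k8 : 0 ≤ (p : ℤ) * p := mul_nonneg hP.le hP.le
    have k9 : 0 ≤ (q : ℤ) * q := mul_nonneg hQ hQ
    have k10 := sq_nonneg ((p : ℤ) - q)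
    apply center_unique_of_hexagon hp h₁ h₂ <;>
    · simp only [develop, weightB, weightC, latNorm, Prod.mk_add_mk, abs_le]
      constructor <;> nlinarith
  · intro i hi hin
    simp only [develop, Designated, Prod.mk_add_mk, Prod.neg_mk, Prod.mk_sub_mk]
    omega

theorem rowEquiv_gap_zero_two (hp : 0 < p) {A y : ℤ × ℤ} (hA : (cls A).1 = 0)
    (hy : InCap p q y) (h0 : Piece p q 0 y) (h2 : Piece p q 2 y) (hS : y ≠ (0, (p : ℤ) + q)) :
    RowEquiv p q (emul ((p : ℤ), (q : ℤ)) A + develop p q 0 y)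
      (emul ((p : ℤ), (q : ℤ)) A + develop p q 2 y) := by
  obtain ⟨m, n⟩ := y
  have hb := hy.bounds hp
  simp only [Piece] at h0 h2 hb
  have hP : (0 : ℤ) < p := by exact_mod_cast hp
  have hQ : (0 : ℤ) ≤ q := by positivity
  obtain rfl : n = p + q := by omega
  have hm : m ≠ 0 := fun h => hS (by rw [h])
  refine ⟨id, isSymmetry_id, by simp [develop]; ring, ?_⟩
  obtain ⟨k, hk⟩ : ∃ k : ℕ, (k : ℤ) = q + m := ⟨(q + m).toNat, by omega⟩
  have key := potential_across_gap (p := p) (q := q) hp hA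
    (w := develop p q 0 (m, (p : ℤ) + q)) k 0 (by omega) ?_ ?_
  · rw [id, ← key, hk]
    congr 2
    ext <;> simp [develop]; ring
  · intro i hi hin A₁ A₂ h₁ h₂
    have k1 : 0 ≤ (p : ℤ) * (q + m - i) := mul_nonneg hP.le (by omega)
    have k2 : 0 ≤ (q : ℤ) * (q + m - i) := mul_nonneg hQ (by omega)
    have k3 : 0 ≤ (p : ℤ) * i := mul_nonneg hP.le hi
    have k4 : 0 ≤ (q : ℤ) * i := mul_nonneg hQ hi
    have k5 : 0 ≤ (p : ℤ) * (-m) := mul_nonneg hP.le (by omega)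
    have k6 : 0 ≤ (q : ℤ) * (-m) := mul_nonneg hQ (by omega)
    have k7 : 0 ≤ (p : ℤ) * q := mul_nonneg hP.le hQ
    have k8 : 0 ≤ (p : ℤ) * p := mul_nonneg hP.le hP.le
    have k9 : 0 ≤ (q : ℤ) * q := mul_nonneg hQ hQ
    apply center_unique_of_rhombus hp h₁ h₂
    left
    simp only [develop, weightB, weightC, latNorm, Prod.mk_add_mk]
    refine ⟨?_, ?_, ?_, ?_⟩ <;> nlinarith
  · intro i hi hin
    simp only [develop, Designated, Prod.mk_add_mk, Prod.neg_mk, Prod.mk_sub_mk]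
    omega

theorem rowEquiv_gap_one_two (hp : 0 < p) {A y : ℤ × ℤ} (hA : (cls A).1 = 0)
    (hy : InCap p q y) (h1 : Piece p q 1 y) (h2 : Piece p q 2 y) (hS : y ≠ (0, (p : ℤ) + q)) :
    RowEquiv p q (emul ((p : ℤ), (q : ℤ)) A + develop p q 2 y)
      (emul ((p : ℤ), (q : ℤ)) A + develop p q 1 y) := by
  obtain ⟨m, n⟩ := y
  have hb := hy.bounds hp
  simp only [Piece] at h1 h2 hb
  have hP : (0 : ℤ) < p := by exact_mod_cast hp
  have hQ : (0 : ℤ) ≤ q := by positivity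
  have hm : 0 < m := by
    rcases h1.1.lt_or_eq with h | h
    · exact h
    · exact absurd (show ((m, n) : ℤ × ℤ) = (0, (p : ℤ) + q) by ext <;> simp <;> omega) hS
  obtain rfl : n = p + q - m := by omega
  have e : ∀ x : ℤ × ℤ, -(emul ((p : ℤ), (q : ℤ)) A + x) + emul ((p : ℤ), (q : ℤ)) (A + A) =
      emul ((p : ℤ), (q : ℤ)) A + -x := by
    intro x; rw [emul_add]; abel
  have hAA : cls (A + A) = 0 := by
    rw [cls_add]
    have : ∀ a : ZMod 2, a + a = 0 := by decide
    ext <;> simp [hA, this]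
  -- The two developments of the cut from b fit together after the point reflection in the centre A,
  -- whose translation vector is z (A + A).
  refine ⟨fun x => -x + emul ((p : ℤ), (q : ℤ)) (A + A), ⟨A + A, hAA, Or.inr fun _ => rfl⟩, ?_, ?_⟩
  · beta_reduce; rw [e]; simp [develop]; ring
  beta_reduce
  rw [e]
  obtain ⟨k, hk⟩ : ∃ k : ℕ, (k : ℤ) = p - m := ⟨(p - m).toNat, by omega⟩
  -- In this gap the last step, with index k - 1, is the designated one.
  have key := potential_across_gap (p := p) (q := q) hp hA
    (w := -develop p q 2 (m, (p : ℤ) + q - m)) k (k - 1) (by omega) ?_ ?_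
  · rw [← key, hk]
    congr 2
    ext <;> simp [develop]; ring
  · intro i hi hin A₁ A₂ h₁ h₂
    have k1 : 0 ≤ (p : ℤ) * (p - m - i) := mul_nonneg hP.le (by omega)
    have k2 : 0 ≤ (q : ℤ) * (p - m - i) := mul_nonneg hQ (by omega)
    have k3 : 0 ≤ (p : ℤ) * i := mul_nonneg hP.le hi
    have k4 : 0 ≤ (q : ℤ) * i := mul_nonneg hQ hi
    have k5 : 0 ≤ (p : ℤ) * m := mul_nonneg hP.le (by omega)
    have k6 : 0 ≤ (q : ℤ) * m := mul_nonneg hQ (by omega)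
    have k7 : 0 ≤ (p : ℤ) * q := mul_nonneg hP.le hQ
    have k8 : 0 ≤ (p : ℤ) * p := mul_nonneg hP.le hP.le
    have k9 : 0 ≤ (q : ℤ) * q := mul_nonneg hQ hQ
    apply center_unique_of_rhombus hp h₁ h₂
    right
    simp only [develop, weightB, weightC, latNorm, Prod.mk_add_mk, Prod.neg_mk]
    refine ⟨?_, ?_, ?_, ?_⟩ <;> nlinarith
  · intro i hi hin
    simp only [develop, Designated, Prod.mk_add_mk, Prod.neg_mk, Prod.mk_sub_mk]
    omega

/-- The positions of a face at which a given orbit can be resumed. -/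
theorem Lift.rowEquiv (hp : 0 < p) {f : FullereneFace p q} {x x' : ℤ × ℤ}
    (h : Lift p q (fun y => y ≠ (0, (p : ℤ) + q)) f x)
    (h' : Lift p q (fun y => y ≠ (0, (p : ℤ) + q)) f x') : RowEquiv p q x x' := by
  refine h.unique hp rowEquiv_equivalence ?_ ?_ ?_ h'
  · intro x
    refine ⟨fun x => -x, ⟨0, by simp [cls], Or.inr fun x => by simp [emul]⟩, rfl, rfl⟩
  · intro x l hl
    exact ⟨fun x => x + emul ((p : ℤ), (q : ℤ)) l, ⟨l, hl, Or.inl fun _ => rfl⟩, rfl, rfl⟩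
  · intro A i j y hA hy hi hj hSi hSj
    have hsymm := @(rowEquiv_equivalence (p := p) (q := q)).symm
    fin_cases i <;> fin_cases j <;>
      simp only [Fin.zero_eta, Fin.mk_one, Fin.reduceFinMk] at hi hj hSi hSj ⊢
    · exact rowEquiv_equivalence.refl _
    · exact rowEquiv_gap_zero_one hp hA hy hi hj (hSi (by decide))
    · exact rowEquiv_gap_zero_two hp hA hy hi hj (hSi (by decide))
    · exact hsymm (rowEquiv_gap_zero_one hp hA hy hj hi (hSi (by decide)))
    · exact rowEquiv_equivalence.refl _
    · exact hsymm (rowEquiv_gap_one_two hp hA hy hi hj (hSi (by decide)))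
    · exact hsymm (rowEquiv_gap_zero_two hp hA hy hj hi (hSj (by decide)))
    · exact rowEquiv_gap_one_two hp hA hy hj hi (hSj (by decide))
    · exact rowEquiv_equivalence.refl _

end

/-! ### Closed walks along weaving lines are even -/

theorem zmod_two_eq_zero : (2 : ZMod 2) = 0 := rfl

section
variable {p q : ℕ} {f g : FullereneFace p q} {x x' : ℤ × ℤ}

/-- The common end of the cuts is admitted only in part 2. This loses no row step: in parts 0 and 1
that face is the only point of the part in its row. -/
theorem HalfStep.lift (hr : x'.1 = x.1) (hne : x' ≠ x) (h : HalfStep p q f g x x') :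
    Lift p q (fun y => y ≠ (0, (p : ℤ) + q)) f x := by
  rcases h with ⟨h, -⟩ | ⟨A, i, y, y', hA, hy, hy', h | h, -, rfl, rfl⟩
  · exact h.2 _
  · refine CapLift.lift ⟨hA, hy, ?_, h, rfl⟩
    rintro hi rfl
    replace hr : (develop p q i y').1 = (develop p q i (0, (p : ℤ) + q)).1 := by simpa using hr
    have hne' : y' ≠ (0, (p : ℤ) + q) := by rintro rfl; exact hne rfl
    have hne'' : ¬ (y'.1 = 0 ∧ y'.2 = p + q) := fun h => hne' (Prod.ext h.1 h.2)
    fin_cases i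
    · simp only [develop, Piece] at hr hy'
      omega
    · simp only [develop, Piece] at hr hy'
      omega
    · exact hi rfl
  · exact h.2 _

theorem HalfStep.row_step (hp : 0 < p) (h : HalfStep p q f g x (x + (0, 1))) :
    Lift p q (fun y => y ≠ (0, (p : ℤ) + q)) f x ∧
      Lift p q (fun y => y ≠ (0, (p : ℤ) + q)) g (x + (0, 1)) ∧
      potential p q (x + (0, 1)) = potential p q x + 1 := by
  refine ⟨h.lift (by simp) (by simp), h.symm.lift (by simp) (by simp), ?_⟩
  rw [potential_add, h.stepWeight_eq_zero hp, add_zero]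

theorem Step.row_step (hp : 0 < p) (h : Step p q f g x (x + (0, 1))) :
    Lift p q (fun y => y ≠ (0, (p : ℤ) + q)) f x ∧
      Lift p q (fun y => y ≠ (0, (p : ℤ) + q)) g (x + (0, 1)) ∧
      potential p q (x + (0, 1)) = potential p q x + 1 := by
  rcases h with h | h
  · exact h.row_step hp
  · have e : -x = -(x + (0, 1)) + (0, 1) := by abel
    have h' := h.symm
    rw [e] at h'
    have hw := h'.stepWeight_eq_zero hp
    obtain ⟨h1, h2, -⟩ := h'.row_step hp
    refine ⟨?_, ?_, ?_⟩
    · have := h2.neg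
      rwa [← e, neg_neg] at this
    · have := h1.neg
      rwa [neg_neg] at this
    · have e' : -(x + (0, 1)) = -x - (0, 1) := by abel
      rw [e', stepWeight_neg] at hw
      rw [potential_add, hw, add_zero]

theorem exists_row_step (hp : 0 < p) (h : (fullereneFaceGraph p q).Adj f g) (he : eps f = eps g) :
    ∃ x x', x'.1 = x.1 ∧ Lift p q (fun y => y ≠ (0, (p : ℤ) + q)) f x ∧
      Lift p q (fun y => y ≠ (0, (p : ℤ) + q)) g x' ∧ potential p q x' = potential p q x + 1 := by
  obtain ⟨x, x', hd, hs⟩ := exists_step_of_adj hp h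
  obtain ⟨h1, h2⟩ := hs.eps_eq hp
  rw [h1, h2, rowParity, rowParity, ZMod.intCast_eq_intCast_iff'] at he
  have : x' = x + (x' - x) := by abel
  have key : ∀ d ∈ units, d.1 % 2 = 0 → d = (0, 1) ∨ d = (0, -1) := by decide
  rcases key _ hd (by simp only [Prod.fst_sub]; push_cast at he; omega) with hd' | hd' <;>
    rw [hd'] at this <;> subst this
  · obtain ⟨k1, k2, k3⟩ := hs.row_step hp
    exact ⟨_, _, by simp, k1, k2, k3⟩
  · have hs' := hs.symm
    obtain ⟨z, rfl⟩ : ∃ z, x = z + (0, 1) := ⟨x - (0, 1), by abel⟩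
    rw [show z + (0, 1) + (0, -1) = z by ext <;> simp] at hs'
    obtain ⟨k1, k2, k3⟩ := hs'.row_step hp
    refine ⟨_, _, by simp, k2, k1, ?_⟩
    rw [k3, add_assoc, zmod_two_add_self, add_zero]

end

/-- Two adjacent faces on a common weaving line. -/
def rowGraph (p q : ℕ) : SimpleGraph (FullereneFace p q) where
  Adj f g := (fullereneFaceGraph p q).Adj f g ∧ eps f = eps g
  symm := ⟨fun _ _ h => ⟨h.1.symm, h.2.symm⟩⟩
  loopless := ⟨fun _ h => h.1.ne rfl⟩

section
variable {p q : ℕ} {f g : FullereneFace p q}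

/-- Successive steps may show a face at different positions. `Lift.rowEquiv` joins them by
symmetries, which are composed along the walk and carried back to the row of the starting point. -/
theorem rowGraph_walk (hp : 0 < p) (w : (rowGraph p q).Walk f g) : ∀ {x₀ : ℤ × ℤ},
    Lift p q (fun y => y ≠ (0, (p : ℤ) + q)) f x₀ → ∃ x γ,
      Lift p q (fun y => y ≠ (0, (p : ℤ) + q)) g x ∧ IsSymmetry p q γ ∧ (γ x).1 = x₀.1 ∧
        potential p q (γ x) = potential p q x₀ + w.length := by
  induction w with
  | nil => exact fun h => ⟨_, id, h, isSymmetry_id, rfl, by simp⟩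
  | cons h w ih =>
    intro x₀ h₀
    obtain ⟨x, x', hr, hx, hx', hpot⟩ := exists_row_step hp h.1 h.2
    obtain ⟨γ₁, s₁, r₁, q₁⟩ := hx.rowEquiv hp h₀
    obtain ⟨x₂, γ₂, h₂, s₂, r₂, q₂⟩ := ih hx'
    have e₁ := s₁.potential_eq hr
    have e₂ := s₁.potential_eq r₂
    refine ⟨x₂, γ₁ ∘ γ₂, h₂, s₁.comp s₂, ?_, ?_⟩
    · rw [Function.comp, s₁.row_eq r₂, s₁.row_eq hr, r₁]
    · simp only [Function.comp, SimpleGraph.Walk.length_cons]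
      push_cast
      linear_combination e₁ + e₂ - q₂ - hpot + q₁ +
        zmod_two_add_self (potential p q x') - zmod_two_add_self (potential p q x) +
        (-1 + potential p q x - potential p q x' - w.length) * zmod_two_eq_zero

/-- A closed walk returns to the start up to a symmetry that preserves the row of the starting
point. That symmetry does not change the potential, while the walk changed it by its length. -/
theorem rowGraph_even (hp : 0 < p) (w : (rowGraph p q).Walk f f) : Even w.length := by
  obtain ⟨x₀, h₀⟩ := FullereneFace.exists_lift (S := fun y => y ≠ (0, (p : ℤ) + q))
    (fun y hy => by
      simp only [ne_eq, not_not] at hy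
      subst hy
      exact Or.inl le_rfl) f
  obtain ⟨x, γ, hx, s, r, e⟩ := rowGraph_walk hp w h₀
  obtain ⟨γ₃, s₃, r₃, e₃⟩ := h₀.rowEquiv hp hx
  have k := (s.comp s₃).potential_eq_self (x := x₀) (by rw [Function.comp, s.row_eq r₃, r])
  have k' := s.potential_eq r₃
  simp only [Function.comp] at k
  rw [even_iff_two_dvd, ← ZMod.natCast_eq_zero_iff]
  linear_combination k' - e₃ - k - e +
    (potential p q (γ x) - potential p q x₀) * zmod_two_eq_zero

theorem rowGraph_colorable (hp : 0 < p) : (rowGraph p q).Colorable 2 :=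
  SimpleGraph.two_colorable_iff_forall_loop_even.2 fun _ w => rowGraph_even hp w

end

/-! ### The neighbours of a face on its weaving line -/

/-- The change of the row along `d` in a part of a cap. -/
def rowDiff (i : Fin 3) (d : ℤ × ℤ) : ℤ :=
  match i with
  | 0 => d.1 + d.2
  | 1 => d.2
  | 2 => d.1

section
variable {p q : ℕ} {f g : FullereneFace p q} {A y : ℤ × ℤ}

theorem develop_add_fst (p q : ℕ) (i : Fin 3) (y d : ℤ × ℤ) :
    (develop p q i (y + d)).1 = (develop p q i y).1 + rowDiff i d := by
  fin_cases i <;> simp [develop, rowDiff] <;> ring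

theorem CapSpot.eps_eq_iff (hp : 0 < p) (hA : (cls A).1 = 0) {i : Fin 3} {d : ℤ × ℤ}
    (hi : Piece p q i y) (hi' : Piece p q i (y + d)) (hg : CapSpot p q A i (y + d) g)
    (hf : CapSpot p q A i y f) : eps g = eps f ↔ rowDiff i d % 2 = 0 := by
  rw [hg.eps_eq hp hA hi', hf.eps_eq hp hA hi, rowParity, rowParity,
    ZMod.intCast_eq_intCast_iff', Prod.fst_add, Prod.fst_add, develop_add_fst]
  push_cast
  omega

theorem CapFace.exists_rowChart (hp : 0 < p) (hA : (cls A).1 = 0)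
    (h : CapFace p q (cls A) y f) (hf : NonCorner f) :
    ∃ X, LocalChart (fullereneFaceGraph p q) f X ∧ ∀ d ∈ units,
      (∃ i, Piece p q i y ∧ Piece p q i (y + d) ∧ (eps (X d) = eps f ↔ rowDiff i d % 2 = 0)) ∧
        ∀ g, CapFace p q (cls A) (y + d) g → g = X d := by
  obtain ⟨X, hX, hX'⟩ := h.exists_localChart hp hA hf
  refine ⟨X, hX, fun d hd => ?_⟩
  obtain ⟨i, hi, hi', hs, hg⟩ := hX' d hd
  exact ⟨⟨i, hi, hi', hs.eps_eq_iff hp hA hi hi' (Or.inl h)⟩, hg⟩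

theorem TriangleLift.exists_rowChart {e u x : ℤ × ℤ} (hp : 0 < p)
    (h : TriangleLift p q e u y f x) (hF : FreeTriangle (cls e) u)
    (hcap : ∀ α y, α.1 = 0 → ¬ CapFace p q α y f) (hf : NonCorner f) :
    ∃ X, LocalChart (fullereneFaceGraph p q) f X ∧ ∃ d₀ ∈ units, ∀ d ∈ units,
      (eps (X d) = eps f ↔ d = d₀ ∨ d = -d₀) := by
  obtain ⟨X, hX, hX'⟩ := h.exists_localChart hp hF hcap hf
  have key : ∀ u ∈ units, ∃ d₀ ∈ units, ∀ d ∈ units,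
      ((emul u d).1 % 2 = 0 ↔ d = d₀ ∨ d = -d₀) := by decide
  obtain ⟨d₀, h₀, hd₀⟩ := key u h.mem
  refine ⟨X, hX, d₀, h₀, fun d hd => ?_⟩
  obtain ⟨h1, h2⟩ := (hX' d hd).eps_eq hp
  rw [← hd₀ d hd, h1, h2, rowParity, rowParity, ZMod.intCast_eq_intCast_iff', Prod.fst_add]
  push_cast
  omega

/-- The position `y` of a cap lies on none of its cuts. -/
def OffCut (p q : ℕ) (y : ℤ × ℤ) : Prop :=
  ¬ (y.1 = 0 ∧ y.2 ≤ p + q) ∧ ¬ (0 ≤ y.1 ∧ y.1 + y.2 = p + q) ∧ ¬ (y.1 ≤ 0 ∧ y.2 = p + q)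

theorem OffCut.exists_direction (h : OffCut p q y) : ∃ e ∈ units, ∀ d ∈ units, ∀ i,
    Piece p q i y → (rowDiff i d % 2 = 0 ↔ d = e ∨ d = -e) := by
  obtain ⟨m, n⟩ := y
  simp only [OffCut] at h
  have key : ∀ i : Fin 3, ∃ e ∈ units, ∀ d ∈ units, (rowDiff i d % 2 = 0 ↔ d = e ∨ d = -e) := by
    decide
  obtain ⟨j, hj⟩ : ∃ j : Fin 3, ∀ i, Piece p q i (m, n) → i = j := by
    by_cases h0 : Piece p q 0 (m, n)
    · refine ⟨0, fun i hi => ?_⟩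
      fin_cases i
      · rfl
      · simp only [Piece] at h0 hi; omega
      · simp only [Piece] at h0 hi; omega
    · by_cases h1 : Piece p q 1 (m, n)
      · refine ⟨1, fun i hi => ?_⟩
        fin_cases i
        · exact absurd hi h0
        · rfl
        · simp only [Piece] at h1 hi; omega
      · refine ⟨2, fun i hi => ?_⟩
        fin_cases i
        · exact absurd hi h0
        · exact absurd hi h1
        · rfl
  obtain ⟨e, he, hd⟩ := key j
  exact ⟨e, he, fun d hd' i hi => hj i hi ▸ hd d hd'⟩

/-- Off the cuts the two directions are opposite. On a cut each adjoining part contributes one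
direction, as the next position must lie in the same part. At the common end only part 2
contributes, so there `e₁` and `e₂` coincide and the line ends. -/
theorem exists_row_directions (p q : ℕ) (y : ℤ × ℤ) : ∃ e₁ e₂ : ℤ × ℤ, ∀ d ∈ units, ∀ i,
    Piece p q i y → Piece p q i (y + d) → rowDiff i d % 2 = 0 → d = e₁ ∨ d = e₂ := by
  by_cases h : OffCut p q y
  · obtain ⟨e, -, he⟩ := h.exists_direction
    exact ⟨e, -e, fun d hd i hi _ hr => (he d hd i hi).1 hr⟩
  obtain ⟨m, n⟩ := y
  have key : ∀ e₁ e₂ : ℤ × ℤ, (∀ d ∈ units, ∀ i,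
      Piece p q i (m, n) → Piece p q i (m + d.1, n + d.2) → rowDiff i d % 2 = 0 →
      d = e₁ ∨ d = e₂) →
      ∃ e₁ e₂ : ℤ × ℤ, ∀ d ∈ units, ∀ i,
      Piece p q i (m, n) → Piece p q i ((m, n) + d) → rowDiff i d % 2 = 0 → d = e₁ ∨ d = e₂ :=
    fun e₁ e₂ h => ⟨e₁, e₂, h⟩
  simp only [OffCut] at h
  rcases lt_trichotomy m 0 with hm | hm | hm
  · apply key (0, 1) (1, -1)
    intro d hd i h1 h2 h3
    simp only [units, List.mem_cons, List.not_mem_nil, or_false] at hd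
    rcases hd with rfl | rfl | rfl | rfl | rfl | rfl <;> fin_cases i <;>
      simp only [Piece, rowDiff] at h1 h2 h3 <;> first | exact Or.inl rfl | exact Or.inr rfl | (exfalso; omega)
  · by_cases hn : n = p + q
    · apply key (0, 1) (0, 1)
      intro d hd i h1 h2 h3
      simp only [units, List.mem_cons, List.not_mem_nil, or_false] at hd
      rcases hd with rfl | rfl | rfl | rfl | rfl | rfl <;> fin_cases i <;>
        simp only [Piece, rowDiff] at h1 h2 h3 <;> first | exact Or.inl rfl | exact Or.inr rfl | (exfalso; omega)
    · apply key (-1, 1) (1, 0)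
      intro d hd i h1 h2 h3
      simp only [units, List.mem_cons, List.not_mem_nil, or_false] at hd
      rcases hd with rfl | rfl | rfl | rfl | rfl | rfl <;> fin_cases i <;>
        simp only [Piece, rowDiff] at h1 h2 h3 <;> first | exact Or.inl rfl | exact Or.inr rfl | (exfalso; omega)
  · apply key (-1, 0) (0, 1)
    intro d hd i h1 h2 h3
    simp only [units, List.mem_cons, List.not_mem_nil, or_false] at hd
    rcases hd with rfl | rfl | rfl | rfl | rfl | rfl <;> fin_cases i <;>
      simp only [Piece, rowDiff] at h1 h2 h3 <;> first | exact Or.inl rfl | exact Or.inr rfl | (exfalso; omega)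

theorem NonCorner.row_degree (hp : 0 < p) (hf : NonCorner f) {g₁ g₂ g₃ : FullereneFace p q}
    (h₁ : (rowGraph p q).Adj f g₁) (h₂ : (rowGraph p q).Adj f g₂) (h₃ : (rowGraph p q).Adj f g₃) :
    g₁ = g₂ ∨ g₁ = g₃ ∨ g₂ = g₃ := by
  obtain ⟨X, hX, e₁, e₂, he⟩ : ∃ X, LocalChart (fullereneFaceGraph p q) f X ∧
      ∃ e₁ e₂ : ℤ × ℤ, ∀ d ∈ units, eps (X d) = eps f → d = e₁ ∨ d = e₂ := by
    rcases f.exists_position with ⟨A, y, hA, hc⟩ | ⟨hcap, e, u, y, x, hF, hl⟩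
    · obtain ⟨X, hX, hX'⟩ := hc.exists_rowChart hp hA hf
      obtain ⟨e₁, e₂, he⟩ := exists_row_directions p q y
      refine ⟨X, hX, e₁, e₂, fun d hd hr => ?_⟩
      obtain ⟨⟨i, hi, hi', hr'⟩, -⟩ := hX' d hd
      exact he d hd i hi hi' (hr'.1 hr)
    · obtain ⟨X, hX, e, -, he⟩ := hl.exists_rowChart hp hF hcap hf
      exact ⟨X, hX, e, -e, fun d hd hr => (he d hd).1 hr⟩
  obtain ⟨d₁, hd₁, rfl⟩ := hX.exists_of_adj _ h₁.1
  obtain ⟨d₂, hd₂, rfl⟩ := hX.exists_of_adj _ h₂.1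
  obtain ⟨d₃, hd₃, rfl⟩ := hX.exists_of_adj _ h₃.1
  rcases he _ hd₁ h₁.2.symm with rfl | rfl <;> rcases he _ hd₂ h₂.2.symm with rfl | rfl <;>
    rcases he _ hd₃ h₃.2.symm with rfl | rfl <;> simp

/-! ### The neighbours of a corner -/

/-- The cell with first corner `v` and second corner `b` may have a weaving line through `v`. -/
def RowFlag (v b : IcoVertex) : Prop :=
  (∃ γ : Cls, ∃ u ∈ [((1, 0) : ℤ × ℤ), (-1, 0)], FreeTriangle γ u ∧ label γ = v ∧
    label (γ + cls u) = b) ∨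
  ∃ α : Cls, α.1 = 0 ∧ ((capB α = v ∧ capC α = b) ∨ (capC α = v ∧ capA α = b) ∨
    (capT α = v ∧ capC α = b))

instance (v b : IcoVertex) : Decidable (RowFlag v b) := by
  unfold RowFlag; infer_instance

/-- With `rowFlag_of_eps_eq` this bounds the row neighbours of a pentagon, for which no local chart
is available. -/
theorem card_rowFlag : ∀ v, (Finset.univ.filter (RowFlag v)).card ≤ 2 := by decide +kernel

theorem card_apex : ∀ v : IcoVertex, (Finset.univ.filter fun b => (apex v b).isSome).card ≤ 5 := by
  decide +kernel

theorem inCell_zero (p q : ℕ) : InCell p q 0 := by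
  simp only [InCell, weightA, weightB, weightC, latNorm, Prod.fst_zero, Prod.snd_zero]
  refine ⟨?_, ?_, ?_⟩ <;> ring_nf <;> positivity

/-- In a free triangle the position (0, 1) is u ω away from the corner, which changes the row by
minus the second coordinate of u; so u is ±1. Of the six corners of the two cells of a cap, three
are excluded by reading off the row difference. -/
theorem rowFlag_of_eps_eq (hp : 0 < p) {v b c : IcoVertex} (hc : IsCell v b c)
    (hf : f.1 = cellPoint p q v b c 0) (hg : g.1 = cellPoint p q v b c (0, 1))
    (h : eps g = eps f) : RowFlag v b := by
  have hP : (1 : ℤ) ≤ p := by exact_mod_cast hp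
  have hQ : (0 : ℤ) ≤ q := by positivity
  have i0 := inCell_zero p q
  have i1 := inCell_zero_one (q := q) hp
  rcases hc.free_or_cap with ⟨γ, u, hu, hF, rfl, rfl, rfl⟩ | ⟨α, hα, hm⟩
  · left
    obtain ⟨e, rfl⟩ := exists_cls_eq γ
    have l0 : TriangleLift p q e u 0 f _ := ⟨hu, hF.1, i0, hf, rfl⟩
    have l1 : TriangleLift p q e u (0, 1) g _ := ⟨hu, hF.1, i1, hg, rfl⟩
    rw [((l0.planeSpot hF).2 _).eps_eq hp, ((l1.planeSpot hF).2 _).eps_eq hp, rowParity, rowParity,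
      ZMod.intCast_eq_intCast_iff'] at h
    refine ⟨cls e, u, ?_, hF, rfl, rfl⟩
    simp only [Prod.fst_add, emul, Prod.fst_zero, Prod.snd_zero] at h
    have h2 : u.2 % 2 = 0 := by push_cast at h; omega
    have key : ∀ u ∈ units, u.2 % 2 = 0 → u ∈ [((1, 0) : ℤ × ℤ), (-1, 0)] := by decide
    exact key u hu h2
  obtain ⟨A, rfl⟩ := exists_cls_eq α
  obtain ⟨c1, c2⟩ := isCell_cap _ hα
  have key : ∀ (i : Fin 3) (y d : ℤ × ℤ), CapFace p q (cls A) y f →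
      CapFace p q (cls A) (y + d) g → Piece p q i y → Piece p q i (y + d) →
      rowDiff i d % 2 = 0 := fun i y d k1 k2 k3 k4 =>
    (CapSpot.eps_eq_iff hp hα k3 k4 (Or.inl k2) (Or.inl k1)).1 h
  simp only [List.mem_cons, Prod.mk.injEq, List.not_mem_nil, or_false] at hm
  rcases hm with ⟨rfl, rfl, rfl⟩ | ⟨rfl, rfl, rfl⟩ | ⟨rfl, rfl, rfl⟩ | ⟨rfl, rfl, rfl⟩ |
    ⟨rfl, rfl, rfl⟩ | ⟨rfl, rfl, rfl⟩
  · refine absurd (key 0 0 (0, 1) (Or.inl ⟨i0, hf⟩) (Or.inl ⟨?_, ?_⟩) ?_ ?_) (by decide)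
    · rwa [zero_add]
    · rwa [zero_add]
    · simp only [Piece, Prod.fst_zero, Prod.snd_zero]; omega
    · simp only [Piece, zero_add]; omega
  · exact Or.inr ⟨_, hα, Or.inl ⟨rfl, rfl⟩⟩
  · exact Or.inr ⟨_, hα, Or.inr (Or.inl ⟨rfl, rfl⟩)⟩
  · have e0 : capFlip p q (-(q : ℤ), (p : ℤ) + q) = 0 := by ext <;> simp [capFlip]
    have e1 : capFlip p q ((-(q : ℤ), (p : ℤ) + q) + (1, 0)) = (0, 1) := by
      ext <;> simp [capFlip]; ring
    refine absurd (key 2 (-(q : ℤ), (p : ℤ) + q) (1, 0) (Or.inr ⟨?_, ?_⟩) (Or.inr ⟨?_, ?_⟩) ?_ ?_) (by decide)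
    · rwa [e0]
    · rwa [e0]
    · rwa [e1]
    · rwa [e1]
    · simp only [Piece]; omega
    · simp only [Piece, Prod.mk_add_mk]; omega
  · have e0 : cellRot p q (capFlip p q (p, q)) = 0 := by ext <;> simp [capFlip, cellRot]
    have e1 : cellRot p q (capFlip p q (((p : ℤ), (q : ℤ)) + (-1, 1))) = (0, 1) := by
      ext <;> simp [capFlip, cellRot] <;> ring
    refine absurd (key 2 ((p : ℤ), (q : ℤ)) (-1, 1) (Or.inr ⟨?_, ?_⟩) (Or.inr ⟨?_, ?_⟩) ?_ ?_) (by decide)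
    · rwa [← inCell_cellRot, e0]
    · rwa [← cellPoint_cellRot c2, e0]
    · rwa [← inCell_cellRot, e1]
    · rwa [← cellPoint_cellRot c2, e1]
    · simp only [Piece]; omega
    · simp only [Piece, Prod.mk_add_mk]; omega
  · exact Or.inr ⟨_, hα, Or.inr (Or.inr ⟨rfl, rfl⟩)⟩

theorem row_degree_of_corner (hp : 0 < p) {v : IcoVertex}
    (hf : f.1 v = latNorm ((p : ℤ), (q : ℤ))) {g₁ g₂ g₃ : FullereneFace p q}
    (h₁ : (rowGraph p q).Adj f g₁) (h₂ : (rowGraph p q).Adj f g₂) (h₃ : (rowGraph p q).Adj f g₃) :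
    g₁ = g₂ ∨ g₁ = g₃ ∨ g₂ = g₃ := by
  have key : ∀ g, (rowGraph p q).Adj f g → ∃ b c, IsCell v b c ∧ RowFlag v b ∧
      g.1 = cellPoint p q v b c (0, 1) := by
    intro g hg
    obtain ⟨b, c, hc, h0, h1⟩ := exists_cell_zero_one_of_corner_adj hp hf hg.1
    exact ⟨b, c, hc, rowFlag_of_eps_eq hp hc h0 h1 hg.2.symm, h1⟩
  have hinj : ∀ g g' : FullereneFace p q, ∀ b c c', IsCell v b c → IsCell v b c' →
      g.1 = cellPoint p q v b c (0, 1) → g'.1 = cellPoint p q v b c' (0, 1) → g = g' := by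
    rintro g g' b c c' hc hc' h h'
    obtain rfl := hc.unique hc'
    exact Subtype.ext (h.trans h'.symm)
  obtain ⟨b₁, c₁, k₁, f₁, e₁⟩ := key g₁ h₁
  obtain ⟨b₂, c₂, k₂, f₂, e₂⟩ := key g₂ h₂
  obtain ⟨b₃, c₃, k₃, f₃, e₃⟩ := key g₃ h₃
  have hmem : ∀ b, RowFlag v b → b ∈ Finset.univ.filter (RowFlag v) := fun b hb => by simpa using hb
  by_contra! hne
  have : 2 < (Finset.univ.filter (RowFlag v)).card := Finset.two_lt_card.2
    ⟨b₁, hmem _ f₁, b₂, hmem _ f₂, b₃, hmem _ f₃, ?_, ?_, ?_⟩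
  · exact absurd (card_rowFlag v) (by omega)
  · rintro rfl; exact hne.1 (hinj _ _ _ _ _ k₁ k₂ e₁ e₂)
  · rintro rfl; exact hne.2.1 (hinj _ _ _ _ _ k₁ k₃ e₁ e₃)
  · rintro rfl; exact hne.2.2 (hinj _ _ _ _ _ k₂ k₃ e₂ e₃)

/-- A weaving line does not branch. -/
theorem row_degree (hp : 0 < p) {g₁ g₂ g₃ : FullereneFace p q}
    (h₁ : (rowGraph p q).Adj f g₁) (h₂ : (rowGraph p q).Adj f g₂) (h₃ : (rowGraph p q).Adj f g₃) :
    g₁ = g₂ ∨ g₁ = g₃ ∨ g₂ = g₃ := by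
  by_cases hf : NonCorner f
  · exact hf.row_degree hp h₁ h₂ h₃
  · simp only [NonCorner, not_forall, not_not] at hf
    obtain ⟨v, hv⟩ := hf
    exact row_degree_of_corner hp hv h₁ h₂ h₃

/-- A corner has at most one neighbour in each of the five cells around it. -/
theorem not_isHexagon_of_corner (hp : 0 < p) {v : IcoVertex}
    (hf : f.1 v = latNorm ((p : ℤ), (q : ℤ))) : ¬ IsHexagon (fullereneFaceGraph p q) f := by
  intro h
  have key : ∀ g : FullereneFace p q, ∃ b, (fullereneFaceGraph p q).Adj f g →
      ∃ c, IsCell v b c ∧ g.1 = cellPoint p q v b c (0, 1) := by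
    intro g
    by_cases hg : (fullereneFaceGraph p q).Adj f g
    · obtain ⟨b, c, hc, -, h1⟩ := exists_cell_zero_one_of_corner_adj hp hf hg
      exact ⟨b, fun _ => ⟨c, hc, h1⟩⟩
    · exact ⟨v, fun h => absurd h hg⟩
  choose B hB using key
  have h1 := Set.ncard_le_ncard_of_injOn (s := (fullereneFaceGraph p q).neighborSet f)
    (t := (Finset.univ.filter fun b => (apex v b).isSome : Finset IcoVertex)) B
    (fun g hg => by
      obtain ⟨c, hc, -⟩ := hB g hg
      simp [isCell_iff_apex.1 hc])
    (fun g hg g' hg' e => by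
      obtain ⟨c, hc, h1⟩ := hB g hg
      obtain ⟨c', hc', h1'⟩ := hB g' hg'
      rw [← e] at hc' h1'
      obtain rfl := hc.unique hc'
      exact Subtype.ext (h1.trans h1'.symm))
    (Finset.finite_toSet _)
  rw [Set.ncard_coe_finset] at h1
  have h2 := card_apex v
  have h3 : ((fullereneFaceGraph p q).neighborSet f).ncard = 6 := h
  omega

theorem NonCorner.isHexagon (hp : 0 < p) (hf : NonCorner f) :
    IsHexagon (fullereneFaceGraph p q) f := by
  obtain ⟨a, b, c, x, hc, hx, hfx⟩ := f.2
  obtain ⟨d₁, d₂, d₃, hs⟩ := hc.exists_star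
  obtain ⟨X, hX, -⟩ := hf.exists_localChart hp hs hx hfx
  exact hX.isHexagon

end

/-! ### Graphs with at most two edges at each vertex -/

section
variable {W : Type*} {H : SimpleGraph W}

/-- The first `n` values of `x` form a path. -/
structure IsPathSeq (H : SimpleGraph W) (n : ℕ) (x : ℕ → W) : Prop where
  inj : ∀ i < n, ∀ j < n, x i = x j → i = j
  adj : ∀ i, i + 1 < n → H.Adj (x i) (x (i + 1))

theorem IsPathSeq.append {n : ℕ} {x : ℕ → W} (h : IsPathSeq H n x) {w : W}
    (hw : ∀ i < n, x i ≠ w) (ha : ∀ i, i + 1 = n → H.Adj (x i) w) :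
    ∃ x, IsPathSeq H (n + 1) x := by
  refine ⟨fun i => if i < n then x i else w, ⟨fun i hi j hj e => ?_, fun i hi => ?_⟩⟩
  · by_cases h1 : i < n <;> by_cases h2 : j < n
    · rw [if_pos h1, if_pos h2] at e; exact h.inj _ h1 _ h2 e
    · rw [if_pos h1, if_neg h2] at e; exact absurd e (hw _ h1)
    · rw [if_neg h1, if_pos h2] at e; exact absurd e.symm (hw _ h2)
    · omega
  · by_cases h1 : i + 1 < n
    · rw [if_pos h1, if_pos (by omega)]; exact h.adj _ h1
    · rw [if_neg h1, if_pos (by omega)]; exact ha _ (by omega)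

theorem IsPathSeq.reverse {n : ℕ} {x : ℕ → W} (h : IsPathSeq H n x) :
    IsPathSeq H n fun i => x (n - 1 - i) := by
  refine ⟨fun i hi j hj e => ?_, fun i hi => ?_⟩
  · have := h.inj _ (by omega) _ (by omega) e
    omega
  · have := h.adj (n - 1 - (i + 1)) (by omega)
    rw [show n - 1 - (i + 1) + 1 = n - 1 - i by omega] at this
    exact this.symm

theorem exists_longest_pathSeq [Finite W] (hW : Nonempty W) : ∃ n x, 1 ≤ n ∧ IsPathSeq H n x ∧
    ¬ ∃ x, IsPathSeq H (n + 1) x := by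
  classical
  have := Fintype.ofFinite W
  have hb : ∀ n, (∃ x, IsPathSeq H n x) → n ≤ Fintype.card W := by
    rintro n ⟨x, hx⟩
    have := Fintype.card_le_of_injective (fun i : Fin n => x i)
      (fun i j e => Fin.ext (hx.inj _ i.2 _ j.2 e))
    simpa using this
  have h1 : ∃ x, IsPathSeq H 1 x := ⟨fun _ => hW.some, fun i hi j hj _ => by omega,
    fun i hi => by omega⟩
  have hc : 1 ≤ Fintype.card W := hb 1 h1
  set n := Nat.findGreatest (fun n => ∃ x, IsPathSeq H n x) (Fintype.card W) with hn
  obtain ⟨x, hx⟩ : ∃ x, IsPathSeq H n x := Nat.findGreatest_spec (P := fun n => ∃ x, IsPathSeq H n x) hc h1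
  refine ⟨n, x, Nat.le_findGreatest hc h1, hx, fun h => ?_⟩
  have := Nat.le_findGreatest (P := fun n => ∃ x, IsPathSeq H n x) (hb _ h) h
  omega

/-- In a longest path every neighbour of a vertex of the path lies on the path: inner vertices have
used their two edges, and the ends cannot be prolonged. By connectedness the path is everything, and
the only possible further edge joins its ends. -/
theorem path_or_even_cycle [Finite W] (hH : H.Connected)
    (hdeg : ∀ a b c d, H.Adj a b → H.Adj a c → H.Adj a d → b = c ∨ b = d ∨ c = d)
    (hcol : H.Colorable 2) :
    (∃ n, 1 ≤ n ∧ Nonempty (H ≃g SimpleGraph.pathGraph n)) ∨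
      ∃ m, 2 ≤ m ∧ Nonempty (H ≃g SimpleGraph.cycleGraph (2 * m)) := by
  obtain ⟨n, x, hn, hx, hmax⟩ := exists_longest_pathSeq (H := H) hH.nonempty
  have hmid : ∀ i w, 0 < i → i + 1 < n → H.Adj (x i) w → w = x (i - 1) ∨ w = x (i + 1) := by
    intro i w h0 h1 hw
    have k1 := (hx.adj (i - 1) (by omega)).symm
    rw [show i - 1 + 1 = i by omega] at k1
    rcases hdeg _ _ _ _ hw k1 (hx.adj i h1) with h | h | h
    · exact Or.inl h
    · exact Or.inr h
    · have := hx.inj _ (by omega) _ (by omega) h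
      omega
  have hclosed : ∀ i w, i < n → H.Adj (x i) w → ∃ j < n, x j = w := by
    intro i w hi hw
    by_contra! hne
    rcases Nat.eq_zero_or_pos i with rfl | h0
    · refine hmax (hx.reverse.append (w := w) (fun j hj => hne _ (by omega)) fun j hj => ?_)
      rwa [show n - 1 - j = 0 by omega]
    · by_cases h1 : i + 1 < n
      · rcases hmid i w h0 h1 hw with h | h
        · exact hne _ (by omega) h.symm
        · exact hne _ h1 h.symm
      · refine hmax (hx.append (w := w) hne fun j hj => ?_)
        rwa [show j = i by omega]
  have hall : ∀ w, ∃ j < n, x j = w := by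
    intro w
    obtain ⟨p⟩ := hH.preconnected (x 0) w
    have key : ∀ {u v : W}, H.Walk u v → (∃ j < n, x j = u) → ∃ j < n, x j = v := by
      intro u v p
      induction p with
      | nil => exact id
      | cons h p ih =>
        rintro ⟨j, hj, rfl⟩
        exact ih (hclosed j _ hj h)
    exact key p ⟨0, hn, rfl⟩
  have hbij : Function.Bijective fun i : Fin n => x i :=
    ⟨fun i j e => Fin.ext (hx.inj _ i.2 _ j.2 e), fun w => by
      obtain ⟨j, hj, h⟩ := hall w
      exact ⟨⟨j, hj⟩, h⟩⟩
  have hadj : ∀ i j, i < j → j < n → H.Adj (x i) (x j) → j = i + 1 ∨ (i = 0 ∧ j + 1 = n) := by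
    intro i j hij hj h
    rcases Nat.eq_zero_or_pos i with rfl | h0
    · by_cases h1 : j + 1 < n
      · rcases hmid j _ (by omega) h1 h.symm with h | h
        · have := hx.inj _ (by omega) _ (by omega) h
          omega
        · have := hx.inj _ (by omega) _ (by omega) h
          omega
      · omega
    · rcases hmid i _ h0 (by omega) h with h | h
      · have := hx.inj _ (by omega) _ (by omega) h
        omega
      · have := hx.inj _ (by omega) _ (by omega) h
        omega
  set e := Equiv.ofBijective _ hbij with he
  have hex : ∀ i : Fin n, e i = x i := fun i => rfl
  -- For n = 2 the two ends are already joined by the path, which gives no cycle.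
  by_cases hc : 3 ≤ n ∧ H.Adj (x 0) (x (n - 1))
  · right
    obtain ⟨hn3, hc⟩ := hc
    obtain ⟨C⟩ := hcol
    -- The two colors alternate along the path, so an edge between its ends forces n to be even.
    have halt : ∀ i < n, (C (x i)).val % 2 = ((C (x 0)).val + i) % 2 := by
      intro i
      induction i with
      | zero => intro _; rfl
      | succ i ih =>
        intro hi
        have h1 := C.valid (hx.adj i hi)
        have h2 := ih (by omega)
        have h3 : (C (x i)).val ≠ (C (x (i + 1))).val := fun h => h1 (Fin.ext h)
        omega
    have h1 := halt (n - 1) (by omega)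
    have h2 : (C (x 0)).val ≠ (C (x (n - 1))).val := fun h => C.valid hc (Fin.ext h)
    obtain ⟨m, rfl⟩ : ∃ m, n = 2 * m := ⟨n / 2, by omega⟩
    refine ⟨m, by omega, ⟨SimpleGraph.Iso.symm ⟨e, @fun i j => ?_⟩⟩⟩
    rw [SimpleGraph.cycleGraph_adj', hex, hex]
    have key : ∀ i j : Fin (2 * m), i < j → (H.Adj (x i) (x j) ↔
        (i - j).val = 1 ∨ (j - i).val = 1) := by
      intro i j hij
      have hi := i.2
      have hj := j.2
      rw [Fin.sub_val_of_le hij.le]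
      have hd : (i - j).val = 2 * m - (j.val - i.val) := by
        rw [Fin.coe_sub_iff_lt.2 hij]
        have : i.val < j.val := hij
        omega
      rw [hd]
      have hij' : i.val < j.val := hij
      constructor
      · intro h
        rcases hadj _ _ hij hj h with h | h <;> omega
      · rintro (h | h)
        · have h0 : i.val = 0 := by omega
          have h1 : j.val = 2 * m - 1 := by omega
          rw [h0, h1]
          exact hc
        · have : j.val = i.val + 1 := by omega
          rw [this]
          exact hx.adj _ (by omega)
    rcases lt_trichotomy i j with h | rfl | h
    · exact key i j h
    · simp only [SimpleGraph.irrefl, false_iff]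
      have : NeZero (2 * m) := ⟨by omega⟩
      simp
    · rw [H.adj_comm, key j i h, or_comm]
  · left
    refine ⟨n, hn, ⟨SimpleGraph.Iso.symm ⟨e, @fun i j => ?_⟩⟩⟩
    rw [SimpleGraph.pathGraph_adj, hex, hex]
    have key : ∀ i j : Fin n, i < j → (H.Adj (x i) (x j) ↔
        i.val + 1 = j.val ∨ j.val + 1 = i.val) := by
      intro i j hij
      have hi := i.2
      have hj := j.2
      have hij' : i.val < j.val := hij
      constructor
      · intro h
        rcases hadj _ _ hij hj h with h' | ⟨h1, h2⟩
        · omega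
        · by_cases hn3 : 3 ≤ n
          · rw [h1, show j.val = n - 1 by omega] at h
            exact absurd ⟨hn3, h⟩ hc
          · omega
      · rintro (h | h)
        · rw [← h]
          exact hx.adj _ (by omega)
        · omega
    rcases lt_trichotomy i j with h | rfl | h
    · exact key i j h
    · simp
    · rw [H.adj_comm, key j i h, or_comm]

end

/-! ### The cuts -/

/-- The faces of the cut from the corner `t` of a cap, in the coordinates of the cap. -/
def cutPos (p q : ℕ) (t : Fin 3) (j : ℕ) : ℤ × ℤ :=
  match t with
  | 0 => (0, j)
  | 1 => (p - j, q + j)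
  | 2 => (-q + j, p + q)

/-- The length of a cut. -/
def cutLen (p q : ℕ) (t : Fin 3) : ℕ :=
  match t with
  | 0 => p + q
  | 1 => p
  | 2 => q

/-- The direction of a cut. -/
def cutDir (t : Fin 3) : ℤ × ℤ :=
  match t with
  | 0 => (0, 1)
  | 1 => (-1, 1)
  | 2 => (1, 0)

/-- The corner of a cap at which a cut starts. -/
def capCorner (α : Cls) (t : Fin 3) : IcoVertex :=
  match t with
  | 0 => capA α
  | 1 => capB α
  | 2 => capC α

/-- The twelve vertices are the corners a, b, c of the four caps, so each pentagon is the start of a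
cut. -/
theorem exists_capCorner : ∀ v, ∃ α : Cls, ∃ t, α.1 = 0 ∧ capCorner α t = v := by decide +kernel

theorem capCorner_ne : ∀ α α' : Cls, α.1 = 0 → α'.1 = 0 → α' ≠ α → ∀ t t',
    capCorner α' t' ≠ capCorner α t := by decide +kernel

theorem cutDir_mem : ∀ t, cutDir t ∈ units := by decide

section
variable {p q : ℕ} {f g : FullereneFace p q} {α : Cls} {y : ℤ × ℤ} {t : Fin 3} {j : ℕ}
  {v w : IcoVertex}

theorem cutPos_succ (p q : ℕ) (t : Fin 3) (j : ℕ) :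
    cutPos p q t (j + 1) = cutPos p q t j + cutDir t := by
  fin_cases t <;> ext <;> simp [cutPos, cutDir] <;> ring

theorem FullereneFace.nonneg (f : FullereneFace p q) (v : IcoVertex) : 0 ≤ f.1 v := by
  obtain ⟨a, b, c, x, hc, ⟨h1, h2, h3⟩, h⟩ := f.2
  rw [h, cellPoint]
  split_ifs <;> first | assumption | rfl

theorem FullereneFace.add_le (f : FullereneFace p q) (h : v ≠ w) :
    f.1 v + f.1 w ≤ latNorm ((p : ℤ), (q : ℤ)) := by
  obtain ⟨a, b, c, x, hc, ⟨h1, h2, h3⟩, hf⟩ := f.2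
  have hs := weight_sum p q x
  obtain ⟨n1, n2, n3⟩ := hc.ne
  rw [hf, cellPoint, cellPoint]
  split_ifs <;> first | omega | (subst_vars; exact absurd rfl h)

theorem face_eq_of_corner (hf : f.1 v = latNorm ((p : ℤ), (q : ℤ)))
    (hg : g.1 v = latNorm ((p : ℤ), (q : ℤ))) : f = g := by
  apply Subtype.ext
  funext w
  by_cases h : v = w
  · rw [← h, hf, hg]
  · have h1 := f.add_le h
    have h2 := g.add_le h
    have h3 := f.nonneg w
    have h4 := g.nonneg w
    omega

/-- The least value -pq is the weight at (0, p + q), where the cuts meet; the bound keeps cuts of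
different caps apart. -/
theorem inCap_cutPos (p q : ℕ) (hj : j ≤ cutLen p q t) : InCap p q (cutPos p q t j) ∧
    -((p : ℤ) * q) ≤ weightA p q (cutPos p q t j) := by
  have hP : (0 : ℤ) ≤ p := by positivity
  have hQ : (0 : ℤ) ≤ q := by positivity
  have hJ : (0 : ℤ) ≤ j := by positivity
  have k1 := mul_nonneg hP hQ
  have k2 := mul_nonneg hP hJ
  have k3 := mul_nonneg hQ hJ
  have k4 := mul_nonneg hP hP
  have k5 := mul_nonneg hQ hQ
  have hL : (j : ℤ) ≤ cutLen p q t := by exact_mod_cast hj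
  have k6 := mul_nonneg hP (sub_nonneg.2 hL)
  have k7 := mul_nonneg hQ (sub_nonneg.2 hL)
  suffices h : (0 ≤ weightB p q (cutPos p q t j) ∧ 0 ≤ weightC p q (cutPos p q t j) ∧
      0 ≤ weightC p q (cutPos p q t j) + weightA p q (cutPos p q t j) ∧
      0 ≤ weightB p q (cutPos p q t j) + weightA p q (cutPos p q t j)) ∧
      -((p : ℤ) * q) ≤ weightA p q (cutPos p q t j) by
    obtain ⟨⟨h1, h2, h3, h4⟩, h5⟩ := h
    refine ⟨?_, h5⟩
    rcases le_total 0 (weightA p q (cutPos p q t j)) with h | h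
    · exact Or.inl ⟨h, h1, h2⟩
    · exact Or.inr (inCell_capFlip.2 ⟨h3, h4, h⟩)
  fin_cases t <;> simp only [cutLen, Nat.cast_add] at k6 k7 <;>
    simp only [cutPos, weightA, weightB, weightC, latNorm] <;>
    refine ⟨⟨?_, ?_, ?_, ?_⟩, ?_⟩ <;> nlinarith

theorem exists_capFace (hα : α.1 = 0) (hy : InCap p q y) : ∃ f, CapFace p q α y f := by
  obtain ⟨c1, c2⟩ := isCell_cap _ hα
  rcases hy with hy | hy
  · exact ⟨cellFace c1 hy, Or.inl ⟨hy, rfl⟩⟩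
  · exact ⟨cellFace c2 hy, Or.inr ⟨hy, rfl⟩⟩

theorem exists_cutFace (p q : ℕ) : ∃ F : Cls → Fin 3 → ℕ → FullereneFace p q, ∀ α t j, α.1 = 0 →
    j ≤ cutLen p q t → CapFace p q α (cutPos p q t j) (F α t j) := by
  have : ∀ (α : Cls) (t : Fin 3) (j : ℕ), ∃ f : FullereneFace p q, α.1 = 0 → j ≤ cutLen p q t →
      CapFace p q α (cutPos p q t j) f := by
    intro α t j
    by_cases h : α.1 = 0 ∧ j ≤ cutLen p q t
    · obtain ⟨f, hf⟩ := exists_capFace h.1 (inCap_cutPos p q h.2).1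
      exact ⟨f, fun _ _ => hf⟩
    · obtain ⟨f, -⟩ := exists_capFace (α := 0) rfl (inCap_cutPos p q (t := 0) (j := 0) (by simp)).1
      exact ⟨f, fun h1 h2 => absurd ⟨h1, h2⟩ h⟩
  choose F hF using this
  exact ⟨F, hF⟩

/-- The faces of the cuts. -/
noncomputable def cutFace (p q : ℕ) : Cls → Fin 3 → ℕ → FullereneFace p q :=
  (exists_cutFace p q).choose

theorem capFace_cutFace (hα : α.1 = 0) (hj : j ≤ cutLen p q t) :
    CapFace p q α (cutPos p q t j) (cutFace p q α t j) :=
  (exists_cutFace p q).choose_spec α t j hα hj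

/-- The cut from the corner `t` of the cap of class `α`. -/
noncomputable def cutList (p q : ℕ) (α : Cls) (t : Fin 3) : List (FullereneFace p q) :=
  (List.range (cutLen p q t + 1)).map (cutFace p q α t)

theorem mem_cutList {f : FullereneFace p q} :
    f ∈ cutList p q α t ↔ ∃ j ≤ cutLen p q t, cutFace p q α t j = f := by
  simp [cutList]

theorem cutFace_corner (hα : α.1 = 0) (t : Fin 3) :
    (cutFace p q α t 0).1 (capCorner α t) = latNorm ((p : ℤ), (q : ℤ)) := by
  have h := capFace_cutFace (p := p) (q := q) hα (Nat.zero_le (cutLen p q t))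
  obtain ⟨h1, h2, h3⟩ := h.weight_eq hα
  have hs := weight_sum p q (cutPos p q t 0)
  have n1 := (cutFace p q α t 0).nonneg (capA α)
  have n2 := (cutFace p q α t 0).nonneg (capB α)
  have n3 := (cutFace p q α t 0).nonneg (capC α)
  have n4 := (cutFace p q α t 0).nonneg (capT α)
  fin_cases t
  · have e1 : weightB p q (cutPos p q 0 0) = 0 := by simp [cutPos, weightB]
    have e2 : weightC p q (cutPos p q 0 0) = 0 := by simp [cutPos, weightC]
    simp only [Fin.zero_eta, capCorner] at *
    omega
  · have e1 : weightA p q (cutPos p q 1 0) = 0 := by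
      simp [cutPos, weightA, weightB, weightC, latNorm]; ring
    have e2 : weightC p q (cutPos p q 1 0) = 0 := by simp [cutPos, weightC]; ring
    simp only [Fin.mk_one, capCorner] at *
    omega
  · have e1 : weightA p q (cutPos p q 2 0) = 0 := by
      simp [cutPos, weightA, weightB, weightC, latNorm]; ring
    have e2 : weightB p q (cutPos p q 2 0) = 0 := by simp [cutPos, weightB]; ring
    simp only [Fin.reduceFinMk, capCorner] at *
    omega

theorem InCell.eq_of_corner (hp : 0 < p) {a b c : IcoVertex} (hy : InCell p q y)
    (hf : f.1 = cellPoint p q a b c y)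
    (hv : f.1 v = latNorm ((p : ℤ), (q : ℤ))) :
    y = 0 ∨ y = ((p : ℤ), (q : ℤ)) ∨ y = (-(q : ℤ), (p : ℤ) + q) := by
  have hN := latNorm_pos q hp
  have hs := weight_sum p q y
  obtain ⟨h1, h2, h3⟩ := hy
  rw [hf, cellPoint] at hv
  split_ifs at hv
  · left
    apply eq_of_weight_eq (q := q) hp
    · simp only [weightB, Prod.fst_zero, Prod.snd_zero] at *; omega
    · simp only [weightC, Prod.fst_zero, Prod.snd_zero] at *; omega
  · right; left
    apply eq_of_weight_eq (q := q) hp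
    · rw [hv]; simp only [weightB, latNorm]; ring
    · rw [show weightC p q y = 0 by omega]; simp only [weightC]; ring
  · right; right
    apply eq_of_weight_eq (q := q) hp
    · rw [show weightB p q y = 0 by omega]; simp only [weightB]; ring
    · rw [hv]; simp only [weightC, latNorm]; ring
  · omega

theorem CapFace.eq_of_corner (hp : 0 < p) (h : CapFace p q α y f)
    (hv : f.1 v = latNorm ((p : ℤ), (q : ℤ))) :
    y = 0 ∨ y = ((p : ℤ), (q : ℤ)) ∨ y = (-(q : ℤ), (p : ℤ) + q) ∨
      y = ((p : ℤ) - q, (p : ℤ) + 2 * q) := by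
  rcases h with ⟨hy, h⟩ | ⟨hy, h⟩
  · have := hy.eq_of_corner hp h hv
    tauto
  · have := hy.eq_of_corner hp h hv
    simp only [capFlip, Prod.ext_iff, Prod.fst_zero, Prod.snd_zero] at this ⊢
    omega

/-- For q = 0 the common end of the cuts is the corner c itself; this is the exception. -/
theorem nonCorner_cutFace (hp : 0 < p) (hα : α.1 = 0) (hj : j ≤ cutLen p q t)
    (h0 : 0 < j) (h : ¬ (q = 0 ∧ j = cutLen p q t)) : NonCorner (cutFace p q α t j) := by
  intro v hv
  have := (capFace_cutFace hα hj).eq_of_corner hp hv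
  fin_cases t <;> simp only [cutPos, Prod.ext_iff, Prod.fst_zero, Prod.snd_zero, cutLen] at * <;>
    omega

theorem CapFace.top_eq (hα : α.1 = 0) (h : CapFace p q α y f) :
    f.1 (capT α) = 0 ∨ f.1 (capT α) = -weightA p q y := by
  obtain ⟨n1, n2, n3, n4, n5, n6⟩ := cap_ne hα
  rcases le_total 0 (weightA p q y) with hA | hA
  · left
    rw [(h.of_nonneg hα hA).2, cellPoint_of_ne n4.symm n5.symm n6.symm]
  · right
    obtain ⟨h1, -, -⟩ := h.weight_eq hα
    rw [(h.of_nonpos hα hA).2, cellPoint_of_ne n3 n1 n4] at h1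
    rw [(h.of_nonpos hα hA).2]
    omega

theorem CapFace.eq_zero_of_ne (h : CapFace p q α y f) (hA : v ≠ capA α) (hB : v ≠ capB α)
    (hC : v ≠ capC α) (hT : v ≠ capT α) : f.1 v = 0 := by
  rcases h with ⟨-, h⟩ | ⟨-, h⟩
  · rw [h, cellPoint_of_ne hA hB hC]
  · rw [h, cellPoint_of_ne hC hB hT]

/-- Cuts which end in different caps are disjoint. -/
theorem cutFace_class_unique (hp : 0 < p) {α' : Cls} {t' : Fin 3} {j' : ℕ} (hα : α.1 = 0)
    (hα' : α'.1 = 0) (hj : j ≤ cutLen p q t) (hj' : j' ≤ cutLen p q t')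
    (h : cutFace p q α t j = cutFace p q α' t' j') : α' = α := by
  by_contra hne
  have k := capFace_cutFace (p := p) (q := q) hα hj
  have k' := capFace_cutFace (p := p) (q := q) hα' hj'
  rw [← h] at k'
  set f := cutFace p q α t j
  obtain ⟨-, b1⟩ := inCap_cutPos p q hj
  obtain ⟨-, b2⟩ := inCap_cutPos p q hj'
  have hT := k.top_eq hα
  have hT' := k'.top_eq hα'
  obtain ⟨h1, h2, h3⟩ := k'.weight_eq hα'
  have hs := weight_sum p q (cutPos p q t' j')
  have hv : ∀ s : Fin 3, f.1 (capCorner α' s) = 0 ∨ capCorner α' s = capT α := by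
    intro s
    by_cases hs : capCorner α' s = capT α
    · exact Or.inr hs
    · exact Or.inl (k.eq_zero_of_ne (capCorner_ne α α' hα hα' hne 0 s)
        (capCorner_ne α α' hα hα' hne 1 s) (capCorner_ne α α' hα hα' hne 2 s) hs)
  obtain ⟨n1, n2, n3, -, -, -⟩ := cap_ne hα'
  -- The corners a, b, c of different caps are different, so the face can have a nonzero coordinate
  -- at a, b, c of the second cap only at a single vertex: the outer vertex t of the first.
  have hsum : f.1 (capA α') + f.1 (capB α') + f.1 (capC α') ≤ f.1 (capT α) := by
    have n := f.nonneg (capT α)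
    rcases hv 0 with v0 | v0 <;> rcases hv 1 with v1 | v1 <;> rcases hv 2 with v2 | v2 <;>
      simp only [capCorner] at v0 v1 v2
    · omega
    · rw [v2]; omega
    · rw [v1]; omega
    · exact absurd (v1.trans v2.symm) n2
    · rw [v0]; omega
    · exact absurd (v0.trans v2.symm) n3
    · exact absurd (v0.trans v1.symm) n1
    · exact absurd (v0.trans v1.symm) n1
  have hP : (0 : ℤ) < p := by exact_mod_cast hp
  have hQ : (0 : ℤ) ≤ q := by positivity
  -- On a cut the coordinate at t is at most pq. Taking the outer vertices of both caps, the total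
  -- weight would be at most 2pq, which is less than p² + pq + q².
  have hlt : 2 * ((p : ℤ) * q) < latNorm ((p : ℤ), (q : ℤ)) := by
    simp only [latNorm]
    nlinarith [sq_nonneg ((p : ℤ) - q), mul_nonneg hP.le hQ, mul_pos hP hP]
  have hpq := mul_nonneg hP.le hQ
  omega

theorem cutFace_position_unique (hp : 0 < p) {t' : Fin 3} {j' : ℕ} (hα : α.1 = 0)
    (hj : j ≤ cutLen p q t) (hj' : j' ≤ cutLen p q t')
    (h : cutFace p q α t j = cutFace p q α t' j') :
    (t = t' ∧ j = j') ∨ (j = cutLen p q t ∧ j' = cutLen p q t') := by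
  have k := capFace_cutFace (p := p) (q := q) hα hj
  have k' := capFace_cutFace (p := p) (q := q) hα hj'
  rw [← h] at k'
  have e := k.position_unique hp hα k'
  by_cases ht : t = t'
  · subst ht
    left
    refine ⟨rfl, ?_⟩
    fin_cases t <;> simp only [cutPos, Prod.ext_iff] at e <;> omega
  · right
    fin_cases t <;> fin_cases t' <;> simp only [cutPos, cutLen, Prod.ext_iff] at * <;>
      first | omega | exact absurd trivial ht

end

section
variable {p q : ℕ} {f g x : FullereneFace p q} {α : Cls} {t : Fin 3} {j : ℕ}

/-- The neighbourhood of a face of a cut, from which another face of the cut is seen in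
direction `e`. -/
theorem exists_cutChart (hp : 0 < p) (hα : α.1 = 0) (hj : j ≤ cutLen p q t)
    (hf : NonCorner (cutFace p q α t j)) :
    ∃ X, LocalChart (fullereneFaceGraph p q) (cutFace p q α t j) X ∧
      (∀ d ∈ units, ∃ i, Piece p q i (cutPos p q t j) ∧ Piece p q i (cutPos p q t j + d) ∧
        (eps (X d) = eps (cutFace p q α t j) ↔ rowDiff i d % 2 = 0)) ∧
      (j < cutLen p q t → cutFace p q α t (j + 1) = X (cutDir t)) ∧
      ∀ j', j = j' + 1 → cutFace p q α t j' = X (-cutDir t) := by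
  have h := capFace_cutFace (p := p) (q := q) hα hj
  obtain ⟨A, rfl⟩ := exists_cls_eq α
  obtain ⟨X, hX, hX'⟩ := h.exists_rowChart hp hα hf
  refine ⟨X, hX, fun d hd => (hX' d hd).1, fun hlt => ?_, fun j' hj' => ?_⟩
  · refine (hX' _ (cutDir_mem t)).2 _ ?_
    rw [← cutPos_succ]
    exact capFace_cutFace hα hlt
  · subst hj'
    refine (hX' _ (neg_mem_units (cutDir_mem t))).2 _ ?_
    rw [cutPos_succ, add_neg_cancel_right]
    exact capFace_cutFace hα (by omega)

theorem rowDiff_beside_cut (hj : j < cutLen p q t) {d : ℤ × ℤ} (hd : d ∈ units)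
    (hd' : d - cutDir t ∈ units) {i : Fin 3} (hi : Piece p q i (cutPos p q t j))
    (hi' : Piece p q i (cutPos p q t j + d)) : rowDiff i d % 2 = 0 := by
  simp only [units, List.mem_cons, List.not_mem_nil, or_false] at hd
  fin_cases t <;> rcases hd with rfl | rfl | rfl | rfl | rfl | rfl <;>
    first
    | exact absurd hd' (by decide)
    | (fin_cases i <;> first | rfl | (simp only [cutPos, cutLen, Piece, Prod.mk_add_mk] at *; omega))

theorem rowDiff_behind_cut (hpq : 1 < p + q) (hp : 0 < p) (hj : 0 < cutLen p q t) {d : ℤ × ℤ}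
    (hd : d ∈ units) (hd' : d = -cutDir t ∨ d - -cutDir t ∈ units) {i : Fin 3}
    (hi : Piece p q i (cutPos p q t (0 + 1))) (hi' : Piece p q i (cutPos p q t (0 + 1) + d)) :
    ¬ rowDiff i d % 2 = 0 := by
  simp only [units, List.mem_cons, List.not_mem_nil, or_false] at hd
  fin_cases t <;> rcases hd with rfl | rfl | rfl | rfl | rfl | rfl <;>
    first
    | exact absurd hd' (by decide)
    | (fin_cases i <;> first
        | decide
        | (simp only [cutPos, cutLen, Piece, Prod.mk_add_mk] at *; omega))

theorem nonCorner_or (hp : 0 < p) (hpq : 1 < p + q) (hα : α.1 = 0) (hj : j < cutLen p q t) :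
    NonCorner (cutFace p q α t j) ∨ (j = 0 ∧ NonCorner (cutFace p q α t (0 + 1))) := by
  rcases Nat.eq_zero_or_pos j with rfl | h0
  · refine Or.inr ⟨rfl, nonCorner_cutFace hp hα hj (by omega) ?_⟩
    fin_cases t <;> simp only [cutLen] at hj ⊢ <;> omega
  · exact Or.inl (nonCorner_cutFace hp hα hj.le h0 (by omega))

theorem cutFace_adj (hp : 0 < p) (hpq : 1 < p + q) (hα : α.1 = 0) (hj : j < cutLen p q t) :
    (fullereneFaceGraph p q).Adj (cutFace p q α t j) (cutFace p q α t (j + 1)) := by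
  rcases nonCorner_or hp hpq hα hj with h | ⟨rfl, h⟩
  · obtain ⟨X, hX, -, h1, -⟩ := exists_cutChart hp hα hj.le h
    rw [h1 hj]
    exact hX.adj _ (cutDir_mem t)
  · obtain ⟨X, hX, -, -, h1⟩ := exists_cutChart hp hα hj h
    rw [h1 0 rfl]
    exact (hX.adj _ (neg_mem_units (cutDir_mem t))).symm

theorem isStraight_cutFace (hp : 0 < p) (hα : α.1 = 0) (hj : j + 1 < cutLen p q t) :
    IsStraight (fullereneFaceGraph p q) (cutFace p q α t j) (cutFace p q α t (j + 1))
      (cutFace p q α t (j + 2)) := by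
  obtain ⟨X, hX, -, h1, h2⟩ := exists_cutChart hp hα hj.le
    (nonCorner_cutFace hp hα hj.le (by omega) (by omega))
  have := hX.isStraight (neg_mem_units (cutDir_mem t))
  rwa [neg_neg, ← h1 hj, ← h2 j rfl] at this

/-- At a hexagon of the cut this is read off its local chart. A pentagon has none; there the chart
of the next face shows that both the pentagon and `x` differ in parity from that face, hence agree
with each other. -/
theorem eps_eq_beside_cut (hp : 0 < p) (hpq : 1 < p + q) (hα : α.1 = 0) (hj : j < cutLen p q t)
    (h1 : (fullereneFaceGraph p q).Adj x (cutFace p q α t j))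
    (h2 : (fullereneFaceGraph p q).Adj x (cutFace p q α t (j + 1))) :
    eps x = eps (cutFace p q α t j) := by
  rcases nonCorner_or hp hpq hα hj with h | ⟨rfl, h⟩
  · obtain ⟨X, hX, hr, hn, -⟩ := exists_cutChart hp hα hj.le h
    obtain ⟨d, hd, rfl⟩ := hX.exists_of_adj _ h1.symm
    rw [hn hj] at h2
    have hd' := hX.sub_mem _ (cutDir_mem t) _ hd h2.symm
    obtain ⟨i, hi, hi', hiff⟩ := hr d hd
    exact hiff.2 (rowDiff_beside_cut hj hd hd' hi hi')
  · obtain ⟨X, hX, hr, -, hn⟩ := exists_cutChart hp hα hj h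
    obtain ⟨d, hd, rfl⟩ := hX.exists_of_adj _ h2.symm
    have hn0 := hn 0 rfl
    have hm := neg_mem_units (cutDir_mem t)
    rw [hn0] at h1 ⊢
    have hd' := hX.sub_mem _ hm _ hd h1.symm
    obtain ⟨i, hi, hi', hiff⟩ := hr d hd
    obtain ⟨i₀, hi₀, hi₀', hiff₀⟩ := hr _ hm
    have k := mt hiff.1 (rowDiff_behind_cut hpq hp hj hd (Or.inr hd') hi hi')
    have k₀ := mt hiff₀.1 (rowDiff_behind_cut hpq hp hj hm (Or.inl rfl) hi₀ hi₀')
    have key : ∀ a b c : ZMod 2, a ≠ c → b ≠ c → a = b := by decide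
    exact key _ _ _ k k₀

theorem exists_cutPos {y : ℤ × ℤ} (hp : 0 < p) (hy : InCap p q y) (h : ¬ OffCut p q y) :
    ∃ t, ∃ j ≤ cutLen p q t, y = cutPos p q t j := by
  obtain ⟨m, n⟩ := y
  have hb := hy.bounds hp
  simp only [OffCut] at h hb
  by_cases h0 : m = 0 ∧ n ≤ p + q
  · refine ⟨0, n.toNat, ?_, ?_⟩
    · simp only [cutLen]; omega
    · simp only [cutPos, Prod.mk.injEq]; omega
  by_cases h1 : 0 ≤ m ∧ m + n = p + q
  · refine ⟨1, (p - m).toNat, ?_, ?_⟩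
    · simp only [cutLen]; omega
    · simp only [cutPos, Prod.mk.injEq]; omega
  · refine ⟨2, (m + q).toNat, ?_, ?_⟩
    · simp only [cutLen]; omega
    · simp only [cutPos, Prod.mk.injEq]; omega

theorem NonCorner.exists_straight (hp : 0 < p) (hf : NonCorner f)
    (hcut : ∀ α t, α.1 = 0 → f ∉ cutList p q α t) :
    ∃ u w, IsStraight (fullereneFaceGraph p q) u f w ∧ (rowGraph p q).Adj f u ∧
      (rowGraph p q).Adj f w := by
  obtain ⟨X, hX, d, hd, hr⟩ : ∃ X, LocalChart (fullereneFaceGraph p q) f X ∧ ∃ d₀ ∈ units,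
      ∀ d ∈ units, (eps (X d) = eps f ↔ d = d₀ ∨ d = -d₀) := by
    rcases f.exists_position with ⟨A, y, hA, hc⟩ | ⟨hcap, e, u, y, x, hF, hl⟩
    · have hoff : OffCut p q y := by
        by_contra hon
        obtain ⟨t, j, hj, rfl⟩ := exists_cutPos hp hc.inCap hon
        exact hcut _ t hA (mem_cutList.2 ⟨j, hj, (capFace_cutFace hA hj).face_unique hA hc⟩)
      obtain ⟨X, hX, hX'⟩ := hc.exists_rowChart hp hA hf
      obtain ⟨e, he, he'⟩ := hoff.exists_direction
      refine ⟨X, hX, e, he, fun d hd => ?_⟩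
      obtain ⟨⟨i, hi, -, hr⟩, -⟩ := hX' d hd
      exact hr.trans (he' d hd i hi)
    · exact hl.exists_rowChart hp hF hcap hf
  have hn := neg_mem_units hd
  exact ⟨X d, X (-d), hX.isStraight hd, ⟨hX.adj _ hd, ((hr _ hd).2 (Or.inl rfl)).symm⟩,
    ⟨hX.adj _ hn, ((hr _ hn).2 (Or.inr rfl)).symm⟩⟩

end

theorem infix_map_range {V : Type*} {F : ℕ → V} {n : ℕ} {l : List V}
    (h : l <:+: (List.range n).map F) :
    ∃ j, j + l.length ≤ n ∧ ∀ i (hi : i < l.length), l[i] = F (j + i) := by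
  obtain ⟨k, hk, h⟩ := List.infix_iff_getElem?.1 h
  rw [List.length_map, List.length_range] at hk
  refine ⟨k, by omega, fun i hi => ?_⟩
  have := h i hi
  rw [List.getElem?_map, List.getElem?_range (by omega)] at this
  simp only [Option.map_some, Option.some.injEq] at this
  rw [← this, add_comm]

section
variable {p q : ℕ} {α : Cls} {t : Fin 3}

theorem pair_infix_cutList {v y : FullereneFace p q} (h : [v, y] <:+: cutList p q α t) :
    ∃ j < cutLen p q t, v = cutFace p q α t j ∧ y = cutFace p q α t (j + 1) := by
  obtain ⟨j, hj, h⟩ := infix_map_range h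
  simp only [List.length_cons, List.length_nil] at hj h
  exact ⟨j, by omega, h 0 (by omega), h 1 (by omega)⟩

theorem isLatticeSegment_cutList (hp : 0 < p) (hpq : 1 < p + q) (hα : α.1 = 0) :
    IsLatticeSegment (fullereneFaceGraph p q) (cutList p q α t) := by
  refine ⟨?_, ?_, ?_⟩
  · refine List.Nodup.map_on (fun i hi j hj h => ?_) List.nodup_range
    rw [List.mem_range] at hi hj
    rcases cutFace_position_unique hp hα (by omega) (by omega) h with h | h <;> omega
  · rw [cutList, List.isChain_map, List.isChain_range]
    intro j hj
    exact cutFace_adj hp hpq hα (by omega)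
  · intro u v w h
    obtain ⟨j, hj, h⟩ := infix_map_range h
    simp only [List.length_cons, List.length_nil] at hj h
    have h0 : u = _ := h 0 (by omega)
    have h1 : v = _ := h 1 (by omega)
    have h2 : w = _ := h 2 (by omega)
    rw [h0, h1, h2]
    exact isStraight_cutFace hp hα (by omega)

theorem head_cutList : (cutList p q α t).head? = some (cutFace p q α t 0) := by
  simp [cutList, List.range_succ_eq_map]

theorem getLast_cutList :
    (cutList p q α t).getLast? = some (cutFace p q α t (cutLen p q t)) := by
  simp [cutList, List.range_succ]

theorem exists_cut (hp : 0 < p) (hpq : 1 < p + q) :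
    ∃ cut : FullereneFace p q → List (FullereneFace p q),
      (∀ a, ¬ IsHexagon (fullereneFaceGraph p q) a → ∃ α t, α.1 = 0 ∧ a = cutFace p q α t 0 ∧
        cut a = cutList p q α t) ∧
      ∀ α t, α.1 = 0 → ∃ a, ¬ IsHexagon (fullereneFaceGraph p q) a ∧ cut a = cutList p q α t := by
  have h : ∀ a : FullereneFace p q, ∃ l : List (FullereneFace p q),
      ¬ IsHexagon (fullereneFaceGraph p q) a → ∃ α t, α.1 = 0 ∧ a = cutFace p q α t 0 ∧
        l = cutList p q α t := by
    intro a
    by_cases ha : NonCorner a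
    · exact ⟨[], fun h => absurd (ha.isHexagon hp) h⟩
    · simp only [NonCorner, not_forall, not_not] at ha
      obtain ⟨v, hv⟩ := ha
      obtain ⟨α, t, hα, rfl⟩ := exists_capCorner v
      exact ⟨_, fun _ => ⟨α, t, hα, face_eq_of_corner hv (cutFace_corner hα t), rfl⟩⟩
  choose cut hcut using h
  refine ⟨cut, hcut, fun α t hα => ?_⟩
  have ha := not_isHexagon_of_corner hp (cutFace_corner (p := p) (q := q) hα t)
  refine ⟨_, ha, ?_⟩
  obtain ⟨α', t', hα', h1, h2⟩ := hcut _ ha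
  obtain rfl := cutFace_class_unique hp hα hα' (Nat.zero_le _) (Nat.zero_le _) h1
  rcases cutFace_position_unique hp hα (Nat.zero_le _) (Nat.zero_le _) h1 with ⟨rfl, -⟩ | ⟨e1, e2⟩
  · exact h2
  · rw [h2]
    fin_cases t <;> fin_cases t' <;> simp only [cutLen] at e1 e2 <;> first | rfl | omega

theorem exists_cutSystem (hp : 0 < p) : ∃ cut, IsCutSystem (fullereneFaceGraph p q) cut ∧
    (∀ v, IsHexagon (fullereneFaceGraph p q) v →
      (∀ a, ¬ IsHexagon (fullereneFaceGraph p q) a → v ∉ cut a) →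
      ∃ u w, IsStraight (fullereneFaceGraph p q) u v w ∧ (rowGraph p q).Adj v u ∧
        (rowGraph p q).Adj v w) ∧
    ∀ v a y, ¬ IsHexagon (fullereneFaceGraph p q) a → [v, y] <:+: cut a →
      ∀ x, (fullereneFaceGraph p q).Adj x v → (fullereneFaceGraph p q).Adj x y →
        (rowGraph p q).Adj v x := by
  by_cases hpq : 1 < p + q
  · obtain ⟨cut, hcut, hcut'⟩ := exists_cut (q := q) hp hpq
    refine ⟨cut, ⟨fun a ha => ?_, fun a b ha hb hab x hxa hxb => ?_⟩, fun v hv h => ?_,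
      fun v a y ha h x h1 h2 => ?_⟩
    · obtain ⟨α, t, hα, rfl, hl⟩ := hcut a ha
      rw [hl]
      exact ⟨head_cutList, isLatticeSegment_cutList hp hpq hα⟩
    · obtain ⟨α, t, hα, h1, hl⟩ := hcut a ha
      obtain ⟨α', t', hα', h1', hl'⟩ := hcut b hb
      rw [hl] at hxa ⊢
      rw [hl'] at hxb ⊢
      obtain ⟨j, hj, rfl⟩ := mem_cutList.1 hxa
      obtain ⟨j', hj', e⟩ := mem_cutList.1 hxb
      obtain rfl := cutFace_class_unique hp hα hα' hj hj' e.symm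
      rcases cutFace_position_unique hp hα hj hj' e.symm with ⟨rfl, -⟩ | ⟨k, k'⟩
      · exact absurd (h1.trans h1'.symm) hab
      · rw [getLast_cutList, getLast_cutList, ← e, ← k', e, ← k]
        exact ⟨rfl, rfl⟩
    · refine NonCorner.exists_straight hp (fun w hw => not_isHexagon_of_corner hp hw hv) ?_
      intro α t hα hmem
      obtain ⟨a, ha, hl⟩ := hcut' α t hα
      exact h a ha (hl ▸ hmem)
    · obtain ⟨α, t, hα, -, hl⟩ := hcut a ha
      rw [hl] at h
      obtain ⟨j, hj, rfl, rfl⟩ := pair_infix_cutList h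
      exact ⟨h1.symm, (eps_eq_beside_cut hp hpq hα hj h1 h2).symm⟩
  -- Now p = 1 and q = 0: all faces are pentagons, and each cut is a single face.
  · refine ⟨fun a => [a], ⟨fun a ha => ⟨rfl, by simp, by simp, fun u v w h => ?_⟩,
      fun a b ha hb hab x hxa hxb => ?_⟩, fun v hv h => ?_, fun v a y ha h x h1 h2 => ?_⟩
    · exact absurd h.length_le (by simp)
    · simp only [List.mem_singleton] at hxa hxb
      exact absurd (hxa.symm.trans hxb) hab
    · exfalso
      have hv' : NonCorner v := fun w hw => not_isHexagon_of_corner hp hw hv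
      obtain ⟨a, b, c, x, hc, hx, hfx⟩ := v.2
      have hw := hv'.weight_le hp hc hx hfx
      have hs := weight_sum p q x
      obtain rfl : p = 1 := by omega
      obtain rfl : q = 0 := by omega
      simp only [latNorm] at hw hs
      norm_num at hw hs
      omega
    · exact absurd h.length_le (by simp)

end

/-! ### The coloring -/

theorem finite_fullereneFace {p : ℕ} (q : ℕ) (hp : 0 < p) : Finite (FullereneFace p q) := by
  have : Set.Finite {f : IcoVertex → ℤ | ∃ a b c x, IsCell a b c ∧ InCell p q x ∧
      f = cellPoint p q a b c x} := by
    have hfin : ((Set.univ : Set (IcoVertex × IcoVertex × IcoVertex)) ×ˢ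
        (Set.Icc (-(q : ℤ)) p ×ˢ Set.Icc (0 : ℤ) (p + q))).Finite :=
      Set.finite_univ.prod ((Set.finite_Icc _ _).prod (Set.finite_Icc _ _))
    refine (hfin.image fun s => cellPoint p q s.1.1 s.1.2.1 s.1.2.2 s.2).subset ?_
    rintro f ⟨a, b, c, x, -, hx, rfl⟩
    obtain ⟨h1, -, h3, h4, h5, -⟩ := hx.bounds hp
    exact ⟨((a, b, c), x), ⟨Set.mem_univ _, ⟨h4, h3⟩, h1, h5⟩, rfl⟩
  exact this.to_subtype

/-- The color of a face with given parities of its row and of its position in the row. -/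
def parityColor (e : ZMod 2) (d : Fin 2) : Fin 4 :=
  if e = 0 then d.castLE (by decide) else Fin.natAdd 2 d

/-- The two colors of the faces in rows of given parity. -/
def parityColors (e : ZMod 2) : Finset (Fin 4) :=
  if e = 0 then {0, 1} else {2, 3}

section
variable {p q : ℕ} {f g : FullereneFace p q}

theorem eps_eq_of_reachable (h : (rowGraph p q).Reachable f g) : eps f = eps g := by
  obtain ⟨w⟩ := h
  induction w with
  | nil => rfl
  | cons h _ ih => exact h.2.trans ih

/-- The parity `eps` is constant on an orbit, so any adjacency between two of its faces is an edge
of `rowGraph`: the induced graph has no further edges. -/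
theorem isPathOrEvenCycle_orbit (hp : 0 < p) (y : FullereneFace p q) :
    IsPathOrEvenCycle (fullereneFaceGraph p q) {x | (rowGraph p q).Reachable x y} := by
  have := finite_fullereneFace q hp
  set O := {x | (rowGraph p q).Reachable x y} with hO
  have hrow : ∀ u v : O, ((fullereneFaceGraph p q).induce O).Adj u v →
      (rowGraph p q).Adj u v := fun u v h =>
    ⟨h, (eps_eq_of_reachable u.2).trans (eps_eq_of_reachable v.2).symm⟩
  have hy : y ∈ O := SimpleGraph.Reachable.refl y
  refine path_or_even_cycle (H := (fullereneFaceGraph p q).induce O) ?_ ?_ ?_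
  · have key : ∀ {u v : FullereneFace p q} (_ : (rowGraph p q).Walk u v) (hu : u ∈ O)
        (hv : v ∈ O), ((fullereneFaceGraph p q).induce O).Reachable ⟨u, hu⟩ ⟨v, hv⟩ := by
      intro u v w
      induction w with
      | nil => exact fun _ _ => SimpleGraph.Reachable.refl _
      | @cons u u' v h w ih =>
        intro hu hv
        have hu' : u' ∈ O := (h.symm.reachable).trans hu
        exact (SimpleGraph.Adj.reachable (G := (fullereneFaceGraph p q).induce O)
          (u := ⟨u, hu⟩) (v := ⟨u', hu'⟩) h.1).trans (ih hu' hv)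
    have : Nonempty O := ⟨⟨y, hy⟩⟩
    refine SimpleGraph.Connected.mk fun u v => ?_
    obtain ⟨w⟩ := (show (rowGraph p q).Reachable u.1 y from u.2).trans
      (show (rowGraph p q).Reachable v.1 y from v.2).symm
    exact key w u.2 v.2
  · intro a b c d hb hc hd
    rcases row_degree hp (hrow _ _ hb) (hrow _ _ hc) (hrow _ _ hd) with h | h | h
    · exact Or.inl (Subtype.ext h)
    · exact Or.inr (Or.inl (Subtype.ext h))
    · exact Or.inr (Or.inr (Subtype.ext h))
  · obtain ⟨C⟩ := rowGraph_colorable (q := q) hp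
    exact ⟨SimpleGraph.Coloring.mk (fun v => C v.1) fun {u v} h => C.valid (hrow u v h)⟩

/-- If adjacent faces lie in different orbits, their row parities differ, since equal parities would
join them in `rowGraph`. So the color pairs of the orbits are complementary. -/
theorem exists_orbitalColoring_of_pos (hp : 0 < p) :
    ∃ c : (fullereneFaceGraph p q).Coloring (Fin 4),
      IsOrbitalColoring (fullereneFaceGraph p q) c := by
  classical
  obtain ⟨C⟩ := rowGraph_colorable (q := q) hp
  obtain ⟨cut, hcut, h1, h2⟩ := exists_cutSystem (q := q) hp
  have k1 : ∀ a b : ZMod 2, ∀ d d', a ≠ b ∨ d ≠ d' → parityColor a d ≠ parityColor b d' := by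
    decide
  have k2 : ∀ a d, parityColor a d ∈ parityColors a := by decide
  have k3 : ∀ a, (parityColors a).card = 2 := by decide
  have k4 : ∀ a b, a ≠ b → parityColors b = (parityColors a)ᶜ := by decide
  have hcol : ∀ {u v : FullereneFace p q}, (fullereneFaceGraph p q).Adj u v →
      parityColor (eps u) (C u) ≠ parityColor (eps v) (C v) := by
    intro u v h
    by_cases he : eps u = eps v
    · exact k1 _ _ _ _ (Or.inr (C.valid ⟨h, he⟩))
    · exact k1 _ _ _ _ (Or.inl he)
  set colors : Set (FullereneFace p q) → Finset (Fin 4) := fun O =>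
    if ∃ v ∈ O, eps v = 0 then parityColors 0 else parityColors 1 with hcolors
  have hclass : ∀ O ∈ (rowGraph p q).reachableSetoid.classes,
      ∃ y, O = {x | (rowGraph p q).Reachable x y} := fun O ⟨y, hy⟩ => ⟨y, hy⟩
  have hcolors' : ∀ O ∈ (rowGraph p q).reachableSetoid.classes, ∀ v ∈ O,
      colors O = parityColors (eps v) := by
    intro O hO v hv
    obtain ⟨y, rfl⟩ := hclass O hO
    have key : ∀ w, (rowGraph p q).Reachable w y → eps w = eps v := fun w hw =>
      eps_eq_of_reachable (hw.trans (SimpleGraph.Reachable.symm hv))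
    by_cases h0 : eps v = 0
    · rw [hcolors, h0]
      exact if_pos ⟨v, hv, h0⟩
    · have h1 : eps v = 1 := by
        have : ∀ a : ZMod 2, a ≠ 0 → a = 1 := by decide
        exact this _ h0
      rw [hcolors, h1]
      exact if_neg fun ⟨w, hw, hw0⟩ => h0 ((key w hw).symm.trans hw0)
  refine ⟨SimpleGraph.Coloring.mk (fun v => parityColor (eps v) (C v)) hcol, cut,
    (rowGraph p q).reachableSetoid.classes, colors, hcut, Setoid.isPartition_classes _,
    ⟨?_, ?_⟩, ?_, ?_, ?_⟩
  · intro O hO v hv hv6 hoff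
    obtain ⟨y, rfl⟩ := hclass O hO
    obtain ⟨u, w, hs, hu, hw⟩ := h1 v hv6 hoff
    exact ⟨u, hu.symm.reachable.trans hv, w, hw.symm.reachable.trans hv, hs⟩
  · intro O hO v hv a y ha hvy x hxv hxy
    obtain ⟨z, rfl⟩ := hclass O hO
    exact (h2 v a y ha hvy x hxv hxy).symm.reachable.trans hv
  · intro O hO
    obtain ⟨y, rfl⟩ := hclass O hO
    exact isPathOrEvenCycle_orbit hp y
  · intro O hO
    refine ⟨?_, fun v hv => ?_⟩
    · obtain ⟨y, rfl⟩ := hclass O hO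
      rw [hcolors' _ hO y (SimpleGraph.Reachable.refl y)]
      exact k3 _
    · rw [hcolors' O hO v hv]
      exact k2 _ _
  · intro O hO O' hO' hne ⟨u, hu, v, hv, huv⟩
    rw [hcolors' O hO u hu, hcolors' O' hO' v hv]
    refine k4 _ _ fun he => hne ?_
    obtain ⟨y, rfl⟩ := hclass O hO
    obtain ⟨y', rfl⟩ := hclass O' hO'
    have huv' : (rowGraph p q).Reachable u v := SimpleGraph.Adj.reachable ⟨huv, he⟩
    have hyy : (rowGraph p q).Reachable y y' :=
      (SimpleGraph.Reachable.symm hu).trans (huv'.trans hv)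
    ext x
    exact ⟨fun h => SimpleGraph.Reachable.trans h hyy,
      fun h => SimpleGraph.Reachable.trans h hyy.symm⟩

end

/-! ### The case of parameters `(0, q)` -/

/-- The rotation of the plane by `-60°`. -/
def rotInv (x : ℤ × ℤ) : ℤ × ℤ := (x.1 + x.2, -x.1)

section
variable {q : ℕ}

theorem rotInv_surjective : Function.Surjective rotInv := fun x =>
  ⟨(-x.2, x.1 + x.2), by ext <;> simp [rotInv]⟩

theorem weight_rotInv (q : ℕ) (x : ℤ × ℤ) : weightA q 0 (rotInv x) = weightA 0 q x ∧
    weightB q 0 (rotInv x) = weightB 0 q x ∧ weightC q 0 (rotInv x) = weightC 0 q x := by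
  simp only [weightA, weightB, weightC, latNorm, rotInv]
  push_cast
  refine ⟨?_, ?_, ?_⟩ <;> ring

theorem inCell_rotInv {x : ℤ × ℤ} : InCell q 0 (rotInv x) ↔ InCell 0 q x := by
  obtain ⟨h1, h2, h3⟩ := weight_rotInv q x
  rw [InCell, InCell, h1, h2, h3]

theorem cellPoint_rotInv (a b c : IcoVertex) (x : ℤ × ℤ) :
    cellPoint q 0 a b c (rotInv x) = cellPoint 0 q a b c x := by
  obtain ⟨h1, h2, h3⟩ := weight_rotInv q x
  funext v
  simp only [cellPoint]
  rw [h1, h2, h3]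

theorem latNorm_rotInv_sub (x y : ℤ × ℤ) :
    latNorm (rotInv y - rotInv x) = latNorm (y - x) := by
  simp only [latNorm, rotInv, Prod.fst_sub, Prod.snd_sub]
  ring

theorem rotInv_flip (q : ℕ) (y : ℤ × ℤ) :
    ((q : ℤ), ((0 : ℕ) : ℤ)) - rotInv y = rotInv ((((0 : ℕ) : ℤ), (q : ℤ)) - y) := by
  ext <;> simp [rotInv]; ring

end

/-- A function on the vertices of the icosahedron which describes a face. -/
def IsFace (p q : ℕ) (f : IcoVertex → ℤ) : Prop :=
  ∃ a b c x, IsCell a b c ∧ InCell p q x ∧ f = cellPoint p q a b c x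

/-- The functions `f` and `g` describe faces at distance one. -/
def FaceRel (p q : ℕ) (f g : IcoVertex → ℤ) : Prop :=
  ∃ a b c x y, IsCell a b c ∧ InCell p q x ∧ f = cellPoint p q a b c x ∧ latNorm (y - x) = 1 ∧
    ((InCell p q y ∧ g = cellPoint p q a b c y) ∨
      ∃ d, IsCell b a d ∧ InCell p q (((p : ℤ), (q : ℤ)) - y) ∧
        g = cellPoint p q b a d (((p : ℤ), (q : ℤ)) - y))

theorem isFace_swap (q : ℕ) : IsFace 0 q = IsFace q 0 := by
  funext f
  refine propext (exists_congr fun a => exists_congr fun b => exists_congr fun c =>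
    Iff.trans ?_ rotInv_surjective.exists.symm)
  simp only [inCell_rotInv, cellPoint_rotInv]

theorem faceRel_swap (q : ℕ) : FaceRel 0 q = FaceRel q 0 := by
  funext f g
  refine propext (exists_congr fun a => exists_congr fun b => exists_congr fun c =>
    Iff.trans ?_ rotInv_surjective.exists.symm)
  refine exists_congr fun x => Iff.trans ?_ rotInv_surjective.exists.symm
  simp only [inCell_rotInv, cellPoint_rotInv, latNorm_rotInv_sub, rotInv_flip]

/-- The triangles with parameters (0, q) and (q, 0) differ by a rotation by 60°, which preserves
barycentric coordinates. Thus both fullerenes are given by the same set of functions and the same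
relation, and the coloring transfers by substitution. -/
theorem exists_orbitalColoring_swap (q : ℕ)
    (h : ∃ c : (fullereneFaceGraph q 0).Coloring (Fin 4),
      IsOrbitalColoring (fullereneFaceGraph q 0) c) :
    ∃ c : (fullereneFaceGraph 0 q).Coloring (Fin 4),
      IsOrbitalColoring (fullereneFaceGraph 0 q) c := by
  have key : ∀ (P P' : (IcoVertex → ℤ) → Prop) (R R' : (IcoVertex → ℤ) → (IcoVertex → ℤ) → Prop),
      P = P' → R = R' →
      (∃ c : (SimpleGraph.fromRel fun f g : {f // P' f} => R' f.1 g.1).Coloring (Fin 4),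
        IsOrbitalColoring _ c) →
      ∃ c : (SimpleGraph.fromRel fun f g : {f // P f} => R f.1 g.1).Coloring (Fin 4),
        IsOrbitalColoring _ c := by
    rintro P _ R _ rfl rfl h
    exact h
  exact key _ _ _ _ (isFace_swap q) (faceRel_swap q) h

/-- Every icosahedral fullerene has an orbital face coloring. -/
theorem theorem10 (p q : ℕ) (hpq : 0 < p + q) :
    ∃ c : (fullereneFaceGraph p q).Coloring (Fin 4),
      IsOrbitalColoring (fullereneFaceGraph p q) c := by
  rcases Nat.eq_zero_or_pos p with rfl | hp
  · exact exists_orbitalColoring_swap q (exists_orbitalColoring_of_pos (by omega))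
  · exact exists_orbitalColoring_of_pos hp
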